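/- **Theorem (Edge Reconstruction).** Let $d\ge 2$ and let $(V,E)$ be a finite simple graph with $V\subset\mathbb R^d$, $n=|V|$, $m=|E|$, that is *GP-immersed*: every $d+1$ points of $V$ are affinely independent; no three points of $V$ are collinear after the orthogonal projection $\pi$ to the $(e_1,e_2)$-plane; and the $e_2$-coordinates of the points of $V$ are distinct. An oracle returns, for every unit vector $s$, the augmented persistence diagram (dimensions $0$ and $1$, every simplex being exactly one event, points on the diagonal kept) of the lower-star filtration of $(V,E)$ by height in direction $s$. One request to the oracle takes time $\Pi$, and the returned data structure answers queries for the number of points with a given birth or death value in time $\Theta(\log n)$. Running time is measured in steps of a real RAM (arithmetic, comparisons and evaluations of angles, sine and cosine on reals, array accesses). Algorithm *find-edges* is given $V$ and the oracle. It requests the diagram in direction $-e_2$, computes the clockwise orders of the points of $V$ above and below each $v\in V$ (with respect to $e_2$, in the projection) by building the dual line arrangement, and the minimum angle $\theta$ defined by three points of $\pi(V)$. Then it treats the vertices $v$ by increasing $e_2$-coordinate. For each $v$, it reads off the number of edges going up from $v$ from the first diagram, and searches for these edges with a stack of arcs, starting with the arc of all vertices above $v$. An arc, which is a run of consecutive vertices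 in the clockwise order together with the number of edges from $v$ to them, is discarded if this number is $0$; all its vertices are joined to $v$ if the number equals the number of vertices; otherwise the arc is split into its first $\lceil k/2\rceil$ and last $\lfloor k/2\rfloor$ vertices, where $k$ is its number of vertices. For a split, let $\alpha$ be the angle of the last vertex in the first half, as seen from $v$, minus $\theta/2$; one diagram, in direction $(\cos(\alpha-\frac\pi2),\sin(\alpha-\frac\pi2),0,\dots,0)$, gives the indegree of $v$ in that direction, and the number of edges in the first half is this indegree minus the number of already known edges at $v$ whose angle is less than $\pi+\alpha$. 1. There is an absolute constant $C$ such that, for all such $d$, $(V,E)$ and $\Pi$, find-edges returns a list in which every edge of $E$, and nothing else, occurs exactly once, it uses at most $C\,(1+m\log n)$ diagrams, and it takes time at most $$C\bigl(n^2+(1+m\log n)(d+\Pi+\log n)\bigr).$$ (For $m\ge 1$ these are $O(m\log n)$ diagrams and $O(n^2+m\log n\,(d+\Pi+\log n))$ time.) 2. These bounds are attained in the worst case, as long as $m\le n^{2-\varepsilon}$ for a fixed $\varepsilon$: for every $\varepsilon>0$ there is $c>0$ such that, for all $d\ge2$ and all $n,m$ with $1\le m\le\binom n2$ and $m\le n^{2-\varepsilon}$,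 there is a GP-immersed graph in $\mathbb R^d$ with $n$ vertices and $m$ edges on which, for every $\Pi$, find-edges uses at least $c\,m\log n$ diagrams and takes time at least $c\,\bigl(n^2+m\log n\,(d+\Pi+\log n)\bigr)$. -/

import Mathlib

noncomputable section

namespace EdgeRec

/-! ### Graphs in general position and their augmented persistence diagrams -/

/-- The coordinate along `e₁`. -/
def e₁coord {d : ℕ} (hd : 2 ≤ d) (q : EuclideanSpace ℝ (Fin d)) : ℝ := q ⟨0, by omega⟩

/-- The coordinate along `e₂`. -/
def e₂coord {d : ℕ} (hd : 2 ≤ d) (q : EuclideanSpace ℝ (Fin d)) : ℝ := q ⟨1, by omega⟩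

/-- The orthogonal projection `π` onto the plane spanned by `e₁` and `e₂`. -/
def proj {d : ℕ} (hd : 2 ≤ d) (q : EuclideanSpace ℝ (Fin d)) : EuclideanSpace ℝ (Fin 2) :=
  !₂[e₁coord hd q, e₂coord hd q]

/-- General position of the vertex set `V = {p 0, …, p (n-1)}`; a graph is GP-immersed when its
vertex set satisfies this. -/
structure GPImmersed {d n : ℕ} (hd : 2 ≤ d) (p : Fin n → EuclideanSpace ℝ (Fin d)) : Prop where
  /-- every set of `d + 1` vertices is affinely independent -/
  affine : ∀ S : Finset (Fin n), S.card = d + 1 →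
    AffineIndependent ℝ (fun i : S => p i)
  /-- no three vertices are collinear after projection -/
  projected : ∀ i j k : Fin n, i ≠ j → j ≠ k → i ≠ k →
    ¬ Collinear ℝ {proj hd (p i), proj hd (p j), proj hd (p k)}
  /-- the heights in direction `e₂` are distinct -/
  heights : Function.Injective (fun i => e₂coord hd (p i))

/-- The augmented persistence diagram of a filtered graph: two multisets of points
`(birth, death)`, in dimensions zero and one; `⊤` is the death of a class that never dies. -/
structure APD where
  dim0 : Multiset (ℝ × WithTop ℝ)
  dim1 : Multiset (ℝ × WithTop ℝ)

/-- The height of an edge in the lower-star filtration of the vertex heights `h`. -/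
def edgeHeight {n : ℕ} (h : Fin n → ℝ) (e : Fin n × Fin n) : ℝ := max (h e.1) (h e.2)

/-- The birth height of the connected component of `v` in `H`: the least height in it. -/
def birth {n : ℕ} (h : Fin n → ℝ) (H : SimpleGraph (Fin n)) (v : Fin n) : ℝ :=
  sInf (h '' {u | H.Reachable v u})

open Classical in
/-- The events caused by the edges of a list, added one after the other to the graph `H`, followed
by the classes that never die.  An edge that joins two components is a death in dimension zero and
is paired with the birth of the younger of the two components; any other edge is a birth in
dimension one.  Every vertex is one birth, every edge is one event, and points on the diagonal are
kept. (A vertex that has not been born yet is an isolated vertex and takes part in no event.) -/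
def events {n : ℕ} (h : Fin n → ℝ) :
    SimpleGraph (Fin n) → List (Fin n × Fin n) → APD
  | H, [] =>
      { dim0 := (Finset.univ : Finset H.ConnectedComponent).val.map
          (fun K => (sInf (h '' K.supp), (⊤ : WithTop ℝ)))
        dim1 := 0 }
  | H, e :: l =>
      let D := events h (H ⊔ SimpleGraph.edge e.1 e.2) l
      if H.Reachable e.1 e.2 then
        { D with dim1 := (edgeHeight h e, ⊤) ::ₘ D.dim1 }
      else
        { D with dim0 := (max (birth h H e.1) (birth h H e.2),
            ((edgeHeight h e : ℝ) : WithTop ℝ)) ::ₘ D.dim0 }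

/-- A list of ordered pairs lists the edges of `G`, every edge once, in one orientation. -/
def ListsEdges {n : ℕ} (G : SimpleGraph (Fin n)) (l : List (Fin n × Fin n)) : Prop :=
  (l.map (fun e => s(e.1, e.2))).Nodup ∧
    ∀ e : Sym2 (Fin n), e ∈ l.map (fun e => s(e.1, e.2)) ↔ e ∈ G.edgeSet

/-- `D` is the augmented persistence diagram of the lower-star filtration in direction `s` of the
graph `G` with vertices `p`: its edges are added by increasing height, in any order among edges
of the same height. -/
def IsAPD {d n : ℕ} (p : Fin n → EuclideanSpace ℝ (Fin d)) (G : SimpleGraph (Fin n))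
    (s : EuclideanSpace ℝ (Fin d)) (D : APD) : Prop :=
  ∃ l : List (Fin n × Fin n), ListsEdges G l ∧
    l.Pairwise (fun e f =>
      edgeHeight (fun v => inner ℝ s (p v)) e ≤ edgeHeight (fun v => inner ℝ s (p v)) f) ∧
    D = events (fun v => inner ℝ s (p v)) ⊥ l

/-- An oracle for `(V, E)`: it answers every direction with the diagram in that direction. -/
def IsOracle {d n : ℕ} (p : Fin n → EuclideanSpace ℝ (Fin d)) (G : SimpleGraph (Fin n))
    (oracle : EuclideanSpace ℝ (Fin d) → APD) : Prop :=
  ∀ s, ‖s‖ = 1 → IsAPD p G s (oracle s)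

/-! ### Step counting

The algorithms are written for a real RAM: a `step` is a bounded amount of straight-line work
(arithmetic operations, comparisons and angle, sine or cosine evaluations on real numbers, array
and list cell accesses).  Work that depends on `n` or `d` is charged by `tick` or is a recursion
each of whose calls is charged.  A function `Fin n → α` stands for an array with `n` entries,
`Function.update` for a write to one of its cells. -/

/-- A result, the number of steps spent on it and the number of diagrams requested for it. -/
structure Run (α : Type) where
  val : α
  time : ℕ
  diagrams : ℕ

instance : Monad Run where
  pure a := ⟨a, 0, 0⟩
  bind r f := ⟨(f r.val).val, r.time + (f r.val).time, r.diagrams + (f r.val).diagrams⟩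

/-- Charge `k` steps. -/
def tick (k : ℕ) : Run Unit := ⟨(), k, 0⟩

/-- One step, with result `a`. -/
def step {α : Type} (a : α) : Run α := ⟨a, 1, 0⟩

/-- A request to the oracle, which takes `T` steps and supplies one diagram. -/
def ask {E : Type} (oracle : E → APD) (T : ℕ) (s : E) : Run APD := ⟨oracle s, T, 1⟩

/-- Look up the number of points of `D.dim1` that are born at `c`. The data structure returned by
the oracle answers such a query in logarithmic time. -/
def birthsAt (n : ℕ) (D : APD) (c : ℝ) : Run ℕ :=
  ⟨(D.dim1.map Prod.fst).count c, Nat.log 2 n + 1, 0⟩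

/-- Look up the number of points of `D.dim0` that die at `c`, also in logarithmic time. -/
def deathsAt (n : ℕ) (D : APD) (c : ℝ) : Run ℕ :=
  ⟨(D.dim0.map Prod.snd).count (c : WithTop ℝ), Nat.log 2 n + 1, 0⟩

/-- The indegree of a vertex with height `c`, read off from the diagram `D`. -/
def indegree (n : ℕ) (D : APD) (c : ℝ) : Run ℕ := do
  let b ← birthsAt n D c
  let k ← deathsAt n D c
  step (b + k)

/-! ### The clockwise orders around all vertices

The vertex `v` with plane coordinates `(x v, y v)` is dual to the line `z ↦ z * y v - x v`.  The
lines of `u` and `v` cross at `z = cut x y u v`, the cotangent of the angle of the line through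
`u` and `v`.  So the clockwise order of the vertices above `v`, and that of the vertices below
`v`, is the order of the crossings on the line of `v`.  The arrangement of the dual lines is built
by adding them by increasing slope, walking through the faces that the new line meets. -/

/-- The abscissa at which the dual lines of `u` and `v` cross. -/
def cut {n : ℕ} (x y : Fin n → ℝ) (u v : Fin n) : ℝ := (x u - x v) / (y u - y v)

/-- For every line, the doubly linked list of the lines that cross it, from left to right; `none`
is the end of the line on either side. -/
structure Links (n : ℕ) where
  nxt : Fin n → Option (Fin n) → Option (Fin n)
  prv : Fin n → Option (Fin n) → Option (Fin n)

/-- Link `w` into the list of the line `v`, right after `b`. -/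
def Links.insert {n : ℕ} (L : Links n) (v : Fin n) (b : Option (Fin n)) (w : Fin n) : Links n :=
  { nxt := Function.update L.nxt v
      (Function.update (Function.update (L.nxt v) (some w) (L.nxt v b)) b (some w))
    prv := Function.update L.prv v
      (Function.update (Function.update (L.prv v) (some w) b) (L.nxt v b) (some w)) }

/-- Insert `v` into a list of vertices that is sorted by height. -/
def insertByHeight {n : ℕ} (y : Fin n → ℝ) (v : Fin n) : List (Fin n) → Run (List (Fin n))
  | [] => step [v]
  | u :: l => do
      if ← step (decide (y v < y u)) then
        step (v :: u :: l)
      else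
        let l' ← insertByHeight y v l
        step (u :: l')

/-- Sort vertices by increasing height. -/
def sortByHeight {n : ℕ} (y : Fin n → ℝ) : List (Fin n) → Run (List (Fin n))
  | [] => step []
  | v :: l => do
      let l' ← sortByHeight y l
      insertByHeight y v l'

/-- Walk to the right along the upper boundary of a face, from the crossing with `b` on the line
`c`, up to the edge where the new line `k` leaves the face: `k` crosses the returned line right
after the returned crossing.  (The counter in this walk and in the next one bounds the number of
edges; a walk meets every line at most once.) -/
def walkRight {n : ℕ} (x y : Fin n → ℝ) (L : Links n) (k : Fin n) :
    ℕ → Fin n → Option (Fin n) → Run (Fin n × Option (Fin n))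
  | 0, c, b => pure (c, b)
  | f + 1, c, b => do
      let e ← step (L.nxt c b)
      match e with
      | none => pure (c, b)
      | some e =>
          if ← step (decide (cut x y k c < cut x y c e)) then
            pure (c, b)
          else
            walkRight x y L k f e (some c)

/-- Walk to the left along the lower boundary of a face, on the line `c` with `a` the next crossing
to the left, up to the left end of the face, and return the first edge of its upper boundary.  Here
`under c` is the line with the next smaller slope, which is the next line above `c` at `-∞`. -/
def walkLeft {n : ℕ} (y : Fin n → ℝ) (L : Links n) (under : Fin n → Option (Fin n)) :
    ℕ → Fin n → Option (Fin n) → Run (Fin n × Option (Fin n))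
  | 0, c, a => pure (c, a)
  | _ + 1, c, none => step ((under c).getD c, none)
  | f + 1, c, some a => do
      if ← step (decide (y c < y a)) then
        pure (a, some c)
      else
        let a' ← step (L.prv a (some c))
        walkLeft y L under f a a'

/-- Add the remaining `r` crossings of the new line `k`. The face that `k` is in has an upper
boundary that starts on the line `c` after the crossing with `b`, and the last crossing found on
`k` is `t`. -/
def addCrossings {n : ℕ} (x y : Fin n → ℝ) (under : Fin n → Option (Fin n)) (k : Fin n) :
    ℕ → Fin n → Option (Fin n) → Option (Fin n) → Links n → Run (Links n)
  | 0, _, _, _, L => pure L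
  | r + 1, c, b, t, L => do
      let q ← walkRight x y L k n c b
      let L₁ ← step (L.insert q.1 q.2 k)
      let L₂ ← step (L₁.insert k t q.1)
      let q' ← walkLeft y L₂ under n q.1 q.2
      addCrossings x y under k r q'.1 q'.2 (some q.1) L₂

/-- Add the lines of a list of vertices, by increasing slope. `last` is the last line added so far,
and `r` is the number of lines added so far. -/
def addLines {n : ℕ} (x y : Fin n → ℝ) :
    List (Fin n) → Option (Fin n) → ℕ → (Fin n → Option (Fin n)) → Links n → Run (Links n)
  | [], _, _, _, L => pure L
  | k :: l, last, r, under, L => do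
      let under' ← step (Function.update under k last)
      let L' ← match last with
        | none => pure L
        | some c => addCrossings x y under' k r c none none L
      addLines x y l (some k) (r + 1) under' L'

/-- Follow the list of the line `v` from the crossing `c` on and append the vertices above `v` to
`A` and those below `v` to `B`. -/
def readLine {n : ℕ} (y : Fin n → ℝ) (L : Links n) (v : Fin n) :
    ℕ → Option (Fin n) → Array (Fin n) → Array (Fin n) → Run (Array (Fin n) × Array (Fin n))
  | 0, _, A, B => pure (A, B)
  | _ + 1, none, A, B => pure (A, B)
  | f + 1, some c, A, B => do
      let c' ← step (L.nxt v (some c))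
      if ← step (decide (y v < y c)) then
        readLine y L v f c' (A.push c) B
      else
        readLine y L v f c' A (B.push c)

/-- The table of the pairs (vertices above `v`, vertices below `v`), both sorted clockwise. -/
def readLines {n : ℕ} (y : Fin n → ℝ) (L : Links n) :
    List (Fin n) → Run (Fin n → Array (Fin n) × Array (Fin n))
  | [] => do
      tick n
      pure (fun _ => (#[], #[]))
  | v :: l => do
      let tab ← readLines y L l
      let c ← step (L.nxt v none)
      let r ← readLine y L v n c #[] #[]
      step (Function.update tab v r)

/-- The clockwise orders of the vertices above and below every vertex; `order` is the list of all
vertices by increasing height.  The two tables of links take `n²` steps each to set up. -/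
def cyclicOrders {n : ℕ} (x y : Fin n → ℝ) (order : List (Fin n)) :
    Run (Fin n → Array (Fin n) × Array (Fin n)) := do
  tick (2 * n ^ 2 + n)
  let L ← addLines x y order none 0 (fun _ => none) ⟨fun _ _ => none, fun _ _ => none⟩
  readLines y L order

/-- The minimum of `best` and of the angles at `v` between consecutive vertices of a list. -/
def minGap {n : ℕ} (angleAt : Fin n → Fin n → Fin n → ℝ) (v : Fin n) :
    ℝ → List (Fin n) → Run ℝ
  | best, u :: w :: l => do
      let best' ← step (min best (angleAt u v w))
      minGap angleAt v best' (w :: l)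
  | best, _ => step best

/-- The minimum of `best` and of the angles at the given vertices between vertices that are
consecutive in the cyclic order around them. -/
def minAngle {n : ℕ} (angleAt : Fin n → Fin n → Fin n → ℝ)
    (cyc : Fin n → Array (Fin n) × Array (Fin n)) : ℝ → List (Fin n) → Run ℝ
  | best, [] => pure best
  | best, v :: l => do
      tick n
      let around ← step ((cyc v).1.toList ++ (cyc v).2.toList)
      let best' ← match around with
        | u :: w :: rest => minGap angleAt v best (u :: w :: rest ++ [u])
        | _ => pure best
      minAngle angleAt cyc best' l

/-! ### Edge arcs and the radial binary multi-search -/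

/-- The angle in `[0, 2π)` from the positive `e₁` axis to the vector `(a, b)`. -/
def angleOf (a b : ℝ) : ℝ := toIcoMod Real.two_pi_pos 0 (Complex.arg ⟨a, b⟩)

/-- An edge arc centred at a vertex `v`: its start and stop angles, its vertices (the entries
`lo, …, hi - 1` of the array of all vertices above `v`, in clockwise order, starting with entry
number zero), and the number of edges between `v` and these vertices. -/
structure EdgeArc (n : ℕ) where
  vert : Fin n
  α₁ : ℝ
  α₂ : ℝ
  lo : ℕ
  hi : ℕ
  count : ℤ

/-- The first of the positions `lo, …, hi - 1` of a decreasing array `a` whose entry is less than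
`t` (and `hi` if there is none), by binary search. -/
def firstBelow (a : ℕ → ℝ) (t : ℝ) (lo hi : ℕ) : Run ℕ :=
  if _h : lo < hi then do
    if ← step (decide (a ((lo + hi) / 2) < t)) then
      firstBelow a t lo ((lo + hi) / 2)
    else
      firstBelow a t ((lo + hi) / 2 + 1) hi
  else step lo
termination_by hi - lo

/-- The direction `(cos β, sin β, 0, …, 0)`, whose `d` entries are written one by one. -/
def planeDirection (d : ℕ) (β : ℝ) : Run (EuclideanSpace ℝ (Fin d)) := do
  tick d
  pure (WithLp.toLp 2 (fun i : Fin d =>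
    if i.val = 0 then Real.cos β else if i.val = 1 then Real.sin β else 0))

/-- Splitting an edge arc. `above` is the array of all vertices above the centre of the arc in
clockwise order; the edges that are known already (`bigedges`) are those to the vertices in `inV`,
followed by those to the vertices in `outV`; all these arrays are sorted clockwise, the largest
angle first. -/
def splitArc {d n : ℕ} (hd : 2 ≤ d) (p : Fin n → EuclideanSpace ℝ (Fin d))
    (oracle : EuclideanSpace ℝ (Fin d) → APD) (T : ℕ)
    (above inV outV : Array (Fin n)) (θ : ℝ) (A : EdgeArc n) : Run (EdgeArc n × EdgeArc n) := do
  let v := A.vert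
  let ang : Fin n → ℝ := fun u =>
    angleOf (e₁coord hd (p u) - e₁coord hd (p v)) (e₂coord hd (p u) - e₂coord hd (p v))
  let nv ← step (A.hi - A.lo)
  let mid ← step ((nv + 1) / 2)
  let α ← step (ang (above.getD (A.lo + mid - 1) v) - θ / 2)
  let s ← planeDirection d (α - Real.pi / 2)
  let D ← ask oracle T s
  tick d
  let c ← step (inner ℝ s (p v))
  let indeg ← indegree n D c
  let bigedges : ℕ → Fin n := fun i =>
    if i < inV.size then inV.getD i v else outV.getD (i - inV.size) v
  let i ← firstBelow (fun i => ang (bigedges i)) (Real.pi + α) 0 (inV.size + outV.size)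
  let ml ← step ((indeg : ℤ) - ((inV.size + outV.size - i : ℕ) : ℤ))
  let mr ← step (A.count - ml)
  let Al ← step { A with α₁ := α, hi := A.lo + mid, count := ml }
  let Ar ← step { A with α₂ := α, lo := A.lo + mid, count := mr }
  pure (Al, Ar)

/-- Append `k` consecutive entries of `above`, from position `i` on, to the array `outV`. -/
def appendFrom {n : ℕ} (above : Array (Fin n)) (v : Fin n) :
    ℕ → ℕ → Array (Fin n) → Run (Array (Fin n))
  | 0, _, outV => pure outV
  | k + 1, i, outV => do
      let outV' ← step (outV.push (above.getD i v))
      appendFrom above v k (i + 1) outV'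

/-- The loop over the stack of edge arcs. The first argument bounds the number of rounds. -/
def stackLoop {d n : ℕ} (hd : 2 ≤ d) (p : Fin n → EuclideanSpace ℝ (Fin d))
    (oracle : EuclideanSpace ℝ (Fin d) → APD) (T : ℕ)
    (above inV : Array (Fin n)) (θ : ℝ) :
    ℕ → List (EdgeArc n) → Array (Fin n) → Run (Array (Fin n))
  | 0, _, outV => pure outV
  | _ + 1, [], outV => step outV
  | f + 1, A :: stack, outV => do
      if ← step (decide (A.count = 0)) then
        stackLoop hd p oracle T above inV θ f stack outV
      else if ← step (decide (A.count = ((A.hi - A.lo : ℕ) : ℤ))) then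
        let outV' ← appendFrom above A.vert (A.hi - A.lo) A.lo outV
        stackLoop hd p oracle T above inV θ f stack outV'
      else
        let S ← splitArc hd p oracle T above inV outV θ A
        let stack' ← step (S.1 :: S.2 :: stack)
        stackLoop hd p oracle T above inV θ f stack' outV

/-- Finding the edges above `v`: the array of the upper ends of all outgoing edges of `v`, given the
vertices above `v`, the lower ends `inV` of its incoming edges, both in clockwise order, and the
diagram `D` in direction `-e₂`.  The first arc is the upper half-plane. (A binary tree with at most
`N ≥ 1` leaves has at most `2 * N - 1` nodes.) -/
def findUpEdges {d n : ℕ} (hd : 2 ≤ d) (p : Fin n → EuclideanSpace ℝ (Fin d))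
    (oracle : EuclideanSpace ℝ (Fin d) → APD) (T : ℕ)
    (v : Fin n) (above inV : Array (Fin n)) (θ : ℝ) (D : APD) : Run (Array (Fin n)) := do
  let c ← step (-(e₂coord hd (p v)))
  let indeg ← indegree n D c
  let A ← step
    { vert := v, α₁ := 0, α₂ := Real.pi, lo := 0, hi := above.size, count := (indeg : ℤ) }
  stackLoop hd p oracle T above inV θ (2 * above.size + 2) [A] #[]

/-! ### The main algorithm -/

/-- The entries of a list that are marked in the table row `mark`, appended to `B` in order. -/
def selectMarked {n : ℕ} (mark : Fin n → Bool) :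
    List (Fin n) → Array (Fin n) → Run (Array (Fin n))
  | [], B => pure B
  | u :: l, B => do
      if ← step (mark u) then
        selectMarked mark l (B.push u)
      else
        selectMarked mark l B

/-- Record the edges from `v` to the vertices of a list, in the list `E` of edges and in the table
`known`, whose row `u` marks the lower ends of the edges found so far with upper end `u`. -/
def recordEdges {n : ℕ} (v : Fin n) :
    List (Fin n) → List (Fin n × Fin n) → (Fin n → Fin n → Bool) →
      Run (List (Fin n × Fin n) × (Fin n → Fin n → Bool))
  | [], E, known => pure (E, known)
  | u :: l, E, known => do
      let known' ← step (Function.update known u (Function.update (known u) v true))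
      recordEdges v l ((v, u) :: E) known'

/-- The sweep over the vertices, by increasing height. -/
def sweep {d n : ℕ} (hd : 2 ≤ d) (p : Fin n → EuclideanSpace ℝ (Fin d))
    (oracle : EuclideanSpace ℝ (Fin d) → APD) (T : ℕ)
    (cyc : Fin n → Array (Fin n) × Array (Fin n)) (θ : ℝ) (D : APD) :
    List (Fin n) → List (Fin n × Fin n) → (Fin n → Fin n → Bool) →
      Run (List (Fin n × Fin n))
  | [], E, _ => pure E
  | v :: l, E, known => do
      let inV ← selectMarked (known v) (cyc v).2.toList #[]
      let outV ← findUpEdges hd p oracle T v (cyc v).1 inV θ D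
      let r ← recordEdges v outV.toList E known
      sweep hd p oracle T cyc θ D l r.1 r.2

/-- The algorithm find-edges. It is given the vertices `p` and can ask `oracle` for diagrams, each
of which takes `T` steps. It returns a list of edges. -/
def findEdges {d n : ℕ} (hd : 2 ≤ d) (p : Fin n → EuclideanSpace ℝ (Fin d))
    (oracle : EuclideanSpace ℝ (Fin d) → APD) (T : ℕ) : Run (List (Fin n × Fin n)) := do
  tick d
  let D ← ask oracle T (-(EuclideanSpace.single (⟨1, by omega⟩ : Fin d) (1 : ℝ)))
  let x : Fin n → ℝ := fun v => e₁coord hd (p v)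
  let y : Fin n → ℝ := fun v => e₂coord hd (p v)
  tick n
  let order ← sortByHeight y (List.finRange n)
  let cyc ← cyclicOrders x y order
  let θ ← minAngle
    (fun u v w => EuclideanGeometry.angle (proj hd (p u)) (proj hd (p v)) (proj hd (p w)))
    cyc Real.pi order
  tick (n ^ 2)
  sweep hd p oracle T cyc θ D order [] (fun _ _ => false)

end EdgeRec

end

/-!
# Edge reconstruction with a radial binary multi-search

**What a diagram tells.** Every edge of the filtered graph is exactly one event, at the height of
its upper end, whatever the order among edges of equal height (`count_events`). So, if the height
of `v` is not that of any other vertex, the events at this height count the edges from `v` to lower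
vertices (`indegree_spec`).

**The clockwise orders.** The vertex `v` is dual to the line `z ↦ z * y v - x v`, and the crossings
on this line, from left to right, give the vertices around `v`. The lines are added by increasing
slope, so that on the left of the new line `k` a face met by `k` is a polygon between a lower chain
of lines crossed already (`LowAt`) and an upper chain of lines not crossed yet (`UpAt`). One walk
follows the upper chain to the exit of `k`, the other one the lower chain of the next face to its
left end. Except for one edge per face, every edge traversed meets a further edge of its chain at
its left end (`TransL`, `TransR`), and a line has such an edge in the chain of at most one face
(`TransL.not_lowAt`, `TransR.not_upAt`): this is the amortisation of the zone theorem. Hence one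
line costs linear time and the arrangement quadratic time (`addCrossings_spec`,
`cyclicOrders_spec`).

**One split.** By `minAngle_separates`, the minimum angle `θ` is a lower bound for the gap between
two directions up from `v`; and by the angle sum of a triangle no direction down from `v` is
opposite to a direction that has been turned by `θ / 2` from a vertex. So the half-plane of a split
contains exactly the vertices of the left part of the arc and those to the left of it above `v`,
and the vertices below `v` whose angle is less than `π + α`. All edges from `v` to the latter are
known, since the sweep goes upwards, and those to the arcs on the left are known, since the stack
is processed from left to right (`indegree_split`, `splitArc_spec`, `stackLoop_spec`). Each vertex
therefore gets its correct upper neighbours (`findUpEdges_spec`), and cost and number of diagrams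
of the algorithm are determined, up to constants, by the number of splits (`findEdges_spec`).

**Counting splits.** The search tree for `g` entries among `k` splits only arcs that contain at
least one of them, on at most `⌈log₂ k⌉` levels, so it makes at most `g ⌈log₂ k⌉` splits
(`splits_le`). Conversely, if `k ≥ 2 ^ (j + i)` and `g ≤ 2 ^ j` entries are spread evenly, they are
in different arcs after `j` levels and each costs a split on `i` further levels, `g i` in all
(`exists_le_splits`).

**The worst case.** Points on the moment curve are in general position. Each of the
lower `n / 2` vertices sees at least about `n / 2` vertices above it. There, up to about
`n ^ (1 - ε)` edges go up from it, spread evenly, and each of them costs about `ε log n` splits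
(`exists_graph_mul_log_le`). For the finitely many `n` for which this is too small, `m log n` is
bounded and the diagram in direction `-e₂` alone suffices (`mul_log_le_of_log_le`).
-/

namespace EdgeRec

/-! ### Runs, sorting and binary search -/

section Run
variable {α β : Type}

@[simp] theorem Run.val_bind (r : Run α) (f : α → Run β) : (r >>= f).val = (f r.val).val := rfl
@[simp] theorem Run.time_bind (r : Run α) (f : α → Run β) :
    (r >>= f).time = r.time + (f r.val).time := rfl
@[simp] theorem Run.diagrams_bind (r : Run α) (f : α → Run β) :
    (r >>= f).diagrams = r.diagrams + (f r.val).diagrams := rfl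
@[simp] theorem Run.val_pure (a : α) : (pure a : Run α).val = a := rfl
@[simp] theorem Run.time_pure (a : α) : (pure a : Run α).time = 0 := rfl
@[simp] theorem Run.diagrams_pure (a : α) : (pure a : Run α).diagrams = 0 := rfl
@[simp] theorem val_step (a : α) : (step a).val = a := rfl
@[simp] theorem time_step (a : α) : (step a).time = 1 := rfl
@[simp] theorem diagrams_step (a : α) : (step a).diagrams = 0 := rfl
@[simp] theorem time_tick (k : ℕ) : (tick k).time = k := rfl
@[simp] theorem diagrams_tick (k : ℕ) : (tick k).diagrams = 0 := rfl
@[simp] theorem val_ask (o : α → APD) (T : ℕ) (s : α) : (ask o T s).val = o s := rfl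
@[simp] theorem time_ask (o : α → APD) (T : ℕ) (s : α) : (ask o T s).time = T := rfl
@[simp] theorem diagrams_ask (o : α → APD) (T : ℕ) (s : α) : (ask o T s).diagrams = 1 := rfl

end Run

variable {n : ℕ}

theorem insertByHeight_perm (y : Fin n → ℝ) (v : Fin n) (l : List (Fin n)) :
    (insertByHeight y v l).val.Perm (v :: l) := by
  induction l with
  | nil => simp [insertByHeight]
  | cons u l ih =>
    by_cases h : y v < y u
    · simp [insertByHeight, h]
    · simpa [insertByHeight, h] using (ih.cons u).trans (List.Perm.swap v u l)

theorem insertByHeight_sorted (y : Fin n → ℝ) (v : Fin n) (l : List (Fin n))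
    (hl : l.Pairwise (fun a b => y a ≤ y b)) :
    (insertByHeight y v l).val.Pairwise (fun a b => y a ≤ y b) := by
  induction l with
  | nil => simp [insertByHeight]
  | cons u l ih =>
    obtain ⟨hu, hl⟩ := List.pairwise_cons.1 hl
    by_cases h : y v < y u
    · simp only [insertByHeight, Run.val_bind, val_step, h, decide_true, if_true,
        List.pairwise_cons, List.mem_cons, forall_eq_or_imp]
      exact ⟨⟨h.le, fun a ha => h.le.trans (hu a ha)⟩, hu, hl⟩
    · simp only [insertByHeight, Run.val_bind, val_step, h, decide_false, Bool.false_eq_true,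
        if_false, List.pairwise_cons]
      refine ⟨fun a ha => ?_, ih hl⟩
      rcases List.mem_cons.1 ((insertByHeight_perm y v l).mem_iff.1 ha) with rfl | ha
      · exact not_lt.1 h
      · exact hu a ha

theorem insertByHeight_cost (y : Fin n → ℝ) (v : Fin n) (l : List (Fin n)) :
    (insertByHeight y v l).time ≤ 2 * l.length + 1 ∧ (insertByHeight y v l).diagrams = 0 := by
  induction l with
  | nil => simp [insertByHeight]
  | cons u l ih =>
    by_cases h : y v < y u
    · simp [insertByHeight, h]; omega
    · simp [insertByHeight, h, ih.2]; omega

theorem sortByHeight_perm (y : Fin n → ℝ) (l : List (Fin n)) :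
    (sortByHeight y l).val.Perm l := by
  induction l with
  | nil => simp [sortByHeight]
  | cons v l ih => exact (insertByHeight_perm y v _).trans (ih.cons v)

theorem sortByHeight_sorted (y : Fin n → ℝ) (l : List (Fin n)) :
    (sortByHeight y l).val.Pairwise (fun a b => y a ≤ y b) := by
  induction l with
  | nil => simp [sortByHeight]
  | cons v l ih => exact insertByHeight_sorted y v _ ih

theorem sortByHeight_cost (y : Fin n → ℝ) (l : List (Fin n)) :
    (sortByHeight y l).time ≤ l.length ^ 2 + 1 ∧ (sortByHeight y l).diagrams = 0 := by
  induction l with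
  | nil => simp [sortByHeight]
  | cons v l ih =>
    have h := insertByHeight_cost y v (sortByHeight y l).val
    have hl := (sortByHeight_perm y l).length_eq
    rw [hl] at h
    simp only [sortByHeight, Run.time_bind, Run.diagrams_bind, List.length_cons, h.2, ih.2]
    exact ⟨by nlinarith [h.1, ih.1], trivial⟩

/-- On an array whose entries below `t` form a final segment, binary search finds the start of that
segment. -/
theorem firstBelow_spec (a : ℕ → ℝ) (t : ℝ) (lo hi : ℕ) (hle : lo ≤ hi)
    (ha : ∀ i j, lo ≤ i → i ≤ j → j < hi → a i < t → a j < t) :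
    lo ≤ (firstBelow a t lo hi).val ∧ (firstBelow a t lo hi).val ≤ hi ∧
      (∀ j, lo ≤ j → j < (firstBelow a t lo hi).val → ¬ a j < t) ∧
      (∀ j, (firstBelow a t lo hi).val ≤ j → j < hi → a j < t) := by
  induction hm : hi - lo using Nat.strong_induction_on generalizing lo hi with
  | _ m ih =>
    rw [firstBelow]
    by_cases h : lo < hi
    · rw [dif_pos h]
      by_cases hc : a ((lo + hi) / 2) < t
      · simp only [Run.val_bind, val_step, hc, decide_true, if_true]
        obtain ⟨h1, h2, h3, h4⟩ := ih ((lo + hi) / 2 - lo) (by omega) lo ((lo + hi) / 2) (by omega)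
          (fun i j hi hij hj => ha i j hi hij (by omega)) rfl
        refine ⟨h1, by omega, h3, fun j hj hj' => ?_⟩
        by_cases hjm : j < (lo + hi) / 2
        · exact h4 j hj hjm
        · exact ha _ j (by omega) (by omega) hj' hc
      · simp only [Run.val_bind, val_step, hc, decide_false, Bool.false_eq_true, if_false]
        obtain ⟨h1, h2, h3, h4⟩ := ih (hi - ((lo + hi) / 2 + 1)) (by omega) ((lo + hi) / 2 + 1) hi
          (by omega) (fun i j hi hij hj => ha i j (by omega) hij hj) rfl
        refine ⟨by omega, h2, fun j hj hj' hlt => ?_, h4⟩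
        by_cases hjm : j < (lo + hi) / 2 + 1
        · exact hc (ha j _ hj (by omega) (by omega) hlt)
        · exact h3 j (by omega) hj' hlt
    · rw [dif_neg h]
      simp only [val_step]
      exact ⟨le_rfl, hle, fun j h1 h2 => by omega, fun j h1 h2 => by omega⟩

theorem firstBelow_cost (a : ℕ → ℝ) (t : ℝ) (lo hi k : ℕ) (hk : hi < lo + 2 ^ k) :
    (firstBelow a t lo hi).time ≤ k + 1 ∧ (firstBelow a t lo hi).diagrams = 0 := by
  induction k generalizing lo hi with
  | zero =>
    rw [firstBelow, dif_neg (by omega)]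
    simp
  | succ k ih =>
    rw [firstBelow]
    by_cases h : lo < hi
    · rw [dif_pos h]
      have h1 := ih lo ((lo + hi) / 2) (by omega)
      have h2 := ih ((lo + hi) / 2 + 1) hi (by omega)
      by_cases hc : a ((lo + hi) / 2) < t
      · simp only [Run.time_bind, Run.diagrams_bind, time_step, diagrams_step, val_step, hc,
          decide_true, if_true]
        omega
      · simp only [Run.time_bind, Run.diagrams_bind, time_step, diagrams_step, val_step, hc,
          decide_false, Bool.false_eq_true, if_false]
        omega
    · rw [dif_neg h]
      simp

/-! ### Neighbouring crossings on a line -/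

section Links
variable {n : ℕ}

/-- `o` is the last element of `S`, ordered by `f`, before the position `z`, which is not the
position of an element of `S`; `none` says that there is no such element. -/
def Prev (S : Finset (Fin n)) (f : Fin n → ℝ) (z : ℝ) : Option (Fin n) → Prop
  | none => ∀ w ∈ S, z < f w
  | some b => b ∈ S ∧ f b < z ∧ ∀ w ∈ S, f w ≤ f b ∨ z < f w

/-- `o` is the first element of `S`, ordered by `f`, after the position `z`. -/
def Next (S : Finset (Fin n)) (f : Fin n → ℝ) (z : ℝ) (o : Option (Fin n)) : Prop :=
  Prev S (fun w => -f w) (-z) o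

@[simp] theorem prev_none {S : Finset (Fin n)} {f : Fin n → ℝ} {z : ℝ} :
    Prev S f z none ↔ ∀ w ∈ S, z < f w := Iff.rfl

@[simp] theorem prev_some {S : Finset (Fin n)} {f : Fin n → ℝ} {z : ℝ} {b : Fin n} :
    Prev S f z (some b) ↔ b ∈ S ∧ f b < z ∧ ∀ w ∈ S, f w ≤ f b ∨ z < f w := Iff.rfl

@[simp] theorem next_none {S : Finset (Fin n)} {f : Fin n → ℝ} {z : ℝ} :
    Next S f z none ↔ ∀ w ∈ S, f w < z := by simp [Next]

@[simp] theorem next_some {S : Finset (Fin n)} {f : Fin n → ℝ} {z : ℝ} {b : Fin n} :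
    Next S f z (some b) ↔ b ∈ S ∧ z < f b ∧ ∀ w ∈ S, f b ≤ f w ∨ f w < z := by simp [Next]

/-- The successor function `nx` of a linked list of the elements of `S`, ordered by `f`. -/
def OneLink (S : Finset (Fin n)) (f : Fin n → ℝ) (nx : Option (Fin n) → Option (Fin n)) : Prop :=
  ∀ z o, Prev S f z o → Next S f z (nx o)

theorem Prev.unique {S : Finset (Fin n)} {f : Fin n → ℝ} {z : ℝ} {o o' : Option (Fin n)}
    (hf : Set.InjOn f S) (h : Prev S f z o) (h' : Prev S f z o') : o = o' := by
  rcases o with _ | b <;> rcases o' with _ | b'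
  · rfl
  · have := h b' h'.1
    have := h'.2.1
    linarith
  · have := h' b h.1
    have := h.2.1
    linarith
  · obtain ⟨h1, h2, h3⟩ := h
    obtain ⟨h1', h2', h3'⟩ := h'
    have e1 := (h3 b' h1').resolve_right (by linarith)
    have e2 := (h3' b h1).resolve_right (by linarith)
    rw [hf h1 h1' (le_antisymm e2 e1)]

theorem exists_prev (S : Finset (Fin n)) (f : Fin n → ℝ) (z : ℝ) (hz : ∀ w ∈ S, f w ≠ z) :
    ∃ o, Prev S f z o := by
  classical
  rcases (S.filter (fun w => f w < z)).eq_empty_or_nonempty with h | h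
  · refine ⟨none, fun w hw => lt_of_le_of_ne ?_ (hz w hw).symm⟩
    by_contra hlt
    have : w ∈ S.filter (fun w => f w < z) := by simp [hw, not_le.1 hlt]
    simp [h] at this
  · obtain ⟨b, hb, hmax⟩ := Finset.exists_max_image _ f h
    rw [Finset.mem_filter] at hb
    refine ⟨some b, hb.1, hb.2, fun w hw => ?_⟩
    by_cases hwz : f w < z
    · exact Or.inl (hmax w (by simp [hw, hwz]))
    · exact Or.inr (lt_of_le_of_ne (not_lt.1 hwz) (hz w hw).symm)

theorem OneLink.insert {S : Finset (Fin n)} {f : Fin n → ℝ}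
    {nx : Option (Fin n) → Option (Fin n)} {w : Fin n} {b e : Option (Fin n)}
    (h : OneLink S f nx) (hw : w ∉ S) (hf : Set.InjOn f S)
    (hb : Prev S f (f w) b) (he : Next S f (f w) e) :
    OneLink (insert w S) f (Function.update (Function.update nx (some w) e) b (some w)) := by
  intro z o ho
  have hbw : b ≠ some w := by
    rintro rfl
    exact hw hb.1
  by_cases how : o = some w
  · subst how
    rw [Function.update_of_ne hbw.symm, Function.update_self]
    obtain ⟨-, h2, h3⟩ := ho
    rcases e with _ | e
    · simp only [next_none] at he ⊢
      intro u hu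
      rcases Finset.mem_insert.1 hu with rfl | hu
      · exact h2
      · exact (he u hu).trans h2
    · simp only [next_some] at he ⊢
      refine ⟨Finset.mem_insert_of_mem he.1, ?_, fun u hu => ?_⟩
      · exact (h3 e (Finset.mem_insert_of_mem he.1)).resolve_left (by linarith [he.2.1])
      · rcases Finset.mem_insert.1 hu with rfl | hu
        · exact Or.inr h2
        · exact (he.2.2 u hu).imp_right (fun h => h.trans h2)
  · have ho' : Prev S f z o := by
      rcases o with _ | c
      · exact fun u hu => ho u (Finset.mem_insert_of_mem hu)
      · exact ⟨(Finset.mem_insert.1 ho.1).resolve_left (fun h => how (by rw [h])), ho.2.1,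
          fun u hu => ho.2.2 u (Finset.mem_insert_of_mem hu)⟩
    by_cases hob : o = b
    · subst hob
      rw [Function.update_self]
      have hz : z < f w := by
        rcases o with _ | c
        · exact ho w (Finset.mem_insert_self _ _)
        · exact (ho.2.2 w (Finset.mem_insert_self _ _)).resolve_left (by linarith [hb.2.1])
      rw [next_some]
      refine ⟨Finset.mem_insert_self _ _, hz, fun u hu => ?_⟩
      rcases Finset.mem_insert.1 hu with rfl | hu
      · exact Or.inl le_rfl
      · rcases o with _ | c
        · exact Or.inl (hb u hu).le
        · rcases hb.2.2 u hu with h1 | h1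
          · exact Or.inr (h1.trans_lt ho.2.1)
          · exact Or.inl h1.le
    · rw [Function.update_of_ne hob, Function.update_of_ne how]
      have hn := h z o ho'
      -- an element of `S` separates `z` from the position of `w`
      have hne : ¬ Prev S f (f w) o := fun h' => hob (Prev.unique hf h' hb)
      generalize nx o = e' at hn ⊢
      have hwz : f w ≠ z := by
        rintro rfl
        exact hne ho'
      rcases e' with _ | e'
      · simp only [next_none] at hn ⊢
        intro u hu
        rcases Finset.mem_insert.1 hu with rfl | hu
        · by_contra hlt
          have hlt := lt_of_le_of_ne (not_lt.1 hlt) hwz.symm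
          apply hne
          rcases o with _ | c
          · intro s hs
            linarith [ho' s hs, hn s hs]
          · exact ⟨ho'.1, ho'.2.1.trans hlt, fun s hs => Or.inl
              ((ho'.2.2 s hs).resolve_right (by linarith [hn s hs]))⟩
        · exact hn u hu
      · simp only [next_some] at hn ⊢
        refine ⟨Finset.mem_insert_of_mem hn.1, hn.2.1, fun u hu => ?_⟩
        rcases Finset.mem_insert.1 hu with rfl | hu
        · by_contra hcon
          push Not at hcon
          have hlt := lt_of_le_of_ne hcon.2 hwz.symm
          apply hne
          rcases o with _ | c
          · intro s hs
            rcases hn.2.2 s hs with h1 | h1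
            · linarith
            · linarith [ho' s hs]
          · refine ⟨ho'.1, ho'.2.1.trans hlt, fun s hs => ?_⟩
            rcases hn.2.2 s hs with h1 | h1
            · exact Or.inr (by linarith)
            · exact Or.inl ((ho'.2.2 s hs).resolve_right (by linarith))
        · exact hn.2.2 u hu

/-- The list of the line `v` in `L` lists `S` in the order of `f`, in both directions. -/
def Linked (L : Links n) (v : Fin n) (S : Finset (Fin n)) (f : Fin n → ℝ) : Prop :=
  OneLink S f (L.nxt v) ∧ OneLink S (fun w => -f w) (L.prv v)

theorem Linked.next {L : Links n} {v : Fin n} {S : Finset (Fin n)} {f : Fin n → ℝ}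
    (h : Linked L v S f) {z : ℝ} {o : Option (Fin n)} (ho : Prev S f z o) :
    Next S f z (L.nxt v o) := h.1 z o ho

theorem Linked.prev {L : Links n} {v : Fin n} {S : Finset (Fin n)} {f : Fin n → ℝ}
    (h : Linked L v S f) {z : ℝ} {o : Option (Fin n)} (ho : Next S f z o) :
    Prev S f z (L.prv v o) := by
  simpa [Next] using h.2 (-z) o ho

theorem Linked.insert {L : Links n} {v w : Fin n} {S : Finset (Fin n)} {f : Fin n → ℝ}
    {b : Option (Fin n)} (h : Linked L v S f) (hw : w ∉ S) (hf : Set.InjOn f S)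
    (hb : Prev S f (f w) b) : Linked (L.insert v b w) v (insert w S) f := by
  have he := h.next hb
  constructor
  · simpa [Links.insert] using h.1.insert hw hf hb he
  · have hf' : Set.InjOn (fun w => -f w) (S : Set (Fin n)) :=
      fun a ha c hc hac => hf ha hc (neg_injective hac)
    have := h.2.insert hw hf' he (by simpa [Next] using hb)
    simpa [Links.insert] using this

theorem Linked.insert_of_ne {L : Links n} {v w u : Fin n} {S : Finset (Fin n)} {f : Fin n → ℝ}
    {b : Option (Fin n)} (h : Linked L u S f) (hu : u ≠ v) :
    Linked (L.insert v b w) u S f := by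
  simpa [Linked, Links.insert, hu] using h

theorem linked_empty {v : Fin n} {f : Fin n → ℝ} :
    Linked (⟨fun _ _ => none, fun _ _ => none⟩ : Links n) v ∅ f := by
  simp [Linked, OneLink]

/-- Points to the right of `z₀`, and before `Z`, that no element of `S` separates from `z₀`. -/
theorem exists_right (S : Finset (Fin n)) (f : Fin n → ℝ) (z₀ Z : ℝ) (hZ : z₀ < Z) :
    ∃ z, z₀ < z ∧ z < Z ∧ ∀ w ∈ S, f w ≤ z₀ ∨ z < f w := by
  induction S using Finset.induction_on with
  | empty => exact ⟨(z₀ + Z) / 2, by linarith, by linarith, by simp⟩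
  | insert w S _ ih =>
    obtain ⟨z, h1, h2, h3⟩ := ih
    by_cases hw : f w ≤ z₀
    · exact ⟨z, h1, h2, by simpa [hw] using h3⟩
    · refine ⟨min z ((z₀ + f w) / 2), lt_min h1 (by linarith), (min_le_left _ _).trans_lt h2, ?_⟩
      intro u hu
      rcases Finset.mem_insert.1 hu with rfl | hu
      · exact Or.inr ((min_le_right _ _).trans_lt (by linarith))
      · exact (h3 u hu).imp_right (fun h => (min_le_left _ _).trans_lt h)

theorem exists_left (S : Finset (Fin n)) (f : Fin n → ℝ) (z₀ Z : ℝ) (hZ : Z < z₀) :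
    ∃ z, z < z₀ ∧ Z < z ∧ ∀ w ∈ S, z₀ ≤ f w ∨ f w < z := by
  obtain ⟨z, h1, h2, h3⟩ := exists_right S (fun w => -f w) (-z₀) (-Z) (by linarith)
  exact ⟨-z, by linarith, by linarith, fun w hw => (h3 w hw).imp (fun h => by linarith)
    (fun h => by linarith)⟩

theorem exists_lt_all (S : Finset (Fin n)) (f : Fin n → ℝ) (Z : ℝ) :
    ∃ z, z < Z ∧ ∀ w ∈ S, z < f w := by
  induction S using Finset.induction_on with
  | empty => exact ⟨Z - 1, by linarith, by simp⟩
  | insert w S _ ih =>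
    obtain ⟨z, h1, h2⟩ := ih
    refine ⟨min z (f w - 1), (min_le_left _ _).trans_lt h1, fun u hu => ?_⟩
    rcases Finset.mem_insert.1 hu with rfl | hu
    · exact (min_le_right _ _).trans_lt (by linarith)
    · exact (min_le_left _ _).trans_lt (h2 u hu)

end Links

/-! ### Inserting a line of largest slope into an arrangement -/

section Arrangement
variable {n : ℕ}

/-- The line dual to the vertex `v`. -/
def line (x y : Fin n → ℝ) (v : Fin n) (z : ℝ) : ℝ := z * y v - x v

/-- No two of the dual lines are parallel and no three meet in a point. -/
structure Simple (x y : Fin n → ℝ) : Prop where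
  inj : Function.Injective y
  cut_ne : ∀ {u w v : Fin n}, u ≠ v → w ≠ v → u ≠ w → cut x y u v ≠ cut x y w v

variable {x y : Fin n → ℝ}

theorem cut_comm (u v : Fin n) : cut x y u v = cut x y v u := by
  rw [cut, cut, ← neg_sub (x v) (x u), ← neg_sub (y v) (y u), neg_div_neg_eq]

theorem line_sub {u v : Fin n} (h : y u ≠ y v) (z : ℝ) :
    line x y u z - line x y v z = (z - cut x y u v) * (y u - y v) := by
  have : y u - y v ≠ 0 := sub_ne_zero.2 h
  rw [line, line, cut]
  field_simp
  ring

theorem line_cut {u v : Fin n} (h : y u ≠ y v) :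
    line x y u (cut x y u v) = line x y v (cut x y u v) := by
  have := line_sub (x := x) h (cut x y u v)
  simpa [sub_eq_zero] using this

theorem line_lt_iff {u v : Fin n} (h : y u < y v) (z : ℝ) :
    line x y u z < line x y v z ↔ cut x y u v < z := by
  have := line_sub (x := x) h.ne z
  rw [← sub_neg, this, mul_comm, mul_neg_iff_of_neg_left (sub_neg.2 h), sub_pos]
where
  mul_neg_iff_of_neg_left {a b : ℝ} (h : a < 0) : a * b < 0 ↔ 0 < b := by
    constructor
    · intro hab
      by_contra hb
      nlinarith
    · intro hb
      nlinarith

theorem line_gt_iff {u v : Fin n} (h : y u < y v) (z : ℝ) :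
    line x y v z < line x y u z ↔ z < cut x y u v := by
  have := line_sub (x := x) h.ne z
  constructor
  · intro h1
    by_contra h2
    nlinarith [mul_nonneg (sub_nonneg.2 (not_lt.1 h2)) (sub_nonneg.2 h.le)]
  · intro h1
    nlinarith [mul_pos (sub_pos.2 h1) (sub_pos.2 h)]

/-- The point of abscissa `t` is not between, or at, the points of abscissas `z` and `z'`. -/
def Outside (t z z' : ℝ) : Prop := (t < z ∧ t < z') ∨ (z < t ∧ z' < t)

theorem side_iff {u v : Fin n} (h : y u ≠ y v) {z z' : ℝ} (ho : Outside (cut x y u v) z z') :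
    line x y u z < line x y v z ↔ line x y u z' < line x y v z' := by
  rcases h.lt_or_gt with h | h
  · rw [line_lt_iff h, line_lt_iff h]
    rcases ho with ho | ho <;> constructor <;> intro <;> linarith
  · rw [line_gt_iff h, line_gt_iff h, cut_comm v u]
    rcases ho with ho | ho <;> constructor <;> intro <;> linarith

/-- Passing from the line `c` to the line `e` at their crossing keeps the side on which the line
`j` lies. -/
theorem below_transfer {j c e : Fin n} (hjc : y j ≠ y c) (hje : y j ≠ y e) (hce : y c ≠ y e)
    {z z' : ℝ} (h1 : Outside (cut x y j c) z (cut x y c e))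
    (h2 : Outside (cut x y j e) (cut x y c e) z') :
    line x y j z < line x y c z ↔ line x y j z' < line x y e z' := by
  rw [side_iff hjc h1, line_cut hce, side_iff hje h2]

theorem above_transfer {j c e : Fin n} (hjc : y j ≠ y c) (hje : y j ≠ y e) (hce : y c ≠ y e)
    {z z' : ℝ} (h1 : Outside (cut x y j c) z (cut x y c e))
    (h2 : Outside (cut x y j e) (cut x y c e) z') :
    line x y c z < line x y j z ↔ line x y e z' < line x y j z' := by
  rw [cut_comm] at h1
  rw [cut_comm j] at h2
  rw [side_iff hjc.symm h1, line_cut hce, side_iff hje.symm h2]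

/-- The crossed lines `P` are those of `S` that cross the line `k` first. -/
def Initial (x y : Fin n → ℝ) (k : Fin n) (S P : Finset (Fin n)) : Prop :=
  P ⊆ S ∧ ∀ p ∈ P, ∀ j ∈ S, j ∉ P → cut x y k p < cut x y k j

/-- Left of the line `k`, the line `c` bounds from above, at abscissa `z`, the face between the
lines in `P` and the other lines of `S`. -/
structure UpAt (x y : Fin n → ℝ) (k : Fin n) (S P : Finset (Fin n)) (c : Fin n) (z : ℝ) : Prop where
  mem : c ∈ S
  notMem : c ∉ P
  lt : z < cut x y k c
  other : ∀ j ∈ S, j ∉ P → j ≠ c → line x y c z < line x y j z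
  crossed : ∀ p ∈ P, line x y p z < line x y c z

/-- Left of the line `k`, the line `c` bounds from below, at abscissa `z`, the face between the
lines in `P` and the other lines of `S`. -/
structure LowAt (x y : Fin n → ℝ) (k : Fin n) (S P : Finset (Fin n)) (c : Fin n) (z : ℝ) :
    Prop where
  mem : c ∈ P
  lt : z < cut x y k c
  other : ∀ j ∈ S, j ∉ P → line x y c z < line x y j z
  crossed : ∀ p ∈ P, p ≠ c → line x y p z < line x y c z

/-- On the lower boundary of the face of `P`, the edge on `c` ends on the left at a crossing with a
further edge of the lower boundary. -/
def TransL (x y : Fin n → ℝ) (k : Fin n) (S P : Finset (Fin n)) (c : Fin n) : Prop :=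
  ∃ z a, LowAt x y k S P c z ∧ Prev (S.erase c) (fun w => cut x y w c) z (some a) ∧ y a < y c

/-- On the upper boundary of the face of `P`, the edge on `e` starts on the left at a crossing with
a further edge of the upper boundary. -/
def TransR (x y : Fin n → ℝ) (k : Fin n) (S P : Finset (Fin n)) (e : Fin n) : Prop :=
  ∃ z c, UpAt x y k S P e z ∧ Prev (S.erase e) (fun w => cut x y w e) z (some c) ∧ c ∉ P ∧ y e < y c

variable {k : Fin n} {S P : Finset (Fin n)}

/-- The amortisation of the leftward walks: a line contributes an edge other than the leftmost one
to the lower boundary of at most one face along `k`. -/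
theorem TransL.not_lowAt (hg : Simple x y) (hk : ∀ j ∈ S, y j < y k) {P₂ : Finset (Fin n)}
    (h1 : Initial x y k S P) (h2 : Initial x y k S P₂) (hP : P ⊂ P₂) {c : Fin n}
    (hc : TransL x y k S P c) (z₂ : ℝ) : ¬ LowAt x y k S P₂ c z₂ := by
  intro hl₂
  obtain ⟨z, a, hl, ⟨ha, haz, hprev⟩, hac⟩ := hc
  obtain ⟨hane, haS⟩ := Finset.mem_erase.1 ha
  have haP : a ∈ P := by
    by_contra hn
    have e1 := hl.other a haS hn
    have e2 := (line_lt_iff (x := x) hac z).2 haz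
    linarith
  have e1 := (line_lt_iff hac z₂).1 (hl₂.crossed a (hP.subset haP) hane)
  obtain ⟨u, hu₂, hu⟩ := Finset.exists_of_ssubset hP
  have huc : u ≠ c := fun h => hu (h ▸ hl.mem)
  have huS := h2.1 hu₂
  have hcS := h1.1 hl.mem
  have e2 := hl.other u huS hu
  have e3 := hl₂.crossed u hu₂ huc
  have e4 := h1.2 c hl.mem u huS hu
  -- `u`, which is crossed between the two faces, lies above `c` at `z` and where `k` meets `c`, but
  -- below `c` at `z₂`, so that it crosses `c` twice or between `z₂` and `z`, on the edge of `c`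
  have e5 : line x y c (cut x y k c) < line x y u (cut x y k c) := by
    have := (line_gt_iff (x := x) (hk u huS) (cut x y k c)).2 (by rwa [cut_comm u])
    rwa [line_cut (hk c hcS).ne'] at this
  have hy : y u ≠ y c := fun h => huc (hg.inj h)
  have l1 := hl.lt
  have l2 := hl₂.lt
  have hpu := hprev u (Finset.mem_erase.2 ⟨huc, huS⟩)
  rcases hy.lt_or_gt with hy | hy
  · rw [line_lt_iff hy] at e3
    rw [line_gt_iff hy] at e2 e5
    linarith
  · rw [line_lt_iff hy, cut_comm c u] at e2 e5
    rw [line_gt_iff hy, cut_comm c u] at e3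
    rcases hpu with h | h <;> linarith

/-- The amortisation of the rightward walks: a line contributes an edge other than the leftmost one
to the upper boundary of at most one face along `k`. -/
theorem TransR.not_upAt (hg : Simple x y) (hk : ∀ j ∈ S, y j < y k) {P₂ : Finset (Fin n)}
    (h2 : Initial x y k S P₂) (hP : P ⊂ P₂) {e : Fin n}
    (he : TransR x y k S P₂ e) (z : ℝ) : ¬ UpAt x y k S P e z := by
  intro hu
  obtain ⟨z₂, c, hu₂, ⟨hc, hcz, hprev⟩, hcP, hec⟩ := he
  obtain ⟨hcne, hcS⟩ := Finset.mem_erase.1 hc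
  have e1 := (line_lt_iff hec z).1 (hu.other c hcS (fun h => hcP (hP.subset h)) hcne)
  rw [cut_comm] at e1
  obtain ⟨u, hu₂', hu'⟩ := Finset.exists_of_ssubset hP
  have hue : u ≠ e := fun h => hu₂.notMem (h ▸ hu₂')
  have huS := h2.1 hu₂'
  have heS := hu.mem
  have e2 := hu.other u huS hu' hue
  have e3 := hu₂.crossed u hu₂'
  have e4 := h2.2 u hu₂' e heS hu₂.notMem
  -- `u`, which is crossed between the two faces, lies above `e` at `z`, but below `e` at `z₂` and
  -- where `k` meets `e`, so that it crosses `e` twice or between `z` and `z₂`, on the edge of `e`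
  have e5 : line x y u (cut x y k e) < line x y e (cut x y k e) := by
    have := (line_lt_iff (x := x) (hk u huS) (cut x y k e)).2 (by rwa [cut_comm u])
    rwa [line_cut (hk e heS).ne'] at this
  have hy : y u ≠ y e := fun h => hue (hg.inj h)
  have l1 := hu.lt
  have l2 := hu₂.lt
  have hpu := hprev u (Finset.mem_erase.2 ⟨hue, huS⟩)
  rcases hy.lt_or_gt with hy | hy
  · rw [line_lt_iff hy] at e3 e5
    rw [line_gt_iff hy] at e2
    rcases hpu with h | h <;> linarith
  · rw [line_lt_iff hy, cut_comm e u] at e2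
    rw [line_gt_iff hy, cut_comm e u] at e3 e5
    linarith

theorem Prev.mono {f : Fin n → ℝ} {z z' : ℝ} {o : Option (Fin n)} (h : Prev S f z o)
    (hz : z ≤ z') (hS : ∀ w ∈ S, f w < z ∨ z' < f w) : Prev S f z' o := by
  rcases o with _ | b
  · exact fun w hw => (hS w hw).resolve_left (by linarith [h w hw])
  · refine ⟨h.1, h.2.1.trans_le hz, fun w hw => ?_⟩
    rcases hS w hw with h1 | h1
    · exact Or.inl ((h.2.2 w hw).resolve_right (by linarith))
    · exact Or.inr h1

theorem outside_of_le {t z z' : ℝ} (h : t ≤ z ∨ z' < t) (hz : z < z') (hne : t ≠ z) :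
    Outside t z z' := by
  rcases h with h | h
  · exact Or.inl ⟨lt_of_le_of_ne h hne, by linarith⟩
  · exact Or.inr ⟨by linarith, h⟩

theorem Outside.symm {t z z' : ℝ} (h : Outside t z z') : Outside t z' z :=
  h.imp And.symm And.symm

open Classical in
/-- A rightward walk ends on the line that is crossed next. -/
theorem walkRight_spec (hg : Simple x y) (hk : ∀ j ∈ S, y j < y k) (hP : Initial x y k S P)
    (L : Links n)
    (hL : ∀ v ∈ S, v ∉ P → Linked L v (S.erase v) (fun w => cut x y w v)) (f : ℕ) (c : Fin n)
    (b : Option (Fin n)) (z : ℝ) (hup : UpAt x y k S P c z)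
    (hb : Prev (S.erase c) (fun w => cut x y w c) z b)
    (hf : (S.filter (fun j => y j < y c)).card < f) :
    (walkRight x y L k f c b).val.1 ∈ S ∧ (walkRight x y L k f c b).val.1 ∉ P ∧
    (∀ j ∈ S, j ∉ P → j ≠ (walkRight x y L k f c b).val.1 →
      cut x y k (walkRight x y L k f c b).val.1 < cut x y k j) ∧
    Prev (S.erase (walkRight x y L k f c b).val.1)
      (fun w => cut x y w (walkRight x y L k f c b).val.1)
      (cut x y k (walkRight x y L k f c b).val.1) (walkRight x y L k f c b).val.2 ∧
    (walkRight x y L k f c b).time ≤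
      2 * (S.filter (fun e => TransR x y k S P e ∧ y e < y c)).card + 2 ∧
    (walkRight x y L k f c b).diagrams = 0 := by
  induction f generalizing c b z with
  | zero => omega
  | succ f ih =>
    have hcS := hup.mem
    have hkc := hk c hcS
    -- the walk ends on `c` if the crossing with `k` is on the current edge
    have hexit : (∀ w ∈ S.erase c, cut x y w c < z ∨ cut x y k c < cut x y w c) →
        (∀ j ∈ S, j ∉ P → j ≠ c → cut x y k c < cut x y k j) ∧
        Prev (S.erase c) (fun w => cut x y w c) (cut x y k c) b := by
      intro h
      refine ⟨fun j hj hjP hjc => ?_, hb.mono hup.lt.le h⟩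
      have hyj : y c ≠ y j := fun h => hjc (hg.inj h).symm
      have ho : Outside (cut x y c j) z (cut x y k c) := by
        rw [cut_comm c j]
        rcases h j (Finset.mem_erase.2 ⟨hjc, hj⟩) with h | h
        · exact Or.inl ⟨h, h.trans hup.lt⟩
        · exact Or.inr ⟨hup.lt.trans h, h⟩
      have := (side_iff hyj ho).1 (hup.other j hj hjP hjc)
      rw [← line_cut hkc.ne', line_gt_iff (hk j hj), cut_comm j] at this
      exact this
    have hnx := (hL c hcS hup.notMem).next hb
    rcases hnxt : L.nxt c b with _ | e
    · rw [hnxt, next_none] at hnx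
      obtain ⟨h1, h2⟩ := hexit (fun w hw => Or.inl (hnx w hw))
      simp only [walkRight, Run.val_bind, val_step, hnxt, Run.val_pure, Run.time_bind, time_step,
        Run.time_pure, Run.diagrams_bind, diagrams_step, Run.diagrams_pure]
      exact ⟨hcS, hup.notMem, h1, h2, by omega, trivial⟩
    · rw [hnxt, next_some] at hnx
      obtain ⟨he, hze, hnext⟩ := hnx
      obtain ⟨hec, heS⟩ := Finset.mem_erase.1 he
      by_cases hlt : cut x y k c < cut x y c e
      · obtain ⟨h1, h2⟩ := hexit (fun w hw => by
          rcases hnext w hw with h | h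
          · rw [cut_comm c e] at hlt
            exact Or.inr (hlt.trans_le h)
          · exact Or.inl h)
        simp only [walkRight, Run.val_bind, val_step, hnxt, Run.val_pure, Run.time_bind, time_step,
          Run.time_pure, Run.diagrams_bind, diagrams_step, Run.diagrams_pure, hlt, decide_true,
          if_true]
        exact ⟨hcS, hup.notMem, h1, h2, by omega, trivial⟩
      · -- the edge of `c` ends before the line `k`, at the crossing with `e`
        have hkne : k ≠ c := fun h => hkc.ne (congrArg y h).symm
        have hke : k ≠ e := fun h => (hk e heS).ne (congrArg y h).symm
        rw [cut_comm c e] at hlt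
        have hlt' : cut x y e c < cut x y k c :=
          lt_of_le_of_ne (not_lt.1 hlt) (hg.cut_ne hec hkne hke.symm)
        have hyec : y e ≠ y c := fun h => hec (hg.inj h)
        have hlk : line x y k (cut x y e c) < line x y e (cut x y e c) := by
          rw [line_cut hyec, line_gt_iff hkc, cut_comm c]
          exact hlt'
        -- a crossed line would have to come from below `c`, and would then meet `k` after `c` does
        have heP : e ∉ P := by
          intro heP
          have e1 := hup.crossed e heP
          have e2 := hP.2 e heP c hcS hup.notMem
          have hce : y c < y e := by
            by_contra h
            rw [line_lt_iff (lt_of_le_of_ne (not_lt.1 h) hyec)] at e1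
            linarith
          have e3 := (line_lt_iff (x := x) hce (cut x y k c)).2 (by rwa [cut_comm c e])
          rw [← line_cut hkc.ne', line_gt_iff (hk e heS), cut_comm e k] at e3
          linarith
        have hye : y e < y c := by
          by_contra h
          have h := lt_of_le_of_ne (not_lt.1 h) hyec.symm
          have := hup.other e heS heP hec
          rw [line_lt_iff h, cut_comm] at this
          linarith
        have hzτ : cut x y e c < cut x y k e := by
          rw [line_gt_iff (hk e heS), cut_comm e k] at hlk
          exact hlk
        -- a point on the next edge, which is on `e`
        obtain ⟨z', hz1, hz2, hz3⟩ := exists_right (S.erase e) (fun w => cut x y w e) _ _ hzτ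
        have hside : ∀ j ∈ S, j ≠ c → j ≠ e →
            Outside (cut x y j c) z (cut x y c e) ∧ Outside (cut x y j e) (cut x y c e) z' := by
          intro j hj hjc hje
          rw [cut_comm c e]
          constructor
          · have hne := hg.cut_ne hjc hec hje
            rcases hnext j (Finset.mem_erase.2 ⟨hjc, hj⟩) with h | h
            · have := lt_of_le_of_ne h hne.symm
              exact Or.inr ⟨hze.trans this, this⟩
            · exact Or.inl ⟨h, h.trans hze⟩
          · have hne := hg.cut_ne hje hec.symm hjc
            rw [cut_comm c e] at hne
            exact outside_of_le (hz3 j (Finset.mem_erase.2 ⟨hje, hj⟩)) hz1 hne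
        have hy : ∀ {a b : Fin n}, a ≠ b → y a ≠ y b := fun h h' => h (hg.inj h')
        have hup' : UpAt x y k S P e z' := by
          refine ⟨heS, heP, hz2, fun j hj hjP hje => ?_, fun p hp => ?_⟩
          · by_cases hjc : j = c
            · subst hjc
              exact (line_lt_iff hye z').2 hz1
            · obtain ⟨o1, o2⟩ := hside j hj hjc hje
              exact (above_transfer (hy hjc) (hy hje) (hy hec.symm) o1 o2).1 (hup.other j hj hjP hjc)
          · have hpc : p ≠ c := fun h => hup.notMem (h ▸ hp)
            have hpe : p ≠ e := fun h => heP (h ▸ hp)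
            obtain ⟨o1, o2⟩ := hside p (hP.1 hp) hpc hpe
            exact (below_transfer (hy hpc) (hy hpe) (hy hec.symm) o1 o2).1 (hup.crossed p hp)
        have hprev' : Prev (S.erase e) (fun w => cut x y w e) z' (some c) := by
          refine ⟨Finset.mem_erase.2 ⟨hec.symm, hcS⟩, ?_, ?_⟩
          · simpa only [cut_comm c e] using hz1
          · simpa only [cut_comm c e] using hz3
        -- the slopes decrease along the walk, so that it terminates
        have hcard : (S.filter (fun j => y j < y e)).card < (S.filter (fun j => y j < y c)).card :=
          Finset.card_lt_card ((Finset.ssubset_iff_of_subset (fun j hj => by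
            simp only [Finset.mem_filter] at hj ⊢
            exact ⟨hj.1, hj.2.trans hye⟩)).2 ⟨e, by simp [heS, hye], by simp⟩)
        obtain ⟨i1, i2, i3, i4, i5, i6⟩ := ih e (some c) z' hup' hprev' (by omega)
        -- the edge on `e` is charged to `e`
        have hcard' : (S.filter (fun j => TransR x y k S P j ∧ y j < y e)).card <
            (S.filter (fun j => TransR x y k S P j ∧ y j < y c)).card := by
          refine Finset.card_lt_card ((Finset.ssubset_iff_of_subset (fun j hj => ?_)).2 ⟨e, ?_, ?_⟩)
          · simp only [Finset.mem_filter] at hj ⊢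
            exact ⟨hj.1, hj.2.1, hj.2.2.trans hye⟩
          · simp only [Finset.mem_filter]
            exact ⟨heS, ⟨z', c, hup', hprev', hup.notMem, hye⟩, hye⟩
          · simp
        rw [cut_comm e c] at hlt
        simp only [walkRight, Run.val_bind, val_step, hnxt, Run.time_bind, time_step,
          Run.diagrams_bind, diagrams_step, hlt, decide_false,
          Bool.false_eq_true, if_false]
        exact ⟨i1, i2, i3, i4, by omega, by omega⟩

open Classical in
/-- A leftward walk ends at the left end of the upper boundary of the same face. -/
theorem walkLeft_spec (hg : Simple x y) (hk : ∀ j ∈ S, y j < y k) (hP : Initial x y k S P)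
    (L : Links n)
    (hL : ∀ v ∈ P, Linked L v (insert k (S.erase v)) (fun w => cut x y w v))
    (under : Fin n → Option (Fin n))
    (hu0 : ∀ c ∈ S, under c = none → ∀ j ∈ S, y c ≤ y j)
    (hu1 : ∀ c ∈ S, ∀ u, under c = some u → u ∈ S ∧ y u < y c ∧ ∀ j ∈ S, y j ≤ y u ∨ y c ≤ y j)
    (f : ℕ) (c : Fin n)
    (a : Option (Fin n)) (z : ℝ) (hlow : LowAt x y k S P c z)
    (ha : Prev (S.erase c) (fun w => cut x y w c) z a)
    (hf : (S.filter (fun j => y j < y c)).card < f) :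
    ((walkLeft y L under f c a).time ≤
      2 * (S.filter (fun e => TransL x y k S P e ∧ y e ≤ y c)).card + 1 ∧
    (walkLeft y L under f c a).diagrams = 0) ∧
    (P ≠ S → ∃ z', UpAt x y k S P (walkLeft y L under f c a).val.1 z' ∧
      Prev (S.erase (walkLeft y L under f c a).val.1)
      (fun w => cut x y w (walkLeft y L under f c a).val.1) z'
      (walkLeft y L under f c a).val.2) := by
  induction f generalizing c a z with
  | zero => omega
  | succ f ih =>
    have hcS := hP.1 hlow.mem
    have hkc := hk c hcS
    have hy : ∀ {a b : Fin n}, a ≠ b → y a ≠ y b := fun h h' => h (hg.inj h')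
    rcases a with _ | a
    · -- an unbounded lower boundary; the upper one starts with the next smaller slope
      simp only [walkLeft, val_step, time_step, diagrams_step]
      refine ⟨⟨by omega, trivial⟩, fun hne => ?_⟩
      rw [prev_none] at ha
      obtain ⟨j, hj, hjP⟩ : ∃ j ∈ S, j ∉ P := by
        by_contra h
        push Not at h
        exact hne (Finset.Subset.antisymm hP.1 h)
      -- left of all crossings, the lines lie above each other in the order of their slopes
      have hslope : ∀ j ∈ S, j ∉ P → y j < y c := by
        intro j hj hjP
        have hjc : j ≠ c := fun h => hjP (h ▸ hlow.mem)
        by_contra h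
        have h := lt_of_le_of_ne (not_lt.1 h) (hy hjc).symm
        have h1 := hlow.other j hj hjP
        have h2 := ha j (Finset.mem_erase.2 ⟨hjc, hj⟩)
        rw [line_lt_iff h, cut_comm] at h1
        linarith
      rcases hun : under c with _ | u
      · exact absurd (hu0 c hcS hun j hj) (not_le.2 (hslope j hj hjP))
      · obtain ⟨huS, huc, hubetween⟩ := hu1 c hcS u hun
        have huP : u ∉ P := by
          intro huP
          have hne : u ≠ c := fun h => huc.ne (congrArg y h)
          have h1 := hlow.crossed u huP hne
          have h2 := ha u (Finset.mem_erase.2 ⟨hne, huS⟩)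
          rw [line_lt_iff huc] at h1
          linarith
        obtain ⟨z', -, hz'⟩ := exists_lt_all (insert k (S.erase u)) (fun w => cut x y w u) z
        refine ⟨z', ⟨huS, huP, hz' k (Finset.mem_insert_self _ _), fun j hj hjP hju => ?_,
          fun p hp => ?_⟩, ?_⟩
        · have h1 := (hubetween j hj).resolve_right (not_le.2 (hslope j hj hjP))
          have h1 := lt_of_le_of_ne h1 (hy hju)
          exact (line_gt_iff h1 z').2
            (hz' j (Finset.mem_insert_of_mem (Finset.mem_erase.2 ⟨hju, hj⟩)))
        · have hpu : p ≠ u := fun h => huP (h ▸ hp)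
          have h1 : y u < y p := by
            by_cases hpc : p = c
            · rw [hpc]
              exact huc
            · have h1 := hlow.crossed p hp hpc
              have h2 := ha p (Finset.mem_erase.2 ⟨hpc, hP.1 hp⟩)
              by_contra h
              have h : y p < y c := (not_lt.1 h).trans_lt huc
              rw [line_lt_iff h] at h1
              linarith
          rw [show (some u).getD c = u from rfl, line_gt_iff h1, cut_comm]
          exact hz' p (Finset.mem_insert_of_mem (Finset.mem_erase.2 ⟨hpu, hP.1 hp⟩))
        · exact fun w hw => hz' w (Finset.mem_insert_of_mem hw)
    · obtain ⟨ha', haz, hprev⟩ := id ha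
      obtain ⟨hac, haS⟩ := Finset.mem_erase.1 ha'
      have hlk : line x y k (cut x y a c) < line x y a (cut x y a c) := by
        rw [line_cut (hy hac), line_gt_iff hkc, cut_comm c]
        exact haz.trans hlow.lt
      have hzτ : cut x y a c < cut x y k a := by
        rw [line_gt_iff (hk a haS), cut_comm a k] at hlk
        exact hlk
      have hside : ∀ j ∈ S, j ≠ c → j ≠ a → Outside (cut x y j c) z (cut x y c a) := by
        intro j hj hjc hja
        rw [cut_comm c a]
        exact (outside_of_le (hprev j (Finset.mem_erase.2 ⟨hjc, hj⟩)) haz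
          (hg.cut_ne hjc hac hja)).symm
      -- `c` and `a` cross at the left end of the face if `a` has the larger slope
      by_cases hca : y c < y a
      · simp only [walkLeft, Run.val_bind, val_step, Run.time_bind, time_step, Run.diagrams_bind,
          diagrams_step, hca, decide_true, if_true, Run.val_pure, Run.time_pure,
          Run.diagrams_pure]
        refine ⟨⟨by omega, trivial⟩, fun _ => ?_⟩
        obtain ⟨z', hz1, hz2, hz3⟩ := exists_right (S.erase a) (fun w => cut x y w a) _ _ hzτ
        have haP : a ∉ P := by
          intro haP
          have h1 := hlow.crossed a haP hac
          rw [line_gt_iff hca, cut_comm] at h1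
          linarith
        have hside' : ∀ j ∈ S, j ≠ c → j ≠ a → Outside (cut x y j a) (cut x y c a) z' := by
          intro j hj hjc hja
          have := outside_of_le (hz3 j (Finset.mem_erase.2 ⟨hja, hj⟩)) hz1
            (by rw [cut_comm a c]; exact hg.cut_ne hja hac.symm hjc)
          rwa [cut_comm c a]
        refine ⟨z', ⟨haS, haP, hz2, fun j hj hjP hja => ?_, fun p hp => ?_⟩, ?_⟩
        · have hjc : j ≠ c := fun h => hjP (h ▸ hlow.mem)
          exact (above_transfer (hy hjc) (hy hja) (hy hac.symm) (hside j hj hjc hja)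
            (hside' j hj hjc hja)).1 (hlow.other j hj hjP)
        · have hpa : p ≠ a := fun h => haP (h ▸ hp)
          by_cases hpc : p = c
          · subst hpc
            rw [line_lt_iff hca, cut_comm]
            exact hz1
          · exact (below_transfer (hy hpc) (hy hpa) (hy hac.symm) (hside p (hP.1 hp) hpc hpa)
              (hside' p (hP.1 hp) hpc hpa)).1 (hlow.crossed p hp hpc)
        · refine ⟨Finset.mem_erase.2 ⟨hac.symm, hcS⟩, ?_, ?_⟩
          · simpa only [cut_comm c a] using hz1
          · simpa only [cut_comm c a] using hz3
      · have hac' : y a < y c := lt_of_le_of_ne (not_lt.1 hca) (hy hac)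
        have haP : a ∈ P := by
          by_contra haP
          have h1 := hlow.other a haS haP
          rw [line_gt_iff hac'] at h1
          linarith
        -- a point on the next edge, which is on `a`
        obtain ⟨z', hz1, -, hz3⟩ := exists_left (S.erase a) (fun w => cut x y w a)
          (cut x y a c) (cut x y a c - 1) (by linarith)
        have hside' : ∀ j ∈ S, j ≠ c → j ≠ a → Outside (cut x y j a) (cut x y c a) z' := by
          intro j hj hjc hja
          rw [cut_comm c a]
          have hne := hg.cut_ne hja hac.symm hjc
          rw [cut_comm c a] at hne
          rcases hz3 j (Finset.mem_erase.2 ⟨hja, hj⟩) with h | h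
          · have := lt_of_le_of_ne h hne.symm
            exact Or.inr ⟨this, hz1.trans this⟩
          · exact Or.inl ⟨h.trans hz1, h⟩
        have hlow' : LowAt x y k S P a z' := by
          refine ⟨haP, hz1.trans hzτ, fun j hj hjP => ?_, fun p hp hpa => ?_⟩
          · have hjc : j ≠ c := fun h => hjP (h ▸ hlow.mem)
            have hja : j ≠ a := fun h => hjP (h ▸ haP)
            exact (above_transfer (hy hjc) (hy hja) (hy hac.symm) (hside j hj hjc hja)
              (hside' j hj hjc hja)).1 (hlow.other j hj hjP)
          · by_cases hpc : p = c
            · subst hpc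
              exact (line_gt_iff hac' z').2 hz1
            · exact (below_transfer (hy hpc) (hy hpa) (hy hac.symm) (hside p (hP.1 hp) hpc hpa)
                (hside' p (hP.1 hp) hpc hpa)).1 (hlow.crossed p hp hpc)
        have hnext : Next (insert k (S.erase a)) (fun w => cut x y w a) z' (some c) := by
          rw [next_some]
          refine ⟨Finset.mem_insert_of_mem (Finset.mem_erase.2 ⟨hac.symm, hcS⟩), ?_, fun w hw => ?_⟩
          · rw [cut_comm c a]
            exact hz1
          · rw [cut_comm c a]
            rcases Finset.mem_insert.1 hw with rfl | hw
            · exact Or.inl hzτ.le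
            · exact hz3 w hw
        have hprev' : Prev (S.erase a) (fun w => cut x y w a) z' (L.prv a (some c)) := by
          have := (hL a haP).prev hnext
          rcases hprv : L.prv a (some c) with _ | o <;> rw [hprv] at this
          · exact fun w hw => this w (Finset.mem_insert_of_mem hw)
          · refine ⟨(Finset.mem_insert.1 this.1).resolve_left (fun h => ?_), this.2.1,
              fun w hw => this.2.2 w (Finset.mem_insert_of_mem hw)⟩
            subst h
            exact lt_asymm this.2.1 (hz1.trans hzτ)
        have hcard : (S.filter (fun j => y j < y a)).card < (S.filter (fun j => y j < y c)).card :=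
          Finset.card_lt_card ((Finset.ssubset_iff_of_subset (fun j hj => by
            simp only [Finset.mem_filter] at hj ⊢
            exact ⟨hj.1, hj.2.trans hac'⟩)).2 ⟨a, by simp [haS, hac'], by simp⟩)
        obtain ⟨⟨i1, i2⟩, i3⟩ := ih a (L.prv a (some c)) z' hlow' hprev' (by omega)
        -- the edge on `c` is charged to `c`
        have hcard' : (S.filter (fun j => TransL x y k S P j ∧ y j ≤ y a)).card <
            (S.filter (fun j => TransL x y k S P j ∧ y j ≤ y c)).card := by
          refine Finset.card_lt_card ((Finset.ssubset_iff_of_subset (fun j hj => ?_)).2 ⟨c, ?_, ?_⟩)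
          · simp only [Finset.mem_filter] at hj ⊢
            exact ⟨hj.1, hj.2.1, hj.2.2.trans hac'.le⟩
          · simp only [Finset.mem_filter]
            exact ⟨hcS, ⟨z, a, hlow, ha, hac'⟩, le_rfl⟩
          · simp [hac']
        simp only [walkLeft, Run.val_bind, val_step, Run.time_bind, time_step, Run.diagrams_bind,
          diagrams_step, hca, decide_false, Bool.false_eq_true, if_false]
        exact ⟨⟨by omega, by omega⟩, i3⟩

end Arrangement

/-! ### The clockwise orders from the arrangement -/

section CyclicOrders
variable {n : ℕ} {x y : Fin n → ℝ} {k : Fin n} {S P : Finset (Fin n)}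

/-- The links in the middle of the insertion of the line `k` into the arrangement of `S`, when the
crossings of `k` with the lines in `P` have been added. -/
structure Inserting (x y : Fin n → ℝ) (k : Fin n) (S P : Finset (Fin n)) (L : Links n) : Prop where
  initial : Initial x y k S P
  crossed : ∀ v ∈ P, Linked L v (insert k (S.erase v)) (fun w => cut x y w v)
  rest : ∀ v ∈ S, v ∉ P → Linked L v (S.erase v) (fun w => cut x y w v)
  new : Linked L k P (fun w => cut x y w k)
  out : ∀ v ∉ S, v ≠ k → Linked L v ∅ (fun w => cut x y w v)

theorem Simple.injOn (hg : Simple x y) {v : Fin n} {R : Finset (Fin n)} (hv : v ∉ R) :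
    Set.InjOn (fun w => cut x y w v) R := by
  intro a ha b hb hab
  by_contra hne
  exact hg.cut_ne (ne_of_mem_of_not_mem ha hv) (ne_of_mem_of_not_mem hb hv) hne hab

open Classical in
/-- If the lines in `P` have been crossed and `c` bounds the current face from above, the remaining
crossings of `k` are added correctly. The walks are charged to the lines with `TransR` or `TransL`
for a face still to be met. -/
theorem addCrossings_spec (hg : Simple x y) (hk : ∀ j ∈ S, y j < y k)
    (under : Fin n → Option (Fin n))
    (hu0 : ∀ c ∈ S, under c = none → ∀ j ∈ S, y c ≤ y j)
    (hu1 : ∀ c ∈ S, ∀ u, under c = some u → u ∈ S ∧ y u < y c ∧ ∀ j ∈ S, y j ≤ y u ∨ y c ≤ y j)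
    (r : ℕ) (c : Fin n) (b t : Option (Fin n)) (L : Links n) (P : Finset (Fin n))
    (hI : Inserting x y k S P L) (hr : r = (S \ P).card)
    (hup : r ≠ 0 → ∃ z, UpAt x y k S P c z ∧ Prev (S.erase c) (fun w => cut x y w c) z b)
    (ht : ∀ z, (∀ p ∈ P, cut x y p k < z) → Prev P (fun w => cut x y w k) z t) :
    Inserting x y k S S (addCrossings x y under k r c b t L).val ∧
    (addCrossings x y under k r c b t L).time ≤ 5 * r +
      2 * (S.filter (fun e => ∃ P₂, P ⊆ P₂ ∧ Initial x y k S P₂ ∧ TransR x y k S P₂ e)).card +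
      2 * (S.filter (fun e => ∃ P₂, P ⊂ P₂ ∧ Initial x y k S P₂ ∧ TransL x y k S P₂ e)).card ∧
    (addCrossings x y under k r c b t L).diagrams = 0 := by
  induction r generalizing c b t L P with
  | zero =>
    have : P = S := by
      have := Finset.card_eq_zero.1 hr.symm
      exact Finset.Subset.antisymm hI.initial.1 (Finset.sdiff_eq_empty_iff_subset.1 this)
    subst this
    simp [addCrossings, hI]
  | succ r ih =>
    obtain ⟨z, hup, hb⟩ := hup (by omega)
    have hkS : k ∉ S := fun h => lt_irrefl _ (hk k h)
    have hcard : ∀ c, c ∈ S → (S.filter (fun j => y j < y c)).card < n := by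
      intro c hc
      have h1 : (S.filter (fun j => y j < y c)).card < (Finset.univ : Finset (Fin n)).card :=
        Finset.card_lt_card ((Finset.ssubset_iff_of_subset (Finset.subset_univ _)).2
          ⟨c, Finset.mem_univ _, by simp⟩)
      simpa using h1
    obtain ⟨q1, q2, q3, q4, q5, q6⟩ := walkRight_spec hg hk hI.initial L hI.rest n c b z hup hb
      (hcard c hup.mem)
    simp only [addCrossings, Run.val_bind, val_step, Run.time_bind, time_step, Run.diagrams_bind,
      diagrams_step]
    generalize walkRight x y L k n c b = Q at *
    obtain ⟨⟨q, b'⟩, tQ, dQ⟩ := Q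
    dsimp only at q1 q2 q3 q4 q5 q6 ⊢
    subst q6
    have hqk : q ≠ k := fun h => hkS (h ▸ q1)
    have hP' : Initial x y k S (insert q P) := by
      refine ⟨Finset.insert_subset q1 hI.initial.1, fun p hp j hj hjP => ?_⟩
      rw [Finset.mem_insert, not_or] at hjP
      rcases Finset.mem_insert.1 hp with rfl | hp
      · exact q3 j hj hjP.2 hjP.1
      · exact hI.initial.2 p hp j hj hjP.2
    have hlast : ∀ p ∈ P, cut x y p k < cut x y q k := by
      intro p hp
      rw [cut_comm p, cut_comm q]
      exact hI.initial.2 p hp q q1 q2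
    set L₂ := (L.insert q b' k).insert k t q with hL₂
    have hI' : Inserting x y k S (insert q P) L₂ := by
      refine ⟨hP', fun v hv => ?_, fun v hv hvP => ?_, ?_, fun v hv hvk => ?_⟩
      · rcases Finset.mem_insert.1 hv with rfl | hv
        · exact ((hI.rest v q1 q2).insert (fun h => hkS (Finset.mem_erase.1 h).2)
            (hg.injOn (by simp)) q4).insert_of_ne hqk
        · exact ((hI.crossed v hv).insert_of_ne (ne_of_mem_of_not_mem hv q2)).insert_of_ne
            (fun h => hkS (h ▸ hI.initial.1 hv))
      · rw [Finset.mem_insert, not_or] at hvP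
        exact ((hI.rest v hv hvP.2).insert_of_ne hvP.1).insert_of_ne (fun h => hkS (h ▸ hv))
      · exact (hI.new.insert_of_ne hqk.symm).insert q2
          (hg.injOn (fun h => hkS (hI.initial.1 h))) (ht _ hlast)
      · exact ((hI.out v hv hvk).insert_of_ne (fun h => hv (h ▸ q1))).insert_of_ne hvk
    -- a point on the line `q` just left of the crossing with `k`
    obtain ⟨z', hz1, -, hz3⟩ := exists_left (S.erase q) (fun w => cut x y w q)
      (cut x y k q) (cut x y k q - 1) (by linarith)
    have hz4 : ∀ w ∈ S.erase q, cut x y w q < z' ∨ cut x y k q < cut x y w q := by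
      intro w hw
      rcases hz3 w hw with h | h
      · obtain ⟨hwq, hwS⟩ := Finset.mem_erase.1 hw
        exact Or.inr (lt_of_le_of_ne h (hg.cut_ne hqk.symm hwq (fun h => hkS (h ▸ hwS))))
      · exact Or.inl h
    have hprev : Prev (S.erase q) (fun w => cut x y w q) z' b' := by
      obtain ⟨o, ho⟩ := exists_prev (S.erase q) (fun w => cut x y w q) z' (fun w hw => by
        rcases hz4 w hw with h | h
        · exact h.ne
        · exact (hz1.trans h).ne')
      have ho' := ho.mono hz1.le hz4
      rwa [Prev.unique (hg.injOn (by simp)) q4 ho']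
    have hlow : LowAt x y k S (insert q P) q z' := by
      have hout : ∀ j ∈ S, j ≠ q → Outside (cut x y j q) (cut x y k q) z' := by
        intro j hj hjq
        rcases hz4 j (Finset.mem_erase.2 ⟨hjq, hj⟩) with h | h
        · exact Or.inl ⟨h.trans hz1, h⟩
        · exact Or.inr ⟨h, hz1.trans h⟩
      refine ⟨Finset.mem_insert_self _ _, hz1, fun j hj hjP => ?_, fun p hp hpq => ?_⟩
      · rw [Finset.mem_insert, not_or] at hjP
        have h1 := q3 j hj hjP.2 hjP.1
        have ho := hout j hj hjP.1
        rw [cut_comm j q] at ho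
        rw [← side_iff (fun h => hjP.1 (hg.inj h).symm) ho, ← line_cut (hk q q1).ne',
          line_gt_iff (hk j hj), cut_comm j k]
        exact h1
      · have hpP := Finset.mem_of_mem_insert_of_ne hp hpq
        have hpS := hI.initial.1 hpP
        rw [← side_iff (fun h => hpq (hg.inj h)) (hout p hpS hpq), ← line_cut (hk q q1).ne',
          line_lt_iff (hk p hpS), cut_comm p k]
        exact hI.initial.2 p hpP q q1 q2
    obtain ⟨⟨w1, w2⟩, w3⟩ := walkLeft_spec hg hk hP' L₂ hI'.crossed under hu0 hu1 n q b' z' hlow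
      hprev (hcard q q1)
    generalize walkLeft y L₂ under n q b' = W at *
    obtain ⟨⟨c', a'⟩, tW, dW⟩ := W
    dsimp only at w1 w2 w3 ⊢
    subst w2
    have hr' : r = (S \ insert q P).card := by
      rw [Finset.sdiff_insert, Finset.card_erase_of_mem (Finset.mem_sdiff.2 ⟨q1, q2⟩)]
      omega
    obtain ⟨i1, i2, i3⟩ := ih c' a' (some q) L₂ (insert q P) hI' hr' (fun hr0 => w3 (fun h => by
        rw [h] at hr'
        simp at hr'
        omega)) (fun z hz => ⟨Finset.mem_insert_self _ _, hz q (Finset.mem_insert_self _ _),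
          fun w hw => by
            rcases Finset.mem_insert.1 hw with rfl | hw
            · exact Or.inl le_rfl
            · exact Or.inl (hlast w hw).le⟩)
    -- no line is charged for two faces
    have hss : P ⊂ insert q P := Finset.ssubset_insert q2
    have hR : (S.filter (fun e => TransR x y k S P e ∧ y e < y c)).card +
        (S.filter (fun e => ∃ P₂, insert q P ⊆ P₂ ∧ Initial x y k S P₂ ∧
          TransR x y k S P₂ e)).card ≤
        (S.filter (fun e => ∃ P₂, P ⊆ P₂ ∧ Initial x y k S P₂ ∧ TransR x y k S P₂ e)).card := by
      rw [← Finset.card_union_of_disjoint]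
      · refine Finset.card_le_card (fun e he => ?_)
        simp only [Finset.mem_union, Finset.mem_filter] at he ⊢
        rcases he with ⟨h1, h2, -⟩ | ⟨h1, P₂, h2, h3⟩
        · exact ⟨h1, P, subset_rfl, hI.initial, h2⟩
        · exact ⟨h1, P₂, hss.subset.trans h2, h3⟩
      · rw [Finset.disjoint_filter]
        rintro e - ⟨⟨z, c, h1, -⟩, -⟩ ⟨P₂, h2, h3, h4⟩
        exact TransR.not_upAt hg hk h3 (hss.trans_subset h2) h4 z h1
    have hL : (S.filter (fun e => TransL x y k S (insert q P) e ∧ y e ≤ y q)).card +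
        (S.filter (fun e => ∃ P₂, insert q P ⊂ P₂ ∧ Initial x y k S P₂ ∧
          TransL x y k S P₂ e)).card ≤
        (S.filter (fun e => ∃ P₂, P ⊂ P₂ ∧ Initial x y k S P₂ ∧ TransL x y k S P₂ e)).card := by
      rw [← Finset.card_union_of_disjoint]
      · refine Finset.card_le_card (fun e he => ?_)
        simp only [Finset.mem_union, Finset.mem_filter] at he ⊢
        rcases he with ⟨h1, h2, -⟩ | ⟨h1, P₂, h2, h3⟩
        · exact ⟨h1, insert q P, hss, hP', h2⟩
        · exact ⟨h1, P₂, hss.trans h2, h3⟩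
      · rw [Finset.disjoint_filter]
        rintro e - ⟨h1, -⟩ ⟨P₂, h2, h3, ⟨z, c, h4, -⟩⟩
        exact h1.not_lowAt hg hk hP' h3 h2 z h4
    exact ⟨i1, by omega, by omega⟩

/-- Every line costs at most five steps per crossing and two steps for each of the at most `2 n` lines
charged in its walks, which explains the `9 n + 1` steps per line. -/
theorem addLines_spec (hg : Simple x y) (l : List (Fin n)) (last : Option (Fin n)) (r : ℕ)
    (under : Fin n → Option (Fin n)) (L : Links n) (S : Finset (Fin n))
    (hl : l.Pairwise (fun a b => y a < y b)) (hlS : ∀ k ∈ l, ∀ j ∈ S, y j < y k)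
    (hr : r = S.card) (hlast0 : last = none → S = ∅)
    (hlast1 : ∀ c, last = some c → c ∈ S ∧ ∀ j ∈ S, y j ≤ y c)
    (hu0 : ∀ c ∈ S, under c = none → ∀ j ∈ S, y c ≤ y j)
    (hu1 : ∀ c ∈ S, ∀ u, under c = some u → u ∈ S ∧ y u < y c ∧ ∀ j ∈ S, y j ≤ y u ∨ y c ≤ y j)
    (hin : ∀ v ∈ S, Linked L v (S.erase v) (fun w => cut x y w v))
    (hout : ∀ v ∉ S, Linked L v ∅ (fun w => cut x y w v)) :
    (∀ v, v ∈ S ∨ v ∈ l → Linked (addLines x y l last r under L).val v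
      ((S ∪ l.toFinset).erase v) (fun w => cut x y w v)) ∧
    (addLines x y l last r under L).time ≤ l.length * (9 * n + 1) ∧
    (addLines x y l last r under L).diagrams = 0 := by
  classical
  induction l generalizing last r under L S with
  | nil => simpa [addLines] using hin
  | cons k l ih =>
    obtain ⟨hkl, hl⟩ := List.pairwise_cons.1 hl
    have hk : ∀ j ∈ S, y j < y k := hlS k List.mem_cons_self
    have hkS : k ∉ S := fun h => lt_irrefl _ (hk k h)
    -- after the insertion of `k`
    have key : ∀ L' : Links n, Inserting x y k S S L' →
        (∀ v, v ∈ S ∨ v ∈ k :: l →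
          Linked (addLines x y l (some k) (r + 1) (Function.update under k last) L').val v
            ((S ∪ (k :: l).toFinset).erase v) (fun w => cut x y w v)) ∧
        (addLines x y l (some k) (r + 1) (Function.update under k last) L').time ≤
          l.length * (9 * n + 1) ∧
        (addLines x y l (some k) (r + 1) (Function.update under k last) L').diagrams = 0 := by
      intro L' hI
      have := ih (some k) (r + 1) (Function.update under k last) L' (insert k S) hl ?_ ?_ ?_ ?_ ?_
        ?_ ?_ ?_
      · refine ⟨fun v hv => ?_, this.2⟩
        have h1 := this.1 v (by simpa [or_assoc, or_left_comm] using hv)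
        rwa [Finset.insert_union, ← Finset.union_insert, ← List.toFinset_cons] at h1
      · intro k' hk' j hj
        rcases Finset.mem_insert.1 hj with rfl | hj
        · exact hkl k' hk'
        · exact hlS k' (List.mem_cons_of_mem _ hk') j hj
      · rw [Finset.card_insert_of_notMem hkS, hr]
      · simp
      · rintro c ⟨⟩
        refine ⟨Finset.mem_insert_self _ _, fun j hj => ?_⟩
        rcases Finset.mem_insert.1 hj with rfl | hj
        · exact le_rfl
        · exact (hk j hj).le
      · intro c hc hcn j hj
        rcases Finset.mem_insert.1 hc with rfl | hc'
        · rw [Function.update_self] at hcn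
          rw [hlast0 hcn] at hj
          simp at hj
          rw [hj]
        · rw [Function.update_of_ne (ne_of_mem_of_not_mem hc' hkS)] at hcn
          rcases Finset.mem_insert.1 hj with rfl | hj
          · exact (hk c hc').le
          · exact hu0 c hc' hcn j hj
      · intro c hc u hcu
        rcases Finset.mem_insert.1 hc with rfl | hc'
        · rw [Function.update_self] at hcu
          obtain ⟨h1, h2⟩ := hlast1 u hcu
          refine ⟨Finset.mem_insert_of_mem h1, hk u h1, fun j hj => ?_⟩
          rcases Finset.mem_insert.1 hj with rfl | hj
          · exact Or.inr le_rfl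
          · exact Or.inl (h2 j hj)
        · rw [Function.update_of_ne (ne_of_mem_of_not_mem hc' hkS)] at hcu
          obtain ⟨h1, h2, h3⟩ := hu1 c hc' u hcu
          refine ⟨Finset.mem_insert_of_mem h1, h2, fun j hj => ?_⟩
          rcases Finset.mem_insert.1 hj with rfl | hj
          · exact Or.inr (hk c hc').le
          · exact h3 j hj
      · intro v hv
        rcases Finset.mem_insert.1 hv with rfl | hv
        · rw [Finset.erase_insert hkS]
          exact hI.new
        · rw [Finset.erase_insert_of_ne (ne_of_mem_of_not_mem hv hkS).symm]
          exact hI.crossed v hv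
      · intro v hv
        rw [Finset.mem_insert, not_or] at hv
        exact hI.out v hv.2 hv.1
    rcases last with _ | c
    · have hS := hlast0 rfl
      obtain ⟨k1, k2, k3⟩ := key L (by
        subst hS
        exact ⟨⟨subset_rfl, by simp⟩, by simp, by simp, hout k hkS, fun v hv _ => hout v hv⟩)
      simp only [addLines, Run.val_bind, val_step, Run.time_bind, time_step, Run.diagrams_bind,
        diagrams_step, Run.val_pure, Run.time_pure, Run.diagrams_pure, List.length_cons]
      refine ⟨k1, ?_, by omega⟩
      rw [add_mul]
      omega
    · obtain ⟨hcS, hcmax⟩ := hlast1 c rfl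
      have hne : ∀ j ∈ S, Function.update under k (some c) j = under j := fun j hj =>
        Function.update_of_ne (ne_of_mem_of_not_mem hj hkS) _ _
      obtain ⟨a1, a2, a3⟩ := addCrossings_spec hg hk (Function.update under k (some c))
        (fun j hj h => hu0 j hj (by rwa [hne j hj] at h))
        (fun j hj u h => hu1 j hj u (by rwa [hne j hj] at h)) r c none none L ∅
        ⟨⟨by simp, by simp⟩, by simp, fun v hv _ => hin v hv, hout k hkS, fun v hv _ => hout v hv⟩
        (by simpa using hr)
        (fun _ => by
          -- far to the left, the line of largest slope is the lowest one
          obtain ⟨z, -, hz⟩ := exists_lt_all (insert k (S.erase c)) (fun w => cut x y w c) 0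
          refine ⟨z, ⟨hcS, by simp, hz k (Finset.mem_insert_self _ _), fun j hj _ hjc => ?_,
            by simp⟩, fun w hw => hz w (Finset.mem_insert_of_mem hw)⟩
          have hlt : y j < y c := lt_of_le_of_ne (hcmax j hj) (fun h => hjc (hg.inj h))
          exact (line_gt_iff hlt z).2
            (hz j (Finset.mem_insert_of_mem (Finset.mem_erase.2 ⟨hjc, hj⟩))))
        (fun z _ => by simp)
      obtain ⟨k1, k2, k3⟩ := key _ a1
      simp only [addLines, Run.val_bind, val_step, Run.time_bind, time_step, Run.diagrams_bind,
        diagrams_step, List.length_cons]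
      refine ⟨k1, ?_, by omega⟩
      have c1 := Finset.card_filter_le S
        (fun e => ∃ P₂, ∅ ⊆ P₂ ∧ Initial x y k S P₂ ∧ TransR x y k S P₂ e)
      have c2 := Finset.card_filter_le S
        (fun e => ∃ P₂, ∅ ⊂ P₂ ∧ Initial x y k S P₂ ∧ TransL x y k S P₂ e)
      have c3 : S.card ≤ n := by simpa using Finset.card_le_univ S
      rw [add_mul]
      omega

theorem readLine_spec {v : Fin n} {S : Finset (Fin n)} (L : Links n)
    (hL : Linked L v S (fun w => cut x y w v))
    (hinj : Set.InjOn (fun w => cut x y w v) S) (f : ℕ) (z : ℝ) (o : Option (Fin n))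
    (ho : Next S (fun w => cut x y w v) z o)
    (hf : (S.filter (fun w => z < cut x y w v)).card ≤ f) (A B : Array (Fin n)) :
    (∃ l : List (Fin n), l.Pairwise (fun a b => cut x y a v < cut x y b v) ∧
      (∀ w, w ∈ l ↔ w ∈ S ∧ z < cut x y w v) ∧
      (readLine y L v f o A B).val.1.toList =
        A.toList ++ l.filter (fun u => decide (y v < y u)) ∧
      (readLine y L v f o A B).val.2.toList =
        B.toList ++ l.filter (fun u => !decide (y v < y u))) ∧
    (readLine y L v f o A B).time ≤ 2 * f ∧ (readLine y L v f o A B).diagrams = 0 := by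
  induction f generalizing z o A B with
  | zero =>
    refine ⟨⟨[], by simp, fun w => ?_, by simp [readLine], by simp [readLine]⟩, by simp [readLine],
      by simp [readLine]⟩
    have := Finset.card_eq_zero.1 (Nat.le_zero.1 hf)
    simp only [List.not_mem_nil, false_iff]
    intro hw
    have hw' : w ∈ S.filter (fun w => z < cut x y w v) := by simpa using hw
    rw [this] at hw'
    simp at hw'
  | succ f ih =>
    rcases o with _ | c
    · rw [next_none] at ho
      refine ⟨⟨[], by simp, fun w => ?_, by simp [readLine], by simp [readLine]⟩,
        by simp [readLine], by simp [readLine]⟩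
      simp only [List.not_mem_nil, false_iff, not_and, not_lt]
      exact fun hw => (ho w hw).le
    · rw [next_some] at ho
      obtain ⟨hcS, hzc, hc⟩ := ho
      obtain ⟨z', hz1, -, hz3⟩ := exists_right S (fun w => cut x y w v) (cut x y c v)
        (cut x y c v + 1) (by linarith)
      have hnext := hL.next (z := z') (o := some c) ⟨hcS, hz1, hz3⟩
      have hmem : ∀ w ∈ S, z < cut x y w v ∧ cut x y w v ≠ cut x y c v ↔ z' < cut x y w v := by
        intro w hw
        constructor
        · rintro ⟨h1, h2⟩
          rcases hz3 w hw with h | h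
          · rcases hc w hw with h' | h'
            · exact absurd (le_antisymm h h') h2
            · linarith
          · exact h
        · intro h
          exact ⟨by linarith, (hz1.trans h).ne'⟩
      have hcard : (S.filter (fun w => z' < cut x y w v)).card <
          (S.filter (fun w => z < cut x y w v)).card :=
        Finset.card_lt_card ((Finset.ssubset_iff_of_subset (fun j hj => by
          simp only [Finset.mem_filter] at hj ⊢
          exact ⟨hj.1, ((hmem j hj.1).2 hj.2).1⟩)).2 ⟨c, by simp [hcS, hzc], by simp [hz1.le]⟩)
      have hmem' : ∀ (l : List (Fin n)), (∀ w, w ∈ l ↔ w ∈ S ∧ z' < cut x y w v) →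
          ∀ w, w ∈ c :: l ↔ w ∈ S ∧ z < cut x y w v := by
        intro l hl w
        rw [List.mem_cons, hl]
        constructor
        · rintro (rfl | ⟨h1, h2⟩)
          · exact ⟨hcS, hzc⟩
          · exact ⟨h1, ((hmem w h1).2 h2).1⟩
        · rintro ⟨h1, h2⟩
          by_cases hwc : w = c
          · exact Or.inl hwc
          · exact Or.inr ⟨h1, (hmem w h1).1 ⟨h2, fun h => hwc (hinj h1 hcS h)⟩⟩
      by_cases hvc : y v < y c
      · obtain ⟨⟨l, l1, l2, l3, l4⟩, i2, i3⟩ := ih z' (L.nxt v (some c)) hnext (by omega)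
          (A.push c) B
        simp only [readLine, Run.val_bind, val_step, Run.time_bind, time_step, Run.diagrams_bind,
          diagrams_step, hvc, decide_true, if_true]
        refine ⟨⟨c :: l, List.pairwise_cons.2 ⟨fun w hw => hz1.trans ((l2 w).1 hw).2, l1⟩,
          hmem' l l2, ?_, ?_⟩, by omega, by omega⟩
        · rw [l3]
          simp [hvc]
        · rw [l4]
          simp [hvc]
      · obtain ⟨⟨l, l1, l2, l3, l4⟩, i2, i3⟩ := ih z' (L.nxt v (some c)) hnext (by omega)
          A (B.push c)
        simp only [readLine, Run.val_bind, val_step, Run.time_bind, time_step, Run.diagrams_bind,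
          diagrams_step, hvc, decide_false, Bool.false_eq_true, if_false]
        refine ⟨⟨c :: l, List.pairwise_cons.2 ⟨fun w hw => hz1.trans ((l2 w).1 hw).2, l1⟩,
          hmem' l l2, ?_, ?_⟩, by omega, by omega⟩
        · rw [l3]
          simp [hvc]
        · rw [l4]
          simp [hvc]

/-- The table `cyc` holds, for every vertex, the vertices above it and those below it, in clockwise
order. -/
structure IsClockwise (x y : Fin n → ℝ) (cyc : Fin n → Array (Fin n) × Array (Fin n)) : Prop where
  mem_above : ∀ v u, u ∈ (cyc v).1.toList ↔ y v < y u
  mem_below : ∀ v u, u ∈ (cyc v).2.toList ↔ y u < y v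
  above : ∀ v, (cyc v).1.toList.Pairwise (fun a b => cut x y a v < cut x y b v)
  below : ∀ v, (cyc v).2.toList.Pairwise (fun a b => cut x y a v < cut x y b v)

theorem readLines_spec (hg : Simple x y) (L : Links n)
    (hL : ∀ v, Linked L v (Finset.univ.erase v) (fun w => cut x y w v)) (l : List (Fin n)) :
    (∀ v ∈ l, (∀ u, u ∈ ((readLines y L l).val v).1.toList ↔ y v < y u) ∧
      (∀ u, u ∈ ((readLines y L l).val v).2.toList ↔ y u < y v) ∧
      ((readLines y L l).val v).1.toList.Pairwise (fun a b => cut x y a v < cut x y b v) ∧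
      ((readLines y L l).val v).2.toList.Pairwise (fun a b => cut x y a v < cut x y b v)) ∧
    (readLines y L l).time ≤ n + l.length * (2 * n + 2) ∧ (readLines y L l).diagrams = 0 := by
  induction l with
  | nil => simp [readLines]
  | cons v l ih =>
    obtain ⟨h1, h2, h3⟩ := ih
    obtain ⟨z, -, hz⟩ := exists_lt_all (Finset.univ.erase v) (fun w => cut x y w v) 0
    obtain ⟨⟨s, s1, s2, s3, s4⟩, s5, s6⟩ := readLine_spec L (hL v) (hg.injOn (by simp)) n z
      (L.nxt v none) ((hL v).next (o := none) hz)
      ((Finset.card_le_univ _).trans (by simp)) #[] #[]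
    simp only [readLines, Run.val_bind, val_step, Run.time_bind, time_step, Run.diagrams_bind,
      diagrams_step, List.length_cons]
    refine ⟨fun u hu => ?_, ?_, by omega⟩
    · by_cases huv : u = v
      · subst huv
        rw [Function.update_self, s3, s4]
        refine ⟨fun w => ?_, fun w => ?_, ?_, ?_⟩
        · simp only [List.nil_append, List.mem_filter, s2, decide_eq_true_eq,
            Finset.mem_erase, Finset.mem_univ, and_true]
          constructor
          · exact fun h => h.2
          · exact fun h => ⟨⟨fun e => h.ne (congrArg y e).symm,
              hz w (by simpa using fun e : w = u => h.ne (congrArg y e).symm)⟩, h⟩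
        · simp only [List.nil_append, List.mem_filter, s2, Bool.not_eq_true',
            decide_eq_false_iff_not, Finset.mem_erase, Finset.mem_univ, and_true, not_lt]
          constructor
          · exact fun h => lt_of_le_of_ne h.2 (fun e => h.1.1 (hg.inj e))
          · exact fun h => ⟨⟨fun e => h.ne (congrArg y e),
              hz w (by simpa using fun e : w = u => h.ne (congrArg y e))⟩, h.le⟩
        · simpa using s1.filter _
        · simpa using s1.filter _
      · rw [Function.update_of_ne huv]
        exact h1 u ((List.mem_cons.1 hu).resolve_left huv)
    · rw [add_mul]
      omega

/-- The clockwise orders are computed in quadratic time. -/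
theorem cyclicOrders_spec (hg : Simple x y) (order : List (Fin n))
    (hsort : order.Pairwise (fun a b => y a < y b)) (hall : ∀ v, v ∈ order) :
    IsClockwise x y (cyclicOrders x y order).val ∧
    (cyclicOrders x y order).time ≤ 2 * n ^ 2 + 2 * n + order.length * (11 * n + 3) ∧
    (cyclicOrders x y order).diagrams = 0 := by
  obtain ⟨a1, a2, a3⟩ := addLines_spec hg order none 0 (fun _ => none)
    ⟨fun _ _ => none, fun _ _ => none⟩ ∅ hsort (by simp) (by simp) (by simp) (by simp) (by simp)
    (by simp) (by simp) (fun v _ => linked_empty)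
  have huniv : order.toFinset = Finset.univ := by
    ext v
    simp [hall v]
  rw [Finset.empty_union, huniv] at a1
  obtain ⟨r1, r2, r3⟩ := readLines_spec hg _ (fun v => a1 v (Or.inr (hall v))) order
  simp only [cyclicOrders, Run.val_bind, Run.time_bind, time_tick, Run.diagrams_bind,
    diagrams_tick]
  refine ⟨⟨fun v => (r1 v (hall v)).1, fun v => (r1 v (hall v)).2.1, fun v => (r1 v (hall v)).2.2.1,
    fun v => (r1 v (hall v)).2.2.2⟩, ?_, by omega⟩
  have : order.length * (11 * n + 3) =
    order.length * (9 * n + 1) + order.length * (2 * n + 2) := by ring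
  omega

end CyclicOrders

/-! ### Angles around a vertex and the minimum angle -/

section Angles

theorem angleOf_polar (a b : ℝ) :
    a = ‖(⟨a, b⟩ : ℂ)‖ * Real.cos (angleOf a b) ∧ b = ‖(⟨a, b⟩ : ℂ)‖ * Real.sin (angleOf a b) := by
  have h : angleOf a b =
      Complex.arg ⟨a, b⟩ - toIcoDiv Real.two_pi_pos 0 (Complex.arg ⟨a, b⟩) * (2 * Real.pi) := by
    rw [angleOf, ← self_sub_toIcoDiv_zsmul, zsmul_eq_mul]
  rw [h, Real.cos_sub_int_mul_two_pi, Real.sin_sub_int_mul_two_pi, Complex.norm_mul_cos_arg,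
    Complex.norm_mul_sin_arg]
  exact ⟨rfl, rfl⟩

theorem angleOf_mem_Ico (a b : ℝ) : 0 ≤ angleOf a b ∧ angleOf a b < 2 * Real.pi := by
  have := toIcoMod_mem_Ico Real.two_pi_pos 0 (Complex.arg ⟨a, b⟩)
  rwa [zero_add] at this

theorem norm_pos_of_im_ne {a b : ℝ} (hb : b ≠ 0) : 0 < ‖(⟨a, b⟩ : ℂ)‖ := by
  rw [norm_pos_iff]
  exact fun h => hb (congrArg Complex.im h)

theorem angleOf_of_pos {a b : ℝ} (hb : 0 < b) : 0 < angleOf a b ∧ angleOf a b < Real.pi := by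
  obtain ⟨h0, h2⟩ := angleOf_mem_Ico a b
  have hp := (angleOf_polar a b).2
  have hn := norm_pos_of_im_ne (a := a) hb.ne'
  have hs : 0 < Real.sin (angleOf a b) := by
    by_contra h
    nlinarith
  constructor
  · refine lt_of_le_of_ne h0 (fun h => ?_)
    rw [← h, Real.sin_zero] at hs
    exact lt_irrefl _ hs
  · by_contra h
    have : Real.sin (angleOf a b) ≤ 0 := by
      rw [← neg_nonneg, ← Real.sin_sub_pi]
      exact Real.sin_nonneg_of_nonneg_of_le_pi (by linarith) (by linarith)
    linarith

theorem angleOf_of_neg {a b : ℝ} (hb : b < 0) :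
    Real.pi < angleOf a b ∧ angleOf a b < 2 * Real.pi := by
  obtain ⟨h0, h2⟩ := angleOf_mem_Ico a b
  have hp := (angleOf_polar a b).2
  have hn := norm_pos_of_im_ne (a := a) hb.ne
  refine ⟨?_, h2⟩
  by_contra h
  have := Real.sin_nonneg_of_nonneg_of_le_pi h0 (not_lt.1 h)
  nlinarith

/-- Two vectors on the same side of the horizontal axis: the cotangent decreases with the angle. -/
theorem angleOf_lt_of_div_lt {a b a' b' : ℝ} (hb : 0 < b * b') (h : a / b < a' / b') :
    angleOf a' b' < angleOf a b := by
  have hb0 : b ≠ 0 := left_ne_zero_of_mul hb.ne'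
  have hb0' : b' ≠ 0 := right_ne_zero_of_mul hb.ne'
  obtain ⟨e1, e2⟩ := angleOf_polar a b
  obtain ⟨e1', e2'⟩ := angleOf_polar a' b'
  have hn := norm_pos_of_im_ne (a := a) hb0
  have hn' := norm_pos_of_im_ne (a := a') hb0'
  have hdiff : angleOf a' b' - angleOf a b < Real.pi := by
    rcases hb0.lt_or_gt with h0 | h0
    · have := angleOf_of_neg (a := a) h0
      have := angleOf_of_neg (a := a') (b := b') (by nlinarith)
      linarith
    · have := angleOf_of_pos (a := a) h0
      have := angleOf_of_pos (a := a') (b := b') (by nlinarith)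
      linarith
  by_contra hle
  have hs := Real.sin_nonneg_of_nonneg_of_le_pi (sub_nonneg.2 (not_lt.1 hle)) hdiff.le
  rw [Real.sin_sub] at hs
  have hlt : a * b' < a' * b := by
    have h1 := mul_lt_mul_of_pos_right h hb
    have h2 : a / b * (b * b') = a * b' := by field_simp
    have h3 : a' / b' * (b * b') = a' * b := by field_simp
    linarith
  have hkey : a * b' - a' * b = ‖(⟨a, b⟩ : ℂ)‖ * ‖(⟨a', b'⟩ : ℂ)‖ *
      (Real.sin (angleOf a' b') * Real.cos (angleOf a b) -
        Real.cos (angleOf a' b') * Real.sin (angleOf a b)) := by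
    calc a * b' - a' * b = (‖(⟨a, b⟩ : ℂ)‖ * Real.cos (angleOf a b)) *
          (‖(⟨a', b'⟩ : ℂ)‖ * Real.sin (angleOf a' b')) -
          (‖(⟨a', b'⟩ : ℂ)‖ * Real.cos (angleOf a' b')) *
          (‖(⟨a, b⟩ : ℂ)‖ * Real.sin (angleOf a b)) := by rw [← e1, ← e2, ← e1', ← e2']
      _ = _ := by ring
  have := mul_nonneg (mul_pos hn hn').le hs
  linarith

variable {d n : ℕ} {hd : 2 ≤ d} {p : Fin n → EuclideanSpace ℝ (Fin d)}

/-- The angle of the vertex `u` as seen from `v`. -/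
noncomputable def ang (hd : 2 ≤ d) (p : Fin n → EuclideanSpace ℝ (Fin d)) (v u : Fin n) : ℝ :=
  angleOf (e₁coord hd (p u) - e₁coord hd (p v)) (e₂coord hd (p u) - e₂coord hd (p v))

theorem ang_of_above {v u : Fin n} (h : e₂coord hd (p v) < e₂coord hd (p u)) :
    0 < ang hd p v u ∧ ang hd p v u < Real.pi := angleOf_of_pos (sub_pos.2 h)

theorem ang_of_below {v u : Fin n} (h : e₂coord hd (p u) < e₂coord hd (p v)) :
    Real.pi < ang hd p v u ∧ ang hd p v u < 2 * Real.pi := angleOf_of_neg (sub_neg.2 h)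

theorem ang_lt_of_cut_lt {v u w : Fin n}
    (hy : 0 < (e₂coord hd (p u) - e₂coord hd (p v)) * (e₂coord hd (p w) - e₂coord hd (p v)))
    (h : cut (fun v => e₁coord hd (p v)) (fun v => e₂coord hd (p v)) u v <
      cut (fun v => e₁coord hd (p v)) (fun v => e₂coord hd (p v)) w v) :
    ang hd p v w < ang hd p v u := angleOf_lt_of_div_lt hy h

theorem angle_proj {v u w : Fin n} (hu : e₂coord hd (p u) ≠ e₂coord hd (p v))
    (hw : e₂coord hd (p w) ≠ e₂coord hd (p v)) :
    EuclideanGeometry.angle (proj hd (p u)) (proj hd (p v)) (proj hd (p w)) =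
      Real.arccos (Real.cos (ang hd p v u - ang hd p v w)) := by
  have hnu := norm_pos_of_im_ne (a := e₁coord hd (p u) - e₁coord hd (p v)) (sub_ne_zero.2 hu)
  have hnw := norm_pos_of_im_ne (a := e₁coord hd (p w) - e₁coord hd (p v)) (sub_ne_zero.2 hw)
  obtain ⟨u1, u2⟩ := angleOf_polar (e₁coord hd (p u) - e₁coord hd (p v))
    (e₂coord hd (p u) - e₂coord hd (p v))
  obtain ⟨w1, w2⟩ := angleOf_polar (e₁coord hd (p w) - e₁coord hd (p v))
    (e₂coord hd (p w) - e₂coord hd (p v))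
  have hnorm : ∀ a b : ℝ, ‖(!₂[a, b] : EuclideanSpace ℝ (Fin 2))‖ = ‖(⟨a, b⟩ : ℂ)‖ := by
    intro a b
    rw [EuclideanSpace.norm_eq, Complex.norm_eq_sqrt_sq_add_sq]
    simp
  have hsub : ∀ u, proj hd (p u) - proj hd (p v) =
      !₂[e₁coord hd (p u) - e₁coord hd (p v), e₂coord hd (p u) - e₂coord hd (p v)] := by
    intro u
    ext i
    fin_cases i <;> simp [proj]
  rw [EuclideanGeometry.angle, InnerProductGeometry.angle, vsub_eq_sub, vsub_eq_sub, hsub, hsub,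
    hnorm, hnorm]
  congr 1
  rw [div_eq_iff (mul_pos hnu hnw).ne', Real.cos_sub]
  have : inner ℝ (!₂[e₁coord hd (p u) - e₁coord hd (p v), e₂coord hd (p u) - e₂coord hd (p v)] :
        EuclideanSpace ℝ (Fin 2))
      !₂[e₁coord hd (p w) - e₁coord hd (p v), e₂coord hd (p w) - e₂coord hd (p v)] =
      (e₁coord hd (p u) - e₁coord hd (p v)) * (e₁coord hd (p w) - e₁coord hd (p v)) +
      (e₂coord hd (p u) - e₂coord hd (p v)) * (e₂coord hd (p w) - e₂coord hd (p v)) := by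
    simp [PiLp.inner_apply, Fin.sum_univ_two, mul_comm]
  rw [this]
  simp only [ang]
  generalize e₁coord hd (p u) - e₁coord hd (p v) = a at *
  generalize e₂coord hd (p u) - e₂coord hd (p v) = b at *
  generalize e₁coord hd (p w) - e₁coord hd (p v) = a' at *
  generalize e₂coord hd (p w) - e₂coord hd (p v) = b' at *
  calc a * a' + b * b' = (‖(⟨a, b⟩ : ℂ)‖ * Real.cos (angleOf a b)) *
          (‖(⟨a', b'⟩ : ℂ)‖ * Real.cos (angleOf a' b')) +
          (‖(⟨a, b⟩ : ℂ)‖ * Real.sin (angleOf a b)) *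
          (‖(⟨a', b'⟩ : ℂ)‖ * Real.sin (angleOf a' b')) := by rw [← u1, ← u2, ← w1, ← w2]
    _ = _ := by ring

theorem arccos_cos_eq_abs {t : ℝ} (h : |t| ≤ Real.pi) : Real.arccos (Real.cos t) = |t| := by
  rw [← Real.cos_abs, Real.arccos_cos (abs_nonneg t) h]

theorem angle_proj_of_above {v u w : Fin n} (hu : e₂coord hd (p v) < e₂coord hd (p u))
    (hw : e₂coord hd (p v) < e₂coord hd (p w)) :
    EuclideanGeometry.angle (proj hd (p u)) (proj hd (p v)) (proj hd (p w)) =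
      |ang hd p v u - ang hd p v w| := by
  rw [angle_proj hu.ne' hw.ne', arccos_cos_eq_abs]
  have := ang_of_above hu
  have := ang_of_above hw
  rw [abs_le]
  constructor <;> linarith

theorem angle_proj_of_below {v u w : Fin n} (hu : e₂coord hd (p u) < e₂coord hd (p v))
    (hw : e₂coord hd (p w) < e₂coord hd (p v)) :
    EuclideanGeometry.angle (proj hd (p u)) (proj hd (p v)) (proj hd (p w)) =
      |ang hd p v u - ang hd p v w| := by
  rw [angle_proj hu.ne hw.ne, arccos_cos_eq_abs]
  have := ang_of_below hu
  have := ang_of_below hw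
  rw [abs_le]
  constructor <;> linarith

/-- In terms of the dual lines, general position of the projected points means that the arrangement is
simple. -/
theorem GPImmersed.simple (hp : GPImmersed hd p) :
    Simple (fun v => e₁coord hd (p v)) (fun v => e₂coord hd (p v)) := by
  refine ⟨hp.heights, fun {u w v} huv hwv huw h => hp.projected u v w huv hwv.symm huw ?_⟩
  have hy : ∀ {a b : Fin n}, a ≠ b → e₂coord hd (p a) - e₂coord hd (p b) ≠ 0 :=
    fun hab h => hab (hp.heights (sub_eq_zero.1 h))
  have hyu := hy huv
  have hyw := hy hwv
  rw [collinear_iff_of_mem (p₀ := proj hd (p v)) (by simp)]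
  simp only [cut] at h
  refine ⟨!₂[(e₁coord hd (p u) - e₁coord hd (p v)) / (e₂coord hd (p u) - e₂coord hd (p v)), 1], ?_⟩
  rintro q (rfl | rfl | rfl)
  · refine ⟨e₂coord hd (p u) - e₂coord hd (p v), ?_⟩
    ext i
    fin_cases i
    · simp [proj]
      field_simp
      ring
    · simp [proj]
  · exact ⟨0, by simp⟩
  · refine ⟨e₂coord hd (p w) - e₂coord hd (p v), ?_⟩
    ext i
    fin_cases i
    · simp only [h, proj]
      simp
      field_simp
      ring
    · simp [proj]

theorem GPImmersed.angle_pos (hp : GPImmersed hd p) {v u w : Fin n} (huv : u ≠ v) (hwv : w ≠ v)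
    (huw : u ≠ w) :
    0 < EuclideanGeometry.angle (proj hd (p u)) (proj hd (p v)) (proj hd (p w)) :=
  lt_of_le_of_ne (EuclideanGeometry.angle_nonneg _ _ _) (fun h =>
    hp.projected u v w huv hwv.symm huw (EuclideanGeometry.collinear_of_angle_eq_zero h.symm))

section MinAngle
variable {angleAt : Fin n → Fin n → Fin n → ℝ}

theorem minGap_spec (v : Fin n) (best : ℝ) (l : List (Fin n)) :
    (minGap angleAt v best l).val ≤ best ∧
    l.IsChain (fun u w => (minGap angleAt v best l).val ≤ angleAt u v w) ∧
    (0 < best → l.IsChain (fun u w => 0 < angleAt u v w) → 0 < (minGap angleAt v best l).val) ∧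
    (minGap angleAt v best l).time ≤ l.length + 1 ∧ (minGap angleAt v best l).diagrams = 0 := by
  induction l generalizing best with
  | nil => simp [minGap]
  | cons u l ih =>
    rcases l with _ | ⟨w, l⟩
    · simp [minGap]
    · obtain ⟨h1, h2, h3, h4, h5⟩ := ih (min best (angleAt u v w))
      simp only [minGap, Run.val_bind, val_step, Run.time_bind, time_step, Run.diagrams_bind,
        diagrams_step, List.isChain_cons_cons, List.length_cons]
      exact ⟨h1.trans (min_le_left _ _), ⟨h1.trans (min_le_right _ _), h2⟩,
        fun hb hc => h3 (lt_min hb hc.1) hc.2, by simp at h4; omega, by omega⟩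

theorem minAngle_spec (cyc : Fin n → Array (Fin n) × Array (Fin n)) (best : ℝ) (l : List (Fin n))
    (hpos : ∀ u v w, u ≠ v → w ≠ v → u ≠ w → 0 < angleAt u v w)
    (hnd : ∀ v, ((cyc v).1.toList ++ (cyc v).2.toList).Nodup)
    (hv : ∀ v, v ∉ (cyc v).1.toList ++ (cyc v).2.toList) :
    (minAngle angleAt cyc best l).val ≤ best ∧
    (∀ v ∈ l, ((cyc v).1.toList ++ (cyc v).2.toList).IsChain
      (fun u w => (minAngle angleAt cyc best l).val ≤ angleAt u v w)) ∧
    (0 < best → 0 < (minAngle angleAt cyc best l).val) ∧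
    (minAngle angleAt cyc best l).time ≤ l.length * (2 * n + 3) ∧
    (minAngle angleAt cyc best l).diagrams = 0 := by
  induction l generalizing best with
  | nil => simp [minAngle]
  | cons v l ih =>
    have hlen : ((cyc v).1.toList ++ (cyc v).2.toList).length ≤ n := by
      simpa using (hnd v).length_le_card
    have hndv := hnd v
    have hvv := hv v
    simp only [minAngle, Run.val_bind, val_step, Run.time_bind, time_step, Run.diagrams_bind,
      diagrams_step, time_tick, diagrams_tick, List.forall_mem_cons, List.length_cons]
    generalize (cyc v).1.toList ++ (cyc v).2.toList = around at hlen hndv hvv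
    rw [add_mul]
    rcases around with _ | ⟨u, _ | ⟨w, rest⟩⟩
    · obtain ⟨h1, h2, h3, h4, h5⟩ := ih best
      exact ⟨h1, ⟨List.IsChain.nil, h2⟩, h3, by simp; omega, by simp; omega⟩
    · obtain ⟨h1, h2, h3, h4, h5⟩ := ih best
      exact ⟨h1, ⟨List.IsChain.singleton _, h2⟩, h3, by simp; omega, by simp; omega⟩
    · obtain ⟨g1, g2, g3, g4, g5⟩ :=
        minGap_spec (angleAt := angleAt) v best (u :: w :: rest ++ [u])
      obtain ⟨h1, h2, h3, h4, h5⟩ :=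
        ih (minGap angleAt v best (u :: w :: rest ++ [u])).val
      refine ⟨h1.trans g1, ⟨?_, h2⟩, fun hb => h3 (g3 hb ?_), ?_, ?_⟩
      · exact g2.left_of_append.imp (fun a b hab => h1.trans hab)
      · -- consecutive entries of the closed list are different vertices
        have hne : (u :: w :: rest ++ [u]).IsChain (fun a b => a ≠ b ∧ a ≠ v ∧ b ≠ v) := by
          have hmem : ∀ a ∈ u :: w :: rest, a ≠ v := fun a ha h => hvv (h ▸ ha)
          rw [List.isChain_append]
          refine ⟨?_, List.IsChain.singleton _, ?_⟩
          · refine List.Pairwise.isChain ?_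
            refine List.Pairwise.imp_of_mem ?_ hndv
            exact fun ha hb hab => ⟨hab, hmem _ ha, hmem _ hb⟩
          · intro a ha b hb
            simp only [List.head?_cons, Option.mem_def, Option.some.injEq] at hb
            subst hb
            have ha' := List.mem_of_getLast? ha
            refine ⟨?_, hmem a ha', hmem u List.mem_cons_self⟩
            rintro rfl
            have h6 : (w :: rest).getLast? = some a := by
              simpa [List.getLast?_cons_cons] using ha
            exact (List.nodup_cons.1 hndv).1 (List.mem_of_getLast? h6)
        exact hne.imp (fun a b hab => hpos a v b hab.2.1 hab.2.2 hab.1)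
      · simp only [List.length_append, List.length_cons, List.length_nil] at g4 hlen
        simp only [Run.time_bind]
        omega
      · simp only [Run.diagrams_bind]
        omega

end MinAngle

/-- What the choice of `θ` has to guarantee: turning the direction from `v` to a vertex `u` above
`v` by `θ / 2` passes no other vertex above `v`, and the opposite direction does not hit a vertex
below `v`. -/
structure Separates (hd : 2 ≤ d) (p : Fin n → EuclideanSpace ℝ (Fin d)) (θ : ℝ) : Prop where
  pos : 0 < θ
  gap : ∀ v u w, e₂coord hd (p v) < e₂coord hd (p u) → e₂coord hd (p v) < e₂coord hd (p w) →
    ang hd p v w < ang hd p v u → θ ≤ ang hd p v u - ang hd p v w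
  opposite : ∀ v u w, e₂coord hd (p w) < e₂coord hd (p v) → e₂coord hd (p v) < e₂coord hd (p u) →
    ang hd p v w ≠ Real.pi + (ang hd p v u - θ / 2)

theorem IsClockwise.nodup {x y : Fin n → ℝ} {cyc : Fin n → Array (Fin n) × Array (Fin n)}
    (h : IsClockwise x y cyc) (v : Fin n) :
    ((cyc v).1.toList ++ (cyc v).2.toList).Nodup := by
  rw [List.nodup_append]
  refine ⟨(h.above v).imp (fun hab e => ?_), (h.below v).imp (fun hab e => ?_),
    fun a ha b hb e => ?_⟩
  · rw [e] at hab
    exact lt_irrefl _ hab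
  · rw [e] at hab
    exact lt_irrefl _ hab
  · rw [h.mem_above] at ha
    rw [h.mem_below, ← e] at hb
    exact lt_asymm ha hb

theorem IsClockwise.self_notMem {x y : Fin n → ℝ} {cyc : Fin n → Array (Fin n) × Array (Fin n)}
    (h : IsClockwise x y cyc) (v : Fin n) : v ∉ (cyc v).1.toList ++ (cyc v).2.toList := by
  rw [List.mem_append, h.mem_above, h.mem_below]
  simp

theorem IsClockwise.ang_above {cyc : Fin n → Array (Fin n) × Array (Fin n)}
    (h : IsClockwise (fun v => e₁coord hd (p v)) (fun v => e₂coord hd (p v)) cyc) (v : Fin n) :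
    (cyc v).1.toList.Pairwise (fun a b => ang hd p v b < ang hd p v a) := by
  refine (h.above v).imp_of_mem (fun {a b} ha hb hab => ang_lt_of_cut_lt ?_ hab)
  exact mul_pos (sub_pos.2 ((h.mem_above v a).1 ha)) (sub_pos.2 ((h.mem_above v b).1 hb))

theorem IsClockwise.ang_below {cyc : Fin n → Array (Fin n) × Array (Fin n)}
    (h : IsClockwise (fun v => e₁coord hd (p v)) (fun v => e₂coord hd (p v)) cyc) (v : Fin n) :
    (cyc v).2.toList.Pairwise (fun a b => ang hd p v b < ang hd p v a) := by
  refine (h.below v).imp_of_mem (fun {a b} ha hb hab => ang_lt_of_cut_lt ?_ hab)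
  exact mul_pos_of_neg_of_neg (sub_neg.2 ((h.mem_below v a).1 ha))
    (sub_neg.2 ((h.mem_below v b).1 hb))

/-- In a decreasing list, the gap between any two entries is at least the least gap between
consecutive entries. -/
theorem le_gap_of_isChain {l : List (Fin n)} {a : Fin n → ℝ} {θ : ℝ} (hθ : 0 ≤ θ)
    (hl : l.Pairwise (fun u w => a w < a u)) (hc : l.IsChain (fun u w => θ ≤ |a u - a w|))
    {u w : Fin n} (hu : u ∈ l) (hw : w ∈ l) (huw : u ≠ w) : θ ≤ |a u - a w| := by
  have h1 : l.IsChain (fun u w => θ ≤ a u - a w) := by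
    have h2 := List.Pairwise.isChain hl
    clear hl hu hw
    induction hc with
    | nil => exact List.IsChain.nil
    | singleton => exact List.IsChain.singleton _
    | cons_cons h _ ih =>
      rw [List.isChain_cons_cons] at h2 ⊢
      rw [abs_of_pos (sub_pos.2 h2.1)] at h
      exact ⟨h, ih h2.2⟩
  have : Trans (fun u w => θ ≤ a u - a w) (fun u w => θ ≤ a u - a w)
      (fun u w => θ ≤ a u - a w) := ⟨fun h h' => by linarith⟩
  have h3 : l.Pairwise (fun u w => θ ≤ |a u - a w|) :=
    (List.isChain_iff_pairwise.1 h1).imp (fun h => h.trans (le_abs_self _))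
  have : Std.Symm (fun u w => θ ≤ |a u - a w|) := ⟨fun u w h => by rwa [abs_sub_comm]⟩
  exact h3.forall hu hw huw

/-- The angle computed by the algorithm has the properties that the splits rely on. It is a lower bound
for the gaps above each vertex and below each vertex; the second fact rules out opposite
directions. -/
theorem minAngle_separates (hp : GPImmersed hd p) {cyc : Fin n → Array (Fin n) × Array (Fin n)}
    (h : IsClockwise (fun v => e₁coord hd (p v)) (fun v => e₂coord hd (p v)) cyc)
    (order : List (Fin n)) (hall : ∀ v, v ∈ order) :
    Separates hd p (minAngle (fun u v w => EuclideanGeometry.angle (proj hd (p u)) (proj hd (p v))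
      (proj hd (p w))) cyc Real.pi order).val := by
  obtain ⟨h1, h2, h3, -⟩ := minAngle_spec (angleAt := fun u v w =>
    EuclideanGeometry.angle (proj hd (p u)) (proj hd (p v)) (proj hd (p w))) cyc Real.pi order
    (fun u v w huv hwv huw => hp.angle_pos huv hwv huw) h.nodup h.self_notMem
  generalize (minAngle (fun u v w => EuclideanGeometry.angle (proj hd (p u)) (proj hd (p v))
    (proj hd (p w))) cyc Real.pi order).val = θ at h1 h2 h3
  have hpos := h3 Real.pi_pos
  have habove : ∀ v u w, e₂coord hd (p v) < e₂coord hd (p u) →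
      e₂coord hd (p v) < e₂coord hd (p w) → u ≠ w → θ ≤ |ang hd p v u - ang hd p v w| := by
    intro v u w hu hw huw
    refine le_gap_of_isChain hpos.le (h.ang_above v) ?_ ((h.mem_above v u).2 hu)
      ((h.mem_above v w).2 hw) huw
    refine (h2 v (hall v)).left_of_append.imp_of_mem_imp (fun {a b} ha hb hab => ?_)
    rwa [angle_proj_of_above ((h.mem_above v a).1 ha) ((h.mem_above v b).1 hb)] at hab
  have hbelow : ∀ v u w, e₂coord hd (p u) < e₂coord hd (p v) →
      e₂coord hd (p w) < e₂coord hd (p v) → u ≠ w → θ ≤ |ang hd p v u - ang hd p v w| := by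
    intro v u w hu hw huw
    refine le_gap_of_isChain hpos.le (h.ang_below v) ?_ ((h.mem_below v u).2 hu)
      ((h.mem_below v w).2 hw) huw
    refine (h2 v (hall v)).right_of_append.imp_of_mem_imp (fun {a b} ha hb hab => ?_)
    rwa [angle_proj_of_below ((h.mem_below v a).1 ha) ((h.mem_below v b).1 hb)] at hab
  refine ⟨hpos, fun v u w hu hw huw => ?_, fun v u w hw hu heq => ?_⟩
  · have := habove v u w hu hw (fun e => by rw [e] at huw; exact lt_irrefl _ huw)
    rwa [abs_of_pos (sub_pos.2 huw)] at this
  · -- otherwise the other two angles of the triangle sum up to `θ / 2`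
    have e1 := angle_proj (hd := hd) (p := p) hu.ne' hw.ne
    rw [heq, show ang hd p v u - (Real.pi + (ang hd p v u - θ / 2)) = -(Real.pi - θ / 2) by ring,
      Real.cos_neg, Real.arccos_cos (by linarith) (by linarith)] at e1
    have hvw : proj hd (p w) ≠ proj hd (p v) := by
      intro h
      have : proj hd (p w) 1 = proj hd (p v) 1 := by rw [h]
      simp [proj] at this
      exact hw.ne this
    have e2 := EuclideanGeometry.angle_add_angle_add_angle_eq_pi (proj hd (p u)) hvw
    have e3 := hbelow u v w hu (hw.trans hu) (fun e => by rw [e] at hw; exact lt_irrefl _ hw)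
    rw [← angle_proj_of_below hu (hw.trans hu)] at e3
    rw [EuclideanGeometry.angle_comm] at e1
    have e4 := EuclideanGeometry.angle_nonneg (proj hd (p u)) (proj hd (p w)) (proj hd (p v))
    rw [EuclideanGeometry.angle_comm] at e4
    have e5 := EuclideanGeometry.angle_comm (proj hd (p u)) (proj hd (p v)) (proj hd (p w))
    have e6 := EuclideanGeometry.angle_comm (proj hd (p v)) (proj hd (p w)) (proj hd (p u))
    have e7 := EuclideanGeometry.angle_comm (proj hd (p w)) (proj hd (p u)) (proj hd (p v))
    linarith

end Angles

/-! ### Indegrees from augmented persistence diagrams -/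

section Diagrams
variable {d n : ℕ}

/-- Every edge is one event at its own height, whatever the order of the edges. -/
theorem count_events (h : Fin n → ℝ) (H : SimpleGraph (Fin n)) (l : List (Fin n × Fin n)) (c : ℝ) :
    ((events h H l).dim1.map Prod.fst).count c +
      ((events h H l).dim0.map Prod.snd).count (c : WithTop ℝ) =
      l.countP (fun e => decide (edgeHeight h e = c)) := by
  induction l generalizing H with
  | nil =>
    simp only [events, Multiset.map_zero, Multiset.count_zero, Multiset.map_map, List.countP_nil,
      zero_add]
    rw [Multiset.count_eq_zero]
    simp [Multiset.mem_replicate]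
  | cons e l ih =>
    have ih := ih (H ⊔ SimpleGraph.edge e.1 e.2)
    by_cases hr : H.Reachable e.1 e.2
    · simp only [events, hr, if_true, Multiset.map_cons, Multiset.count_cons, List.countP_cons,
        decide_eq_true_eq, eq_comm (a := c), ← ih]
      ring
    · simp only [events, hr, if_false, Multiset.map_cons, Multiset.count_cons, List.countP_cons,
        decide_eq_true_eq, ← ih, WithTop.coe_inj, eq_comm (a := c)]
      ring

open Classical in
/-- If no other vertex has the height of `v`, the edges of this height are those from `v` down to lower
vertices. The list `w` may be any list of all other vertices. -/
theorem countP_edgeHeight {G : SimpleGraph (Fin n)} {l : List (Fin n × Fin n)}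
    (hl : ListsEdges G l) (h : Fin n → ℝ) (v : Fin n) (hv : ∀ u, u ≠ v → h u ≠ h v)
    (w : List (Fin n)) (hw : w.Nodup) (hmem : ∀ u, u ≠ v → u ∈ w) :
    l.countP (fun e => decide (edgeHeight h e = h v)) =
      w.countP (fun u => decide (G.Adj v u) && decide (h u < h v)) := by
  have hinj : Function.Injective (fun u : Fin n => s(v, u)) := fun a b hab => Sym2.congr_right.1 hab
  rw [List.countP_eq_length_filter, List.countP_eq_length_filter,
    ← List.length_map (f := fun e : Fin n × Fin n => s(e.1, e.2)),
    ← List.length_map (f := fun u => s(v, u))]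
  apply List.Perm.length_eq
  rw [List.perm_ext_iff_of_nodup]
  · intro z
    simp only [List.mem_map, List.mem_filter, decide_eq_true_eq, Bool.and_eq_true]
    constructor
    · rintro ⟨⟨a, b⟩, ⟨he, hh⟩, rfl⟩
      have hadj : G.Adj a b := (hl.2 s(a, b)).1 (List.mem_map.2 ⟨(a, b), he, rfl⟩)
      simp only [edgeHeight] at hh
      by_cases hav : a = v
      · subst hav
        exact ⟨b, ⟨hmem b hadj.ne', hadj, lt_of_le_of_ne (hh ▸ le_max_right _ _)
          (hv b hadj.ne')⟩, rfl⟩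
      · have hbv : b = v := by
          by_contra hb
          rcases max_choice (h a) (h b) with hm | hm <;> rw [hm] at hh
          · exact hv a hav hh
          · exact hv b hb hh
        subst hbv
        exact ⟨a, ⟨hmem a hav, hadj.symm, lt_of_le_of_ne (hh ▸ le_max_left _ _) (hv a hav)⟩,
          Sym2.eq_swap⟩
    · rintro ⟨u, ⟨-, hadj, hlt⟩, rfl⟩
      obtain ⟨⟨a, b⟩, he, hab⟩ := List.mem_map.1 ((hl.2 s(v, u)).2 hadj)
      refine ⟨(a, b), ⟨he, ?_⟩, hab⟩
      rcases Sym2.eq_iff.1 hab with ⟨h1, h2⟩ | ⟨h1, h2⟩ <;> simp only at h1 h2 <;>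
        subst h1 <;> subst h2
      · exact max_eq_left hlt.le
      · exact max_eq_right hlt.le
  · exact hl.1.sublist (List.Sublist.map _ List.filter_sublist)
  · exact (hw.filter _).map hinj

open Classical in
/-- The number of events at the height of `v` is the number of lower neighbours of `v`, provided that no
other vertex has the height of `v`. -/
theorem indegree_spec {p : Fin n → EuclideanSpace ℝ (Fin d)} {G : SimpleGraph (Fin n)}
    {s : EuclideanSpace ℝ (Fin d)} {D : APD} (hD : IsAPD p G s D) (v : Fin n)
    (hv : ∀ u, u ≠ v → inner ℝ s (p u) ≠ inner ℝ s (p v))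
    (w : List (Fin n)) (hw : w.Nodup) (hmem : ∀ u, u ≠ v → u ∈ w) :
    (indegree n D (inner ℝ s (p v))).val =
      w.countP (fun u => decide (G.Adj v u) && decide (inner ℝ s (p u) < inner ℝ s (p v))) := by
  obtain ⟨l, hl, -, rfl⟩ := hD
  rw [← countP_edgeHeight hl (fun u => inner ℝ s (p u)) v hv w hw hmem,
    ← count_events (fun u => inner ℝ s (p u)) ⊥ l]
  rfl

theorem indegree_cost (D : APD) (c : ℝ) :
    (indegree n D c).time = 2 * Nat.log 2 n + 3 ∧ (indegree n D c).diagrams = 0 := by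
  constructor
  · simp only [indegree, birthsAt, deathsAt, Run.time_bind, time_step]
    ring
  · rfl

end Diagrams

/-! ### Directions in the plane -/

section Directions
variable {d n : ℕ} {hd : 2 ≤ d} {p : Fin n → EuclideanSpace ℝ (Fin d)}

theorem inner_planeDirection (hd : 2 ≤ d) (β : ℝ) (q : EuclideanSpace ℝ (Fin d)) :
    inner ℝ (planeDirection d β).val q =
      Real.cos β * e₁coord hd q + Real.sin β * e₂coord hd q := by
  obtain ⟨k, rfl⟩ := Nat.exists_eq_add_of_le' hd
  simp [planeDirection, PiLp.inner_apply, Fin.sum_univ_succ, e₁coord, e₂coord, mul_comm]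

theorem norm_planeDirection (hd : 2 ≤ d) (β : ℝ) : ‖(planeDirection d β).val‖ = 1 := by
  have h : ‖(planeDirection d β).val‖ ^ 2 = 1 := by
    rw [← real_inner_self_eq_norm_sq, inner_planeDirection hd]
    simp [planeDirection, e₁coord, e₂coord, ← pow_two]
  exact (pow_eq_one_iff_of_nonneg (norm_nonneg _) two_ne_zero).1 h

theorem inner_planeDirection_sub (α : ℝ) (v u : Fin n) :
    inner ℝ (planeDirection d (α - Real.pi / 2)).val (p u) -
      inner ℝ (planeDirection d (α - Real.pi / 2)).val (p v) =
    ‖(⟨e₁coord hd (p u) - e₁coord hd (p v), e₂coord hd (p u) - e₂coord hd (p v)⟩ : ℂ)‖ *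
      Real.sin (α - ang hd p v u) := by
  obtain ⟨h1, h2⟩ := angleOf_polar (e₁coord hd (p u) - e₁coord hd (p v))
    (e₂coord hd (p u) - e₂coord hd (p v))
  rw [inner_planeDirection hd, inner_planeDirection hd, Real.cos_sub_pi_div_two,
    Real.sin_sub_pi_div_two, Real.sin_sub]
  rw [← ang] at h1 h2
  linear_combination Real.sin α * h1 - Real.cos α * h2

theorem sin_neg_iff {t : ℝ} (h1 : -Real.pi < t) (h2 : t < Real.pi) : Real.sin t < 0 ↔ t < 0 := by
  constructor
  · intro h
    by_contra hn
    exact absurd (Real.sin_nonneg_of_nonneg_of_le_pi (not_lt.1 hn) h2.le) (not_le.2 h)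
  · exact fun h => Real.sin_neg_of_neg_of_neg_pi_lt h h1

theorem inner_planeDirection_lt_above {α : ℝ} (h0 : 0 < α) (hpi : α < Real.pi) {v u : Fin n}
    (hu : e₂coord hd (p v) < e₂coord hd (p u)) :
    inner ℝ (planeDirection d (α - Real.pi / 2)).val (p u) <
      inner ℝ (planeDirection d (α - Real.pi / 2)).val (p v) ↔ α < ang hd p v u := by
  have hn := norm_pos_of_im_ne (a := e₁coord hd (p u) - e₁coord hd (p v)) (sub_pos.2 hu).ne'
  obtain ⟨a1, a2⟩ := ang_of_above hu
  rw [← sub_neg, inner_planeDirection_sub (hd := hd), ← sub_neg (a := α),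
    ← sin_neg_iff (t := α - ang hd p v u) (by linarith) (by linarith)]
  exact ⟨fun h => by_contra fun h' => not_lt.2 (mul_nonneg hn.le (not_lt.1 h')) h,
    mul_neg_of_pos_of_neg hn⟩

theorem inner_planeDirection_ne_above {α : ℝ} (h0 : 0 < α) (hpi : α < Real.pi) {v u : Fin n}
    (hu : e₂coord hd (p v) < e₂coord hd (p u)) (hne : α ≠ ang hd p v u) :
    inner ℝ (planeDirection d (α - Real.pi / 2)).val (p u) ≠
      inner ℝ (planeDirection d (α - Real.pi / 2)).val (p v) := by
  have hn := norm_pos_of_im_ne (a := e₁coord hd (p u) - e₁coord hd (p v)) (sub_pos.2 hu).ne'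
  obtain ⟨a1, a2⟩ := ang_of_above hu
  rw [← sub_ne_zero, inner_planeDirection_sub (hd := hd)]
  refine mul_ne_zero hn.ne' (fun h => ?_)
  rw [Real.sin_eq_zero_iff_of_lt_of_lt (by linarith) (by linarith)] at h
  exact hne (sub_eq_zero.1 h)

theorem inner_planeDirection_lt_below {α : ℝ} (h0 : 0 < α) (hpi : α < Real.pi) {v u : Fin n}
    (hu : e₂coord hd (p u) < e₂coord hd (p v)) :
    inner ℝ (planeDirection d (α - Real.pi / 2)).val (p u) <
      inner ℝ (planeDirection d (α - Real.pi / 2)).val (p v) ↔ ang hd p v u < Real.pi + α := by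
  have hn := norm_pos_of_im_ne (a := e₁coord hd (p u) - e₁coord hd (p v)) (sub_neg.2 hu).ne
  obtain ⟨a1, a2⟩ := ang_of_below hu
  have h1 : Real.sin (α - ang hd p v u) = Real.sin (ang hd p v u - Real.pi - α) := by
    rw [← Real.sin_add_two_pi, ← Real.sin_pi_sub]
    congr 1
    ring
  rw [← sub_neg, inner_planeDirection_sub (hd := hd), h1, ← sub_neg (a := ang hd p v u),
    ← sub_sub, ← sin_neg_iff (t := ang hd p v u - Real.pi - α) (by linarith) (by linarith)]
  exact ⟨fun h => by_contra fun h' => not_lt.2 (mul_nonneg hn.le (not_lt.1 h')) h,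
    mul_neg_of_pos_of_neg hn⟩

theorem inner_planeDirection_ne_below {α : ℝ} (h0 : 0 < α) (hpi : α < Real.pi) {v u : Fin n}
    (hu : e₂coord hd (p u) < e₂coord hd (p v)) (hne : ang hd p v u ≠ Real.pi + α) :
    inner ℝ (planeDirection d (α - Real.pi / 2)).val (p u) ≠
      inner ℝ (planeDirection d (α - Real.pi / 2)).val (p v) := by
  have hn := norm_pos_of_im_ne (a := e₁coord hd (p u) - e₁coord hd (p v)) (sub_neg.2 hu).ne
  obtain ⟨a1, a2⟩ := ang_of_below hu
  rw [← sub_ne_zero, inner_planeDirection_sub (hd := hd)]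
  refine mul_ne_zero hn.ne' (fun h => ?_)
  have h1 : Real.sin (α - ang hd p v u) = Real.sin (ang hd p v u - Real.pi - α) := by
    rw [← Real.sin_add_two_pi, ← Real.sin_pi_sub]
    congr 1
    ring
  rw [h1, Real.sin_eq_zero_iff_of_lt_of_lt (by linarith) (by linarith)] at h
  exact hne (by linarith)

end Directions

/-! ### The number of splits in the search at one vertex -/

section Splits
variable {α : Type}

/-- The number of splits in the multi-search for the entries of a list that satisfy `q`. -/
def splits (q : α → Bool) (l : List α) : ℕ :=
  if _h : l.countP q = 0 ∨ l.countP q = l.length then 0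
  else 1 + splits q (l.take ((l.length + 1) / 2)) + splits q (l.drop ((l.length + 1) / 2))
termination_by l.length
decreasing_by
  all_goals
    have := List.countP_le_length (p := q) (l := l)
    simp only [List.length_take, List.length_drop]
    omega

theorem splits_eq_zero {q : α → Bool} {l : List α} (h : l.countP q = 0 ∨ l.countP q = l.length) :
    splits q l = 0 := by
  rw [splits, dif_pos h]

theorem splits_eq_add {q : α → Bool} {l : List α}
    (h : ¬ (l.countP q = 0 ∨ l.countP q = l.length)) :
    splits q l = 1 + splits q (l.take ((l.length + 1) / 2)) +
      splits q (l.drop ((l.length + 1) / 2)) := by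
  rw [splits, dif_neg h]

theorem countP_take_add_countP_drop (q : α → Bool) (l : List α) (k : ℕ) :
    (l.take k).countP q + (l.drop k).countP q = l.countP q := by
  rw [← List.countP_append, List.take_append_drop]

/-- On each of the `Nat.clog 2 l.length` levels of the search tree, the arcs that are split contain
different entries that satisfy `q`. -/
theorem splits_le (q : α → Bool) (l : List α) :
    splits q l ≤ l.countP q * Nat.clog 2 l.length := by
  induction hk : l.length using Nat.strong_induction_on generalizing l with
  | _ k ih =>
    by_cases h : l.countP q = 0 ∨ l.countP q = l.length
    · rw [splits_eq_zero h]
      exact Nat.zero_le _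
    · rw [splits_eq_add h]
      push Not at h
      have hle := List.countP_le_length (p := q) (l := l)
      have hk2 : 2 ≤ k := by omega
      have h1 := ih ((l.take ((l.length + 1) / 2)).length) (by rw [List.length_take]; omega) _ rfl
      have h2 := ih ((l.drop ((l.length + 1) / 2)).length) (by rw [List.length_drop]; omega) _ rfl
      have hc : Nat.clog 2 k = Nat.clog 2 ((k + 1) / 2) + 1 := Nat.clog_of_two_le (by omega) hk2
      have hsum := countP_take_add_countP_drop q l ((l.length + 1) / 2)
      have m1 : Nat.clog 2 (l.take ((l.length + 1) / 2)).length ≤ Nat.clog 2 ((k + 1) / 2) :=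
        Nat.clog_mono_right 2 (by rw [List.length_take]; omega)
      have m2 : Nat.clog 2 (l.drop ((l.length + 1) / 2)).length ≤ Nat.clog 2 ((k + 1) / 2) :=
        Nat.clog_mono_right 2 (by rw [List.length_drop]; omega)
      have n1 := h1.trans (Nat.mul_le_mul_left _ m1)
      have n2 := h2.trans (Nat.mul_le_mul_left _ m2)
      rw [hc, ← hsum, mul_add, add_mul]
      omega

theorem splits_congr {q q' : α → Bool} {l : List α} (h : ∀ a ∈ l, q a = q' a) :
    splits q l = splits q' l := by
  induction hk : l.length using Nat.strong_induction_on generalizing l with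
  | _ k ih =>
    have hc : l.countP q = l.countP q' := List.countP_congr (fun a ha => by rw [h a ha])
    by_cases h0 : l.countP q = 0 ∨ l.countP q = l.length
    · rw [splits_eq_zero h0, splits_eq_zero (hc ▸ h0)]
    · have h0' : ¬ (l.countP q' = 0 ∨ l.countP q' = l.length) := by rwa [← hc]
      rw [splits_eq_add h0, splits_eq_add h0']
      push Not at h0
      have hle := List.countP_le_length (p := q) (l := l)
      rw [ih _ (by rw [List.length_take]; omega) (fun a ha => h a (List.mem_of_mem_take ha)) rfl,
        ih _ (by rw [List.length_drop]; omega) (fun a ha => h a (List.mem_of_mem_drop ha)) rfl]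

/-- If `g` entries are spread evenly over a list, they lie in different arcs from some level of the
search tree on, and each of them then costs one split on every further level. -/
theorem exists_le_splits [DecidableEq α] (i j g : ℕ) (l : List α) (hl : l.Nodup) (hg : g ≤ 2 ^ j)
    (hlen : 2 ^ (j + i) ≤ l.length) : ∃ q : α → Bool, l.countP q = g ∧ g * i ≤ splits q l := by
  induction hk : l.length using Nat.strong_induction_on generalizing i j g l with
  | _ k ih =>
    subst hk
    -- the two halves are searched independently
    have hglue : ∀ q₁ q₂ : α → Bool, ∃ q : α → Bool,
        (l.take ((l.length + 1) / 2)).countP q = (l.take ((l.length + 1) / 2)).countP q₁ ∧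
        (l.drop ((l.length + 1) / 2)).countP q = (l.drop ((l.length + 1) / 2)).countP q₂ ∧
        splits q (l.take ((l.length + 1) / 2)) = splits q₁ (l.take ((l.length + 1) / 2)) ∧
        splits q (l.drop ((l.length + 1) / 2)) = splits q₂ (l.drop ((l.length + 1) / 2)) := by
      intro q₁ q₂
      refine ⟨fun a => if a ∈ l.take ((l.length + 1) / 2) then q₁ a else q₂ a, ?_, ?_, ?_, ?_⟩
      · exact List.countP_congr (fun a ha => by simp [ha])
      · refine List.countP_congr (fun a ha => ?_)
        have : a ∉ l.take ((l.length + 1) / 2) := fun h =>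
          List.disjoint_take_drop hl le_rfl h ha
        simp [this]
      · exact splits_congr (fun a ha => by simp [ha])
      · refine splits_congr (fun a ha => ?_)
        have : a ∉ l.take ((l.length + 1) / 2) := fun h =>
          List.disjoint_take_drop hl le_rfl h ha
        simp [this]
    have hj := Nat.one_le_two_pow (n := j)
    have hi := Nat.one_le_two_pow (n := i)
    have hgl : g ≤ l.length := by
      rw [pow_add] at hlen
      nlinarith
    have hlt1 : (l.take ((l.length + 1) / 2)).length = (l.length + 1) / 2 := by
      rw [List.length_take]
      omega
    have hlt2 : (l.drop ((l.length + 1) / 2)).length = l.length / 2 := by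
      rw [List.length_drop]
      omega
    have hsum := fun q : α → Bool => countP_take_add_countP_drop q l ((l.length + 1) / 2)
    rcases Nat.eq_zero_or_pos g with rfl | hg0
    · exact ⟨fun _ => false, by simp, by simp⟩
    -- on the last level the positions of the entries do not matter
    rcases Nat.eq_zero_or_pos i with rfl | hi0
    · refine ⟨fun a => decide (a ∈ l.take g), ?_, by simp⟩
      rw [← countP_take_add_countP_drop _ l g]
      have h1 : (l.take g).countP (fun a => decide (a ∈ l.take g)) = g := by
        rw [List.countP_eq_length.2 (fun a ha => by simpa using ha), List.length_take]
        omega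
      have h2 : (l.drop g).countP (fun a => decide (a ∈ l.take g)) = 0 := by
        rw [List.countP_eq_zero]
        intro a ha h
        exact List.disjoint_take_drop hl le_rfl (by simpa using h) ha
      omega
    obtain ⟨i, rfl⟩ : ∃ i', i = i' + 1 := ⟨i - 1, by omega⟩
    have hglt : g < l.length := by
      rw [pow_add, pow_succ] at hlen
      have := Nat.one_le_two_pow (n := i)
      nlinarith
    rcases j with _ | j
    · -- a single entry, placed in the larger half
      obtain rfl : g = 1 := by simp at hg; omega
      rw [zero_add, pow_succ] at hlen
      obtain ⟨q₁, c1, s1⟩ := ih ((l.length + 1) / 2) (by omega) i 0 1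
        (l.take ((l.length + 1) / 2)) (hl.sublist (List.take_sublist _ _)) (by simp)
        (by rw [hlt1, zero_add]; omega) hlt1
      obtain ⟨q, h1, h2, h3, h4⟩ := hglue q₁ (fun _ => false)
      have hc : l.countP q = 1 := by
        rw [← hsum q, h1, h2, c1]
        simp
      refine ⟨q, hc, ?_⟩
      rw [splits_eq_add (by omega), h3]
      omega
    · have hlen' : 2 ^ (j + (i + 1)) * 2 ≤ l.length := by
        rw [← pow_succ]
        convert hlen using 2
        ring
      rw [pow_succ] at hg
      -- the entries are shared out evenly between the two halves
      obtain ⟨q₁, c1, s1⟩ := ih ((l.length + 1) / 2) (by omega) (i + 1) j ((g + 1) / 2)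
        (l.take ((l.length + 1) / 2)) (hl.sublist (List.take_sublist _ _)) (by omega)
        (by rw [hlt1]; omega) hlt1
      obtain ⟨q₂, c2, s2⟩ := ih (l.length / 2) (by omega) (i + 1) j (g / 2)
        (l.drop ((l.length + 1) / 2)) (hl.sublist (List.drop_sublist _ _)) (by omega)
        (by rw [hlt2]; omega) hlt2
      obtain ⟨q, h1, h2, h3, h4⟩ := hglue q₁ q₂
      have hc : l.countP q = g := by
        rw [← hsum q, h1, h2, c1, c2]
        omega
      refine ⟨q, hc, ?_⟩
      rw [splits_eq_add (by omega), h3, h4]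
      have : g * (i + 1) = (g + 1) / 2 * (i + 1) + g / 2 * (i + 1) := by
        rw [← add_mul]
        congr 1
        omega
      omega

end Splits

/-! ### The search at one vertex -/

section Search
variable {d n : ℕ} {hd : 2 ≤ d} {p : Fin n → EuclideanSpace ℝ (Fin d)}

/-- The vertices at the positions `lo, …, hi - 1` of a list. -/
def seg (l : List (Fin n)) (lo hi : ℕ) : List (Fin n) := (l.drop lo).take (hi - lo)

theorem length_seg {l : List (Fin n)} {lo hi : ℕ} (h : hi ≤ l.length) :
    (seg l lo hi).length = hi - lo := by
  rw [seg, List.length_take, List.length_drop]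
  omega

theorem take_append_seg {l : List (Fin n)} {lo hi : ℕ} (h : lo ≤ hi) :
    l.take lo ++ seg l lo hi = l.take hi := by
  obtain ⟨k, rfl⟩ := Nat.exists_eq_add_of_le h
  rw [seg, Nat.add_sub_cancel_left, ← List.take_add]

theorem take_seg {l : List (Fin n)} {lo hi k : ℕ} (h : lo + k ≤ hi) :
    (seg l lo hi).take k = seg l lo (lo + k) := by
  rw [seg, seg, List.take_take]
  congr 1
  omega

theorem drop_seg {l : List (Fin n)} {lo hi k : ℕ} :
    (seg l lo hi).drop k = seg l (lo + k) hi := by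
  rw [seg, seg, List.drop_take, List.drop_drop]
  congr 1
  omega

/-- `l` and `l'` list the vertices above and below `v`, in clockwise order. -/
structure Around (hd : 2 ≤ d) (p : Fin n → EuclideanSpace ℝ (Fin d)) (v : Fin n)
    (l l' : List (Fin n)) : Prop where
  mem_above : ∀ u, u ∈ l ↔ e₂coord hd (p v) < e₂coord hd (p u)
  mem_below : ∀ u, u ∈ l' ↔ e₂coord hd (p u) < e₂coord hd (p v)
  above : l.Pairwise (fun a b => ang hd p v b < ang hd p v a)
  below : l'.Pairwise (fun a b => ang hd p v b < ang hd p v a)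
  nodup : (l ++ l').Nodup
  all : ∀ u, u ≠ v → u ∈ l ++ l'

theorem IsClockwise.around (hp : GPImmersed hd p) {cyc : Fin n → Array (Fin n) × Array (Fin n)}
    (h : IsClockwise (fun v => e₁coord hd (p v)) (fun v => e₂coord hd (p v)) cyc) (v : Fin n) :
    Around hd p v (cyc v).1.toList (cyc v).2.toList := by
  refine ⟨h.mem_above v, h.mem_below v, h.ang_above v, h.ang_below v, h.nodup v, fun u hu => ?_⟩
  rw [List.mem_append, h.mem_above, h.mem_below]
  exact (lt_or_gt_of_ne (fun e => hu (hp.heights e))).symm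

theorem getD_toList (A : Array (Fin n)) (i : ℕ) (v : Fin n) : A.getD i v = A.toList.getD i v := by
  simp [Array.getD_eq_getD_getElem?, List.getD_eq_getElem?_getD]

/-- The number of entries less than `t` of a decreasing list, found by binary search. -/
theorem length_sub_firstBelow (a : Fin n → ℝ) (l : List (Fin n)) (v : Fin n) (t : ℝ)
    (hl : l.Pairwise (fun u w => a w < a u)) :
    l.length - (firstBelow (fun i => a (l.getD i v)) t 0 l.length).val =
      l.countP (fun u => decide (a u < t)) := by
  obtain ⟨-, h2, h3, h4⟩ := firstBelow_spec (fun i => a (l.getD i v)) t 0 l.length (Nat.zero_le _)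
    (fun i j _ hij hj hlt => by
      rcases hij.eq_or_lt with rfl | hij
      · exact hlt
      · rw [List.getD_eq_getElem _ _ hj]
        rw [List.getD_eq_getElem _ _ (hij.trans hj)] at hlt
        exact (List.pairwise_iff_getElem.1 hl i j (hij.trans hj) hj hij).trans hlt)
  generalize (firstBelow (fun i => a (l.getD i v)) t 0 l.length).val = i at h2 h3 h4
  rw [← countP_take_add_countP_drop _ l i]
  have e1 : (l.take i).countP (fun u => decide (a u < t)) = 0 := by
    rw [List.countP_eq_zero]
    intro u hu
    obtain ⟨j, hj, rfl⟩ := List.mem_take_iff_getElem.1 hu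
    have := h3 j (Nat.zero_le _) (by omega)
    rw [List.getD_eq_getElem _ _ (by omega)] at this
    simpa using this
  have e2 : (l.drop i).countP (fun u => decide (a u < t)) = l.length - i := by
    rw [List.countP_eq_length.2, List.length_drop]
    intro u hu
    obtain ⟨j, hj, rfl⟩ := List.mem_drop_iff_getElem.1 hu
    have := h4 (i + j) (by omega) (by omega)
    rw [List.getD_eq_getElem _ _ (by omega)] at this
    simpa using this
  omega

open Classical in
/-- The diagram in the direction of a split counts the edges to the vertices on the left of the
split and the edges to the vertices below whose angle is less than `π + α`. -/
theorem indegree_split {G : SimpleGraph (Fin n)} {oracle : EuclideanSpace ℝ (Fin d) → APD}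
    (hO : IsOracle p G oracle) {θ : ℝ} (hθ : Separates hd p θ) {v : Fin n}
    {l₁ l₂ below : List (Fin n)} {a : Fin n} (hA : Around hd p v (l₁ ++ a :: l₂) below)
    (hl₂ : l₂ ≠ []) :
    0 < ang hd p v a - θ / 2 ∧
    (indegree n (oracle (planeDirection d (ang hd p v a - θ / 2 - Real.pi / 2)).val)
      (inner ℝ (planeDirection d (ang hd p v a - θ / 2 - Real.pi / 2)).val (p v))).val =
    (l₁ ++ [a]).countP (fun u => decide (G.Adj v u)) +
      (below.filter (fun u => decide (G.Adj v u))).countP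
        (fun u => decide (ang hd p v u < Real.pi + (ang hd p v a - θ / 2))) := by
  have ha : e₂coord hd (p v) < e₂coord hd (p a) := (hA.mem_above a).1 (by simp)
  have hpw := hA.above
  rw [List.pairwise_append, List.pairwise_cons] at hpw
  obtain ⟨-, ⟨hal₂, -⟩, hl₁⟩ := hpw
  -- the boundary of the half-plane separates `a` from the next vertex and meets no vertex
  have hleft : ∀ u ∈ l₁ ++ [a], ang hd p v a - θ / 2 < ang hd p v u := by
    intro u hu
    have hpos := hθ.pos
    rcases List.mem_append.1 hu with hu | hu
    · have := hl₁ u hu a List.mem_cons_self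
      linarith
    · rw [List.mem_singleton.1 hu]
      linarith
  have hright : ∀ u ∈ l₂, ang hd p v u < ang hd p v a - θ / 2 := by
    intro u hu
    have hpos := hθ.pos
    have := hθ.gap v a u ha ((hA.mem_above u).1 (by simp [hu])) (hal₂ u hu)
    linarith
  have h0 : 0 < ang hd p v a - θ / 2 := by
    obtain ⟨b, hb⟩ := List.exists_mem_of_ne_nil _ hl₂
    exact (ang_of_above ((hA.mem_above b).1 (by simp [hb]))).1.trans (hright b hb)
  refine ⟨h0, ?_⟩
  have hpi : ang hd p v a - θ / 2 < Real.pi := by linarith [(ang_of_above ha).2, hθ.pos]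
  have hbelow : ∀ u ∈ below, ang hd p v u ≠ Real.pi + (ang hd p v a - θ / 2) := fun u hu =>
    hθ.opposite v a u ((hA.mem_below u).1 hu) ha
  have hside : ∀ u ∈ l₁ ++ a :: l₂, ang hd p v a - θ / 2 ≠ ang hd p v u := by
    intro u hu
    have hu' : u ∈ l₁ ++ [a] ∨ u ∈ l₂ := by
      simpa [or_assoc] using hu
    rcases hu' with hu | hu
    · exact (hleft u hu).ne
    · exact (hright u hu).ne'
  generalize ang hd p v a - θ / 2 = α at *
  have hne : ∀ u, u ≠ v → inner ℝ (planeDirection d (α - Real.pi / 2)).val (p u) ≠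
      inner ℝ (planeDirection d (α - Real.pi / 2)).val (p v) := by
    intro u hu
    rcases List.mem_append.1 (hA.all u hu) with h | h
    · exact inner_planeDirection_ne_above h0 hpi ((hA.mem_above u).1 h) (hside u h)
    · exact inner_planeDirection_ne_below h0 hpi ((hA.mem_below u).1 h) (hbelow u h)
  rw [indegree_spec (hO _ (norm_planeDirection hd _)) v hne _ hA.nodup hA.all, List.countP_append,
    show l₁ ++ a :: l₂ = (l₁ ++ [a]) ++ l₂ by simp, List.countP_append, List.countP_filter]
  have habove : ∀ u ∈ l₁ ++ a :: l₂, e₂coord hd (p v) < e₂coord hd (p u) := fun u hu =>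
    (hA.mem_above u).1 hu
  have e1 : (l₁ ++ [a]).countP (fun u => decide (G.Adj v u) &&
      decide (inner ℝ (planeDirection d (α - Real.pi / 2)).val (p u) <
        inner ℝ (planeDirection d (α - Real.pi / 2)).val (p v))) =
      (l₁ ++ [a]).countP (fun u => decide (G.Adj v u)) := by
    refine List.countP_congr (fun u hu => ?_)
    have hu' : u ∈ l₁ ++ a :: l₂ := by
      rw [show l₁ ++ a :: l₂ = (l₁ ++ [a]) ++ l₂ by simp]
      exact List.mem_append_left _ hu
    simp [(inner_planeDirection_lt_above h0 hpi (habove u hu')).2 (hleft u hu)]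
  have e2 : l₂.countP (fun u => decide (G.Adj v u) &&
      decide (inner ℝ (planeDirection d (α - Real.pi / 2)).val (p u) <
        inner ℝ (planeDirection d (α - Real.pi / 2)).val (p v))) = 0 := by
    rw [List.countP_eq_zero]
    intro u hu
    have hu' : u ∈ l₁ ++ a :: l₂ := by simp [hu]
    have := mt (inner_planeDirection_lt_above h0 hpi (habove u hu')).1 (not_lt.2 (hright u hu).le)
    simp [this]
  have e3 : below.countP (fun u => decide (G.Adj v u) &&
      decide (inner ℝ (planeDirection d (α - Real.pi / 2)).val (p u) <
        inner ℝ (planeDirection d (α - Real.pi / 2)).val (p v))) =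
      below.countP (fun u => decide (ang hd p v u < Real.pi + α) && decide (G.Adj v u)) := by
    refine List.countP_congr (fun u hu => ?_)
    simp [inner_planeDirection_lt_below h0 hpi ((hA.mem_below u).1 hu), and_comm]
  rw [e1, e2, e3, add_zero]

open Classical in
/-- If all edges to vertices below the centre and to vertices left of an arc are known, the arc is split
into halves with correct edge counts, for one diagram and a logarithmic number of comparisons. -/
theorem splitArc_spec {G : SimpleGraph (Fin n)} {oracle : EuclideanSpace ℝ (Fin d) → APD}
    (hO : IsOracle p G oracle) (T : ℕ) {θ : ℝ} (hθ : Separates hd p θ) {v : Fin n}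
    {above inV outV : Array (Fin n)} {below : List (Fin n)}
    (hA : Around hd p v above.toList below)
    (hin : inV.toList = below.filter (fun u => decide (G.Adj v u))) (A : EdgeArc n)
    (hv : A.vert = v) (hlo : A.lo + 2 ≤ A.hi) (hhi : A.hi ≤ above.toList.length)
    (hcount : A.count = (((seg above.toList A.lo A.hi).countP (fun u => decide (G.Adj v u)) : ℕ) : ℤ))
    (hout : outV.toList = (above.toList.take A.lo).filter (fun u => decide (G.Adj v u)))
    (S : Run (EdgeArc n × EdgeArc n))
    (hS : S = splitArc hd p oracle T above inV outV θ A) (mid : ℕ)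
    (hmid : mid = A.lo + (A.hi - A.lo + 1) / 2) :
    (S.val.1.vert = v ∧ S.val.1.lo = A.lo ∧ S.val.1.hi = mid ∧ S.val.1.count =
      (((seg above.toList A.lo mid).countP (fun u => decide (G.Adj v u)) : ℕ) : ℤ)) ∧
    (S.val.2.vert = v ∧ S.val.2.lo = mid ∧ S.val.2.hi = A.hi ∧ S.val.2.count =
      (((seg above.toList mid A.hi).countP (fun u => decide (G.Adj v u)) : ℕ) : ℤ)) ∧
    S.diagrams = 1 ∧ 2 * d + T + 2 * (Nat.log 2 n + 1) ≤ S.time ∧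
    S.time ≤ 2 * d + T + (3 * Nat.log 2 n + 13) := by
  -- the vertex after which the arc is split
  have hidx : mid - 1 < above.toList.length := by omega
  obtain ⟨l₁, a, l₂, hl, hl₁, hl₂⟩ : ∃ l₁ a l₂, above.toList = l₁ ++ a :: l₂ ∧
      l₁.length = mid - 1 ∧ l₂.length = above.toList.length - mid := by
    refine ⟨above.toList.take (mid - 1), above.toList[mid - 1], above.toList.drop (mid - 1 + 1),
      ?_, ?_, ?_⟩
    · rw [← List.drop_eq_getElem_cons, List.take_append_drop]
    · rw [List.length_take]
      omega
    · rw [List.length_drop]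
      omega
  have hget : above.getD (A.lo + (A.hi - A.lo + 1) / 2 - 1) v = a := by
    rw [← hmid, getD_toList, hl, List.getD_append_right _ _ _ _ (by omega), hl₁]
    simp
  have hne : l₂ ≠ [] := by
    rintro rfl
    simp at hl₂
    simp at hhi
    omega
  have hA' := hA
  rw [hl] at hA'
  obtain ⟨h0, hdeg⟩ := indegree_split hO hθ hA' hne
  have htake : above.toList.take mid = l₁ ++ [a] := by
    rw [hl, List.take_append, List.take_of_length_le (by omega),
      show mid - l₁.length = 1 by omega]
    simp
  have hangOut : ∀ u ∈ outV.toList, ang hd p v u < Real.pi := by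
    intro u hu
    rw [hout, List.mem_filter] at hu
    exact (ang_of_above ((hA.mem_above u).1 (List.mem_of_mem_take hu.1))).2
  -- the known edges are sorted by angle
  have hbig : (inV.toList ++ outV.toList).Pairwise (fun u w => ang hd p v w < ang hd p v u) := by
    rw [List.pairwise_append, hin, hout]
    refine ⟨hA.below.sublist List.filter_sublist,
      hA.above.sublist (List.filter_sublist.trans (List.take_sublist _ _)), fun u hu w hw => ?_⟩
    rw [List.mem_filter] at hu
    rw [← hout] at hw
    exact (hangOut w hw).trans (ang_of_below ((hA.mem_below u).1 hu.1)).1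
  have hsearch := length_sub_firstBelow (ang hd p v) (inV.toList ++ outV.toList) v
    (Real.pi + (ang hd p v a - θ / 2)) hbig
  have hlen : (inV.toList ++ outV.toList).length = inV.size + outV.size := by simp
  have hcost := firstBelow_cost (fun i => ang hd p v ((inV.toList ++ outV.toList).getD i v))
    (Real.pi + (ang hd p v a - θ / 2)) 0 (inV.size + outV.size) (Nat.log 2 n + 1) (by
      rw [zero_add]
      refine lt_of_le_of_lt ?_ (Nat.lt_pow_succ_log_self one_lt_two n)
      have hnd : (inV.toList ++ outV.toList).Nodup := hbig.imp (fun h e => by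
        rw [e] at h
        exact lt_irrefl _ h)
      rw [← hlen]
      simpa using hnd.length_le_card)
  rw [hlen] at hsearch
  have hknown : (inV.toList ++ outV.toList).countP
      (fun u => decide (ang hd p v u < Real.pi + (ang hd p v a - θ / 2))) =
      (below.filter (fun u => decide (G.Adj v u))).countP
        (fun u => decide (ang hd p v u < Real.pi + (ang hd p v a - θ / 2))) +
      (above.toList.take A.lo).countP (fun u => decide (G.Adj v u)) := by
    have hfull : outV.toList.countP
        (fun u => decide (ang hd p v u < Real.pi + (ang hd p v a - θ / 2))) =
        outV.toList.length := by
      rw [List.countP_eq_length]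
      intro u hu
      have := hangOut u hu
      simp only [decide_eq_true_eq]
      linarith
    rw [List.countP_append, hfull, hin, hout, ← List.countP_eq_length_filter]
  have hbigfun : (fun i => ang hd p v (if i < inV.size then inV.getD i v else
      outV.getD (i - inV.size) v)) =
      (fun i => ang hd p v ((inV.toList ++ outV.toList).getD i v)) := by
    funext i
    congr 1
    by_cases hi : i < inV.size
    · rw [if_pos hi, List.getD_append _ _ _ _ (by simpa using hi), getD_toList]
    · rw [if_neg hi, List.getD_append_right _ _ _ _ (by simpa using hi), getD_toList]
      simp
  have hseg1 : (above.toList.take A.lo).countP (fun u => decide (G.Adj v u)) +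
      (seg above.toList A.lo mid).countP (fun u => decide (G.Adj v u)) =
      (l₁ ++ [a]).countP (fun u => decide (G.Adj v u)) := by
    rw [← htake, ← take_append_seg (l := above.toList) (lo := A.lo) (hi := mid) (by omega),
      List.countP_append]
  have hseg2 : (seg above.toList A.lo mid).countP (fun u => decide (G.Adj v u)) +
      (seg above.toList mid A.hi).countP (fun u => decide (G.Adj v u)) =
      (seg above.toList A.lo A.hi).countP (fun u => decide (G.Adj v u)) := by
    rw [← countP_take_add_countP_drop _ (seg _ A.lo A.hi) ((A.hi - A.lo + 1) / 2),
      take_seg (by omega), drop_seg, ← hmid]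
  have hdir : (planeDirection d (ang hd p v a - θ / 2 - Real.pi / 2)).time = d ∧
      (planeDirection d (ang hd p v a - θ / 2 - Real.pi / 2)).diagrams = 0 :=
    ⟨rfl, rfl⟩
  subst hv hS
  rw [← hmid] at hget
  simp only [ang] at hdeg hsearch hcost hbigfun hdir hknown hget
  simp only [splitArc, Run.val_bind, val_step, val_ask, Run.val_pure, Run.time_bind, time_step,
    time_ask, time_tick, Run.time_pure, Run.diagrams_bind, diagrams_step, diagrams_ask,
    diagrams_tick, Run.diagrams_pure, (indegree_cost _ _).1, (indegree_cost _ _).2, hget, hbigfun,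
    hdeg, hsearch, hknown, hdir.1, hdir.2, hcost.2, hcount, ← hmid, true_and]
  have hcost1 := hcost.1
  refine ⟨?_, ?_, ?_, ?_⟩ <;> omega


theorem appendFrom_spec (above : Array (Fin n)) (v : Fin n) (k i : ℕ) (outV : Array (Fin n))
    (h : i + k ≤ above.toList.length) :
    (appendFrom above v k i outV).val.toList = outV.toList ++ seg above.toList i (i + k) ∧
    (appendFrom above v k i outV).time = k ∧ (appendFrom above v k i outV).diagrams = 0 := by
  induction k generalizing i outV with
  | zero => simp [appendFrom, seg]
  | succ k ih =>
    obtain ⟨h1, h2, h3⟩ := ih (i + 1) (outV.push (above.getD i v)) (by omega)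
    simp only [appendFrom, Run.val_bind, val_step, Run.time_bind, time_step, Run.diagrams_bind,
      diagrams_step]
    refine ⟨?_, by omega, by omega⟩
    rw [h1, getD_toList, List.getD_eq_getElem _ _ (by omega), Array.toList_push, List.append_assoc,
      seg, seg, show i + 1 + k - (i + 1) = k by omega, show i + (k + 1) - i = k + 1 by omega,
      List.drop_eq_getElem_cons (i := i) (by omega), List.take_succ_cons]
    rfl

open Classical in
/-- The arcs of a stack cover the positions from `m` on, in order, with correct edge counts. -/
def Arcs (G : SimpleGraph (Fin n)) (v : Fin n) (l : List (Fin n)) : ℕ → List (EdgeArc n) → Prop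
  | m, [] => m = l.length
  | m, A :: st => A.vert = v ∧ A.lo = m ∧ m ≤ A.hi ∧ A.hi ≤ l.length ∧
      A.count = (((seg l m A.hi).countP (fun u => decide (G.Adj v u)) : ℕ) : ℤ) ∧ Arcs G v l A.hi st

open Classical in
/-- The number of splits still to be made for the arcs of a stack. -/
noncomputable def stackSplits (G : SimpleGraph (Fin n)) (v : Fin n) (l : List (Fin n))
    (st : List (EdgeArc n)) : ℕ :=
  (st.map (fun A => splits (fun u => decide (G.Adj v u)) (seg l A.lo A.hi))).sum

/-- A bound on the number of rounds for the arcs of a stack: a binary tree with `k ≥ 1` leaves has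
`2 * k - 1` nodes. -/
def stackRounds (st : List (EdgeArc n)) : ℕ :=
  (st.map (fun A => max 1 (2 * (A.hi - A.lo) - 1))).sum

open Classical in
/-- The invariant of the search: the arcs on the stack cover all vertices from position `m` on, and
`outV` holds the neighbours before this position. Besides the splits, every arc costs a bounded
number of steps and every edge one step. -/
theorem stackLoop_spec {G : SimpleGraph (Fin n)} {oracle : EuclideanSpace ℝ (Fin d) → APD}
    (hO : IsOracle p G oracle) (T : ℕ) {θ : ℝ} (hθ : Separates hd p θ) {v : Fin n}
    {above inV : Array (Fin n)} {below : List (Fin n)}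
    (hA : Around hd p v above.toList below)
    (hin : inV.toList = below.filter (fun u => decide (G.Adj v u))) (f : ℕ)
    (st : List (EdgeArc n)) (m : ℕ) (outV : Array (Fin n)) (hst : Arcs G v above.toList m st)
    (hm : m ≤ above.toList.length)
    (hout : outV.toList = (above.toList.take m).filter (fun u => decide (G.Adj v u)))
    (hf : stackRounds st + 1 ≤ f) :
    (stackLoop hd p oracle T above inV θ f st outV).val.toList =
      above.toList.filter (fun u => decide (G.Adj v u)) ∧
    (stackLoop hd p oracle T above inV θ f st outV).diagrams =
      stackSplits G v above.toList st ∧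
    stackSplits G v above.toList st * (2 * d + T + 2 * (Nat.log 2 n + 1)) ≤
      (stackLoop hd p oracle T above inV θ f st outV).time ∧
    (stackLoop hd p oracle T above inV θ f st outV).time ≤
      stackSplits G v above.toList st * (2 * d + T + (3 * Nat.log 2 n + 13) + 6) + 3 * st.length +
        (above.toList.drop m).countP (fun u => decide (G.Adj v u)) + 1 := by
  induction f generalizing st m outV with
  | zero => omega
  | succ f ih =>
    rcases st with _ | ⟨A, st⟩
    · obtain rfl : m = above.toList.length := hst
      simp only [stackLoop, val_step, time_step, diagrams_step, stackSplits, List.map_nil,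
        List.sum_nil]
      rw [hout, List.take_length]
      simp
    · obtain ⟨hv, hlo, hmhi, hhi, hcount, hst'⟩ := hst
      subst hlo
      have hsum : stackSplits G v above.toList (A :: st) =
          splits (fun u => decide (G.Adj v u)) (seg above.toList A.lo A.hi) +
            stackSplits G v above.toList st := by simp [stackSplits]
      have hrounds : stackRounds (A :: st) = max 1 (2 * (A.hi - A.lo) - 1) + stackRounds st := by
        simp [stackRounds]
      have hlen := length_seg (lo := A.lo) hhi
      have hdrop : (above.toList.drop A.lo).countP (fun u => decide (G.Adj v u)) =
          (seg above.toList A.lo A.hi).countP (fun u => decide (G.Adj v u)) +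
            (above.toList.drop A.hi).countP (fun u => decide (G.Adj v u)) := by
        rw [← countP_take_add_countP_drop _ (above.toList.drop A.lo) (A.hi - A.lo), seg,
          List.drop_drop, Nat.add_sub_cancel' hmhi]
      have hfilter : (above.toList.take A.hi).filter (fun u => decide (G.Adj v u)) =
          outV.toList ++ (seg above.toList A.lo A.hi).filter (fun u => decide (G.Adj v u)) := by
        rw [← take_append_seg hmhi, List.filter_append, hout]
      by_cases hc0 : A.count = 0
      · -- no edge in the arc
        have hz : (seg above.toList A.lo A.hi).countP (fun u => decide (G.Adj v u)) = 0 := by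
          rw [hc0] at hcount
          exact_mod_cast hcount.symm
        obtain ⟨i1, i2, i3, i4⟩ := ih st A.hi outV hst' hhi (by
          rw [hfilter, List.filter_eq_nil_iff.2 (List.countP_eq_zero.1 hz), List.append_nil])
          (by omega)
        simp only [stackLoop, Run.val_bind, val_step, Run.time_bind, time_step, Run.diagrams_bind,
          diagrams_step, hc0, decide_true, if_true, hsum, splits_eq_zero (Or.inl hz),
          List.length_cons, hdrop, hz, zero_add]
        exact ⟨i1, i2, by omega, by omega⟩
      · by_cases hc1 : A.count = ((A.hi - A.lo : ℕ) : ℤ)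
        · -- all vertices of the arc are joined to `v`
          have hz : (seg above.toList A.lo A.hi).countP (fun u => decide (G.Adj v u)) =
              (seg above.toList A.lo A.hi).length := by
            rw [hc1] at hcount
            rw [hlen]
            exact_mod_cast hcount.symm
          obtain ⟨a1, a2, a3⟩ := appendFrom_spec above A.vert (A.hi - A.lo) A.lo outV (by omega)
          rw [Nat.add_sub_cancel' hmhi] at a1
          obtain ⟨i1, i2, i3, i4⟩ := ih st A.hi
            (appendFrom above A.vert (A.hi - A.lo) A.lo outV).val hst' hhi (by
              rw [hfilter, a1, List.filter_eq_self.2 (List.countP_eq_length.1 hz)]) (by omega)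
          simp only [stackLoop, Run.val_bind, val_step, Run.time_bind, time_step,
            Run.diagrams_bind, diagrams_step, hc0, decide_false, Bool.false_eq_true, if_false,
            ← hc1, decide_true, if_true, hsum, splits_eq_zero (Or.inr hz), List.length_cons, hdrop,
            hz, zero_add, a2, a3]
          simp only [hc1] at *
          exact ⟨i1, i2, by omega, by omega⟩
        · have hne : ¬ ((seg above.toList A.lo A.hi).countP (fun u => decide (G.Adj v u)) = 0 ∨
              (seg above.toList A.lo A.hi).countP (fun u => decide (G.Adj v u)) =
                (seg above.toList A.lo A.hi).length) := by
            rintro (h | h)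
            · rw [h] at hcount
              exact hc0 (by exact_mod_cast hcount)
            · rw [h, hlen] at hcount
              exact hc1 hcount
          have hle := List.countP_le_length (p := fun u => decide (G.Adj v u))
            (l := seg above.toList A.lo A.hi)
          have hlo2 : A.lo + 2 ≤ A.hi := by omega
          obtain ⟨⟨b1, b2, b3, b4⟩, ⟨c1, c2, c3, c4⟩, s1, s2, s3⟩ := splitArc_spec hO T hθ hA hin A
            hv hlo2 hhi hcount hout _ rfl _ rfl
          have hsplit := splits_eq_add hne
          rw [hlen, take_seg (by omega), drop_seg] at hsplit
          simp only [stackLoop, Run.val_bind, val_step, Run.time_bind, time_step,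
            Run.diagrams_bind, diagrams_step, hc0, hc1, decide_false, Bool.false_eq_true, if_false]
          generalize splitArc hd p oracle T above inV outV θ A = S at *
          obtain ⟨i1, i2, i3, i4⟩ := ih (S.val.1 :: S.val.2 :: st) A.lo outV
            (by
              refine ⟨b1, b2, by omega, by omega, ?_, c1, by omega, by omega, by omega, ?_, ?_⟩
              · rw [b3]
                exact b4
              · rw [b3, c3]
                exact c4
              · rw [c3]
                exact hst') hm hout
            (by
              simp only [stackRounds, List.map_cons, List.sum_cons] at hrounds hf ⊢
              rw [b2, b3, c2, c3]
              omega)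
          have hsum' : stackSplits G v above.toList (S.val.1 :: S.val.2 :: st) + 1 =
              stackSplits G v above.toList (A :: st) := by
            rw [hsum, hsplit]
            simp only [stackSplits, List.map_cons, List.sum_cons, b2, b3, c2, c3]
            ring
          rw [← hsum', add_mul, add_mul, one_mul, one_mul]
          simp only [List.length_cons] at i4 ⊢
          exact ⟨i1, by omega, by omega, by omega⟩

open Classical in
/-- In direction `-e₂` the lower neighbours of `v` are those above `v`, so that the first arc has the
correct edge count and the search finds all upper neighbours. -/
theorem findUpEdges_spec (hp : GPImmersed hd p) {G : SimpleGraph (Fin n)}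
    {oracle : EuclideanSpace ℝ (Fin d) → APD}
    (hO : IsOracle p G oracle) (T : ℕ) {θ : ℝ} (hθ : Separates hd p θ) {v : Fin n}
    {above inV : Array (Fin n)} {below : List (Fin n)}
    (hA : Around hd p v above.toList below)
    (hin : inV.toList = below.filter (fun u => decide (G.Adj v u))) {D : APD}
    (hD : IsAPD p G (-(EuclideanSpace.single (⟨1, by omega⟩ : Fin d) (1 : ℝ))) D)
    (R : Run (Array (Fin n))) (hR : R = findUpEdges hd p oracle T v above inV θ D) :
    R.val.toList = above.toList.filter (fun u => decide (G.Adj v u)) ∧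
    R.diagrams = splits (fun u => decide (G.Adj v u)) above.toList ∧
    splits (fun u => decide (G.Adj v u)) above.toList * (2 * d + T + 2 * (Nat.log 2 n + 1)) ≤
      R.time ∧
    R.time ≤ splits (fun u => decide (G.Adj v u)) above.toList *
        (2 * d + T + (3 * Nat.log 2 n + 13) + 6) +
      above.toList.countP (fun u => decide (G.Adj v u)) + 2 * Nat.log 2 n + 9 := by
  have hinner : ∀ u, inner ℝ (-(EuclideanSpace.single (⟨1, by omega⟩ : Fin d) (1 : ℝ))) (p u) =
      -e₂coord hd (p u) := by
    intro u
    rw [inner_neg_left, EuclideanSpace.inner_single_left]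
    simp [e₂coord]
  have hdeg := indegree_spec hD v (fun u hu => by
    rw [hinner, hinner]
    exact fun h => hu (hp.heights (neg_injective h))) _ hA.nodup hA.all
  rw [hinner, List.countP_append] at hdeg
  have e1 : above.toList.countP (fun u => decide (G.Adj v u) &&
      decide (inner ℝ (-(EuclideanSpace.single (⟨1, by omega⟩ : Fin d) (1 : ℝ))) (p u) <
        -e₂coord hd (p v))) = above.toList.countP (fun u => decide (G.Adj v u)) := by
    refine List.countP_congr (fun u hu => ?_)
    simp [hinner, (hA.mem_above u).1 hu]
  have e2 : below.countP (fun u => decide (G.Adj v u) &&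
      decide (inner ℝ (-(EuclideanSpace.single (⟨1, by omega⟩ : Fin d) (1 : ℝ))) (p u) <
        -e₂coord hd (p v))) = 0 := by
    rw [List.countP_eq_zero]
    intro u hu
    simp [hinner, ((hA.mem_below u).1 hu).le]
  rw [e1, e2, add_zero] at hdeg
  have hseg : seg above.toList 0 above.size = above.toList := by simp [seg]
  obtain ⟨i1, i2, i3, i4⟩ := stackLoop_spec hO T hθ hA hin (2 * above.size + 2)
    [{ vert := v, α₁ := 0, α₂ := Real.pi, lo := 0, hi := above.size,
       count := (((indegree n D (-e₂coord hd (p v))).val : ℕ) : ℤ) }] 0 #[]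
    ⟨rfl, rfl, Nat.zero_le _, by simp, by rw [hseg, hdeg], by simp [Arcs]⟩ (Nat.zero_le _)
    (by simp) (by simp [stackRounds]; omega)
  simp only [stackSplits, List.map_cons, List.map_nil, List.sum_cons, List.sum_nil, hseg, add_zero,
    List.length_cons, List.length_nil, List.drop_zero] at i1 i2 i3 i4
  subst hR
  simp only [findUpEdges, Run.val_bind, val_step, Run.time_bind, time_step, Run.diagrams_bind,
    diagrams_step, (indegree_cost _ _).1, (indegree_cost _ _).2]
  exact ⟨i1, by omega, by omega, by omega⟩

end Search

/-! ### The sweep -/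

section Sweep
variable {d n : ℕ} {hd : 2 ≤ d} {p : Fin n → EuclideanSpace ℝ (Fin d)}

theorem selectMarked_spec (mark : Fin n → Bool) (l : List (Fin n)) (B : Array (Fin n)) :
    (selectMarked mark l B).val.toList = B.toList ++ l.filter mark ∧
    (selectMarked mark l B).time = l.length ∧ (selectMarked mark l B).diagrams = 0 := by
  induction l generalizing B with
  | nil => simp [selectMarked]
  | cons u l ih =>
    cases h : mark u
    · simp [selectMarked, h, ih, add_comm]
    · simp [selectMarked, h, ih, add_comm]

theorem recordEdges_spec (v : Fin n) (l : List (Fin n)) (E : List (Fin n × Fin n))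
    (known : Fin n → Fin n → Bool) :
    (recordEdges v l E known).val.1 = (l.map (fun u => (v, u))).reverse ++ E ∧
    (∀ u w, (recordEdges v l E known).val.2 u w = true ↔ known u w = true ∨ (w = v ∧ u ∈ l)) ∧
    (recordEdges v l E known).time = l.length ∧ (recordEdges v l E known).diagrams = 0 := by
  induction l generalizing E known with
  | nil => simp [recordEdges]
  | cons a l ih =>
    obtain ⟨h1, h2, h3, h4⟩ := ih ((v, a) :: E)
      (Function.update known a (Function.update (known a) v true))
    simp only [recordEdges, Run.val_bind, val_step, Run.time_bind, time_step, Run.diagrams_bind,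
      diagrams_step, List.length_cons]
    refine ⟨by rw [h1]; simp, fun u w => ?_, by omega, by omega⟩
    rw [h2]
    by_cases hu : u = a
    · subst hu
      by_cases hw : w = v
      · simp [hw]
      · simp [hw]
    · simp [hu]

open Classical in
/-- The invariant of the sweep: the vertices below those of `l` are done or in `l`, and `known` marks the
edges to done vertices. The numbers `s` and `g` count the splits and the edges of the rest. -/
theorem sweep_spec (hp : GPImmersed hd p) {G : SimpleGraph (Fin n)}
    {oracle : EuclideanSpace ℝ (Fin d) → APD}
    (hO : IsOracle p G oracle) (T : ℕ) {θ : ℝ} (hθ : Separates hd p θ)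
    (cyc : Fin n → Array (Fin n) × Array (Fin n))
    (hcyc : ∀ v, Around hd p v (cyc v).1.toList (cyc v).2.toList) {D : APD}
    (hD : IsAPD p G (-(EuclideanSpace.single (⟨1, by omega⟩ : Fin d) (1 : ℝ))) D)
    (l : List (Fin n)) (E : List (Fin n × Fin n)) (known : Fin n → Fin n → Bool)
    (done : Fin n → Prop)
    (hl : l.Pairwise (fun a b => e₂coord hd (p a) < e₂coord hd (p b)))
    (hdone : ∀ v ∈ l, ∀ u, e₂coord hd (p u) < e₂coord hd (p v) → done u ∨ u ∈ l)
    (hknown : ∀ u w, known u w = true ↔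
      done w ∧ G.Adj u w ∧ e₂coord hd (p w) < e₂coord hd (p u))
    (R : Run (List (Fin n × Fin n))) (hR : R = sweep hd p oracle T cyc θ D l E known) (s g : ℕ)
    (hs : s = (l.map (fun v => splits (fun u => decide (G.Adj v u)) (cyc v).1.toList)).sum)
    (hg : g = (l.map (fun v => (cyc v).1.toList.countP (fun u => decide (G.Adj v u)))).sum) :
    R.val = (l.flatMap (fun v => ((cyc v).1.toList.filter (fun u => decide (G.Adj v u))).map
      (fun u => (v, u)))).reverse ++ E ∧
    R.diagrams = s ∧ s * (2 * d + T + 2 * (Nat.log 2 n + 1)) ≤ R.time ∧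
    R.time ≤ s * (2 * d + T + (3 * Nat.log 2 n + 19)) + 2 * g +
      l.length * (n + 2 * Nat.log 2 n + 9) := by
  induction l generalizing E known done R s g with
  | nil =>
    subst hR hs hg
    simp [sweep]
  | cons v l ih =>
    obtain ⟨hvl, hl⟩ := List.pairwise_cons.1 hl
    obtain ⟨m1, m2, m3⟩ := selectMarked_spec (known v) (cyc v).2.toList #[]
    -- all lower neighbours of `v` have been treated
    have hin : (selectMarked (known v) (cyc v).2.toList #[]).val.toList =
        (cyc v).2.toList.filter (fun u => decide (G.Adj v u)) := by
      rw [m1, List.nil_append]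
      refine List.filter_congr (fun u hu => ?_)
      have hlt := ((hcyc v).mem_below u).1 hu
      have hu : done u := by
        rcases hdone v List.mem_cons_self u hlt with h | h
        · exact h
        · rcases List.mem_cons.1 h with rfl | h
          · exact absurd hlt (lt_irrefl _)
          · exact absurd hlt (lt_asymm (hvl u h))
      rw [Bool.eq_iff_iff, hknown]
      simp [hu, hlt]
    obtain ⟨f1, f2, f3, f4⟩ := findUpEdges_spec hp hO T hθ (hcyc v) hin hD _ rfl
    rw [show 2 * d + T + (3 * Nat.log 2 n + 13) + 6 = 2 * d + T + (3 * Nat.log 2 n + 19) by ring]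
      at f4
    subst hR
    simp only [sweep, Run.val_bind, Run.time_bind, Run.diagrams_bind]
    generalize findUpEdges hd p oracle T v (cyc v).1
      (selectMarked (known v) (cyc v).2.toList #[]).val θ D = F at *
    obtain ⟨r1, r2, r3, r4⟩ := recordEdges_spec v F.val.toList E known
    generalize recordEdges v F.val.toList E known = Q at *
    rw [List.map_cons, List.sum_cons] at hs hg
    obtain ⟨i1, i2, i3, i4⟩ := ih Q.val.1 Q.val.2 (fun w => done w ∨ w = v) hl
      (fun w hw u hu => by
        rcases hdone w (List.mem_cons_of_mem _ hw) u hu with h | h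
        · exact Or.inl (Or.inl h)
        · rcases List.mem_cons.1 h with h | h
          · exact Or.inl (Or.inr h)
          · exact Or.inr h)
      (fun u w => by
        rw [r2, hknown, f1, List.mem_filter, (hcyc v).mem_above]
        constructor
        · rintro (⟨h1, h2⟩ | ⟨rfl, h1, h2⟩)
          · exact ⟨Or.inl h1, h2⟩
          · exact ⟨Or.inr rfl, (by simpa using h2 : G.Adj w u).symm, h1⟩
        · rintro ⟨h1 | rfl, h2, h3⟩
          · exact Or.inl ⟨h1, h2, h3⟩
          · exact Or.inr ⟨rfl, h3, by simpa using h2.symm⟩) _ rfl _ _ rfl rfl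
    have hlen : F.val.toList.length =
        (cyc v).1.toList.countP (fun u => decide (G.Adj v u)) := by
      rw [f1, List.countP_eq_length_filter]
    have hbelow : (cyc v).2.toList.length ≤ n := by
      have := ((hcyc v).nodup.sublist (List.sublist_append_right _ _)).length_le_card
      simpa using this
    generalize (List.map (fun v => splits (fun u => decide (G.Adj v u)) (cyc v).1.toList) l).sum =
      s' at *
    generalize (List.map (fun v => (cyc v).1.toList.countP (fun u => decide (G.Adj v u))) l).sum =
      g' at *
    generalize splits (fun u => decide (G.Adj v u)) (cyc v).1.toList = s₀ at *
    subst hs hg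
    rw [add_mul, add_mul]
    simp only [List.length_cons]
    rw [add_mul l.length 1, one_mul]
    refine ⟨?_, by omega, by omega, by omega⟩
    rw [i1, r1, f1]
    simp

theorem ListsEdges.ncard_edgeSet {G : SimpleGraph (Fin n)} {l : List (Fin n × Fin n)}
    (h : ListsEdges G l) : G.edgeSet.ncard = l.length := by
  classical
  have : G.edgeSet = ((l.map (fun e => s(e.1, e.2))).toFinset : Set (Sym2 (Fin n))) := by
    ext e
    rw [← h.2 e]
    simp
  rw [this, Set.ncard_coe_finset, List.toFinset_card_of_nodup h.1, List.length_map]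

/-- The vertices above `v`, in the clockwise order computed by the algorithm. -/
noncomputable def aboveList (hd : 2 ≤ d) (p : Fin n → EuclideanSpace ℝ (Fin d)) (v : Fin n) :
    List (Fin n) :=
  ((cyclicOrders (fun v => e₁coord hd (p v)) (fun v => e₂coord hd (p v))
    (sortByHeight (fun v => e₂coord hd (p v)) (List.finRange n)).val).val v).1.toList

theorem order_spec (hp : GPImmersed hd p) :
    (sortByHeight (fun v => e₂coord hd (p v)) (List.finRange n)).val.Pairwise
      (fun a b => e₂coord hd (p a) < e₂coord hd (p b)) ∧
    (∀ v, v ∈ (sortByHeight (fun v => e₂coord hd (p v)) (List.finRange n)).val) ∧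
    (sortByHeight (fun v => e₂coord hd (p v)) (List.finRange n)).val.Perm (List.finRange n) := by
  have hperm := sortByHeight_perm (fun v => e₂coord hd (p v)) (List.finRange n)
  refine ⟨?_, fun v => hperm.mem_iff.2 (List.mem_finRange v), hperm⟩
  have hnd := hperm.nodup_iff.2 (List.nodup_finRange n)
  have hs := sortByHeight_sorted (fun v => e₂coord hd (p v)) (List.finRange n)
  exact (hs.and hnd).imp (fun h => lt_of_le_of_ne h.1 (fun e => h.2 (hp.heights e)))

theorem cyc_spec (hp : GPImmersed hd p) (v : Fin n) :
    Around hd p v (aboveList hd p v)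
      ((cyclicOrders (fun v => e₁coord hd (p v)) (fun v => e₂coord hd (p v))
        (sortByHeight (fun v => e₂coord hd (p v)) (List.finRange n)).val).val v).2.toList :=
  (cyclicOrders_spec hp.simple _ (order_spec hp).1 (order_spec hp).2.1).1.around hp v

open Classical in
/-- The list of all edges `(v, u)` with `u` above `v`. -/
noncomputable def upEdges (hd : 2 ≤ d) (p : Fin n → EuclideanSpace ℝ (Fin d))
    (G : SimpleGraph (Fin n)) (order : List (Fin n)) : List (Fin n × Fin n) :=
  order.flatMap (fun v => ((aboveList hd p v).filter (fun u => decide (G.Adj v u))).map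
    (fun u => (v, u)))

theorem mem_upEdges (hp : GPImmersed hd p) {G : SimpleGraph (Fin n)} {order : List (Fin n)}
    {a b : Fin n} : (a, b) ∈ upEdges hd p G order ↔
      a ∈ order ∧ G.Adj a b ∧ e₂coord hd (p a) < e₂coord hd (p b) := by
  simp only [upEdges, List.mem_flatMap, List.mem_map, List.mem_filter, decide_eq_true_eq,
    Prod.mk.injEq]
  constructor
  · rintro ⟨v, hv, u, ⟨hu, hadj⟩, rfl, rfl⟩
    exact ⟨hv, hadj, ((cyc_spec hp v).mem_above u).1 hu⟩
  · rintro ⟨ha, hadj, hlt⟩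
    exact ⟨a, ha, b, ⟨((cyc_spec hp a).mem_above b).2 hlt, hadj⟩, rfl, rfl⟩

theorem listsEdges_upEdges (hp : GPImmersed hd p) (G : SimpleGraph (Fin n))
    {order : List (Fin n)} (hnd : order.Nodup) (hall : ∀ v, v ∈ order) :
    ListsEdges G (upEdges hd p G order).reverse := by
  constructor
  · refine List.Nodup.map_on ?_ (List.nodup_reverse.2 ?_)
    · rintro ⟨a, b⟩ h ⟨a', b'⟩ h' heq
      rw [List.mem_reverse, mem_upEdges hp] at h h'
      rcases Sym2.eq_iff.1 heq with ⟨h1, h2⟩ | ⟨h1, h2⟩ <;> simp only at h1 h2 <;>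
        subst h1 <;> subst h2
      · rfl
      · exact absurd h.2.2 (lt_asymm h'.2.2)
    · refine List.nodup_flatMap.2 ⟨fun v _ => ?_, hnd.imp (fun {a b} hab => ?_)⟩
      · refine List.Nodup.map (fun u w h => (Prod.mk.inj h).2) (List.Nodup.filter _ ?_)
        exact (cyc_spec hp v).nodup.sublist (List.sublist_append_left _ _)
      · intro e h1 h2
        obtain ⟨u, -, rfl⟩ := List.mem_map.1 h1
        obtain ⟨w, -, h⟩ := List.mem_map.1 h2
        exact hab (Prod.mk.inj h).1.symm
  · intro e
    induction e using Sym2.ind with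
    | _ a b =>
      simp only [List.mem_map, List.mem_reverse, Prod.exists]
      constructor
      · rintro ⟨a', b', h, heq⟩
        rw [← heq]
        exact ((mem_upEdges hp).1 h).2.1
      · intro hadj
        have hadj : G.Adj a b := hadj
        rcases lt_or_gt_of_ne (fun e => hadj.ne (hp.heights e) :
          e₂coord hd (p a) ≠ e₂coord hd (p b)) with hlt | hlt
        · exact ⟨a, b, (mem_upEdges hp).2 ⟨hall a, hadj, hlt⟩, rfl⟩
        · exact ⟨b, a, (mem_upEdges hp).2 ⟨hall b, hadj.symm, hlt⟩, Sym2.eq_swap⟩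

open Classical in
theorem length_upEdges (G : SimpleGraph (Fin n)) (order : List (Fin n)) :
    (upEdges hd p G order).length =
      (order.map (fun v => (aboveList hd p v).countP (fun u => decide (G.Adj v u)))).sum := by
  simp [upEdges, List.length_flatMap, List.countP_eq_length_filter]

open Classical in
/-- The number of splits made by the algorithm. -/
noncomputable def totalSplits (hd : 2 ≤ d) (p : Fin n → EuclideanSpace ℝ (Fin d))
    (G : SimpleGraph (Fin n)) : ℕ :=
  ∑ v, splits (fun u => decide (G.Adj v u)) (aboveList hd p v)

theorem sum_map_order (hp : GPImmersed hd p) (f : Fin n → ℕ) :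
    ((sortByHeight (fun v => e₂coord hd (p v)) (List.finRange n)).val.map f).sum = ∑ v, f v := by
  rw [Fin.sum_univ_def]
  exact ((order_spec hp).2.2.map f).sum_eq

open Classical in
theorem ncard_edgeSet_eq_sum (hp : GPImmersed hd p) (G : SimpleGraph (Fin n)) :
    G.edgeSet.ncard = ∑ v, (aboveList hd p v).countP (fun u => decide (G.Adj v u)) := by
  obtain ⟨h1, h2, h3⟩ := order_spec hp
  rw [(listsEdges_upEdges hp G (h3.nodup_iff.2 (List.nodup_finRange n)) h2).ncard_edgeSet,
    List.length_reverse, length_upEdges, sum_map_order hp]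

theorem length_aboveList_le (hp : GPImmersed hd p) (v : Fin n) :
    (aboveList hd p v).length ≤ n := by
  have := ((cyc_spec hp v).nodup.sublist (List.sublist_append_left _ _)).length_le_card
  simpa using this

theorem totalSplits_le (hp : GPImmersed hd p) (G : SimpleGraph (Fin n)) :
    totalSplits hd p G ≤ G.edgeSet.ncard * Nat.clog 2 n := by
  classical
  rw [ncard_edgeSet_eq_sum hp, Finset.sum_mul, totalSplits]
  refine Finset.sum_le_sum (fun v _ => ?_)
  exact (splits_le _ _).trans
    (Nat.mul_le_mul_left _ (Nat.clog_mono_right 2 (length_aboveList_le hp v)))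

/-- Correctness of the algorithm, and its cost in terms of the number of splits. -/
theorem findEdges_spec (hp : GPImmersed hd p) {G : SimpleGraph (Fin n)}
    {oracle : EuclideanSpace ℝ (Fin d) → APD} (hO : IsOracle p G oracle) (T : ℕ) :
    ListsEdges G (findEdges hd p oracle T).val ∧
    (findEdges hd p oracle T).diagrams = 1 + totalSplits hd p G ∧
    d + T + n ^ 2 + totalSplits hd p G * (2 * d + T + 2 * (Nat.log 2 n + 1)) ≤
      (findEdges hd p oracle T).time ∧
    (findEdges hd p oracle T).time ≤
      d + T + totalSplits hd p G * (2 * d + T + (3 * Nat.log 2 n + 19)) +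
        2 * G.edgeSet.ncard + 18 * n ^ 2 + 2 * (n * Nat.log 2 n) + 18 * n + 1 := by
  classical
  obtain ⟨o1, o2, o3⟩ := order_spec hp
  have hlen : (sortByHeight (fun v => e₂coord hd (p v)) (List.finRange n)).val.length = n := by
    simpa using o3.length_eq
  obtain ⟨s1, s2⟩ := sortByHeight_cost (fun v => e₂coord hd (p v)) (List.finRange n)
  rw [List.length_finRange] at s1
  obtain ⟨c1, c2, c3⟩ := cyclicOrders_spec hp.simple _ o1 o2
  obtain ⟨-, -, -, t4, t5⟩ := minAngle_spec (angleAt := fun u v w =>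
    EuclideanGeometry.angle (proj hd (p u)) (proj hd (p v)) (proj hd (p w))) _ Real.pi
    (sortByHeight (fun v => e₂coord hd (p v)) (List.finRange n)).val
    (fun u v w huv hwv huw => hp.angle_pos huv hwv huw) c1.nodup c1.self_notMem
  have hθ := minAngle_separates hp c1 _ o2
  have hD : IsAPD p G (-(EuclideanSpace.single (⟨1, by omega⟩ : Fin d) (1 : ℝ)))
      (oracle (-(EuclideanSpace.single (⟨1, by omega⟩ : Fin d) (1 : ℝ)))) :=
    hO _ (by simp)
  obtain ⟨w1, w2, w3, w4⟩ := sweep_spec hp hO T hθ _ (fun v => c1.around hp v) hD _ []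
    (fun _ _ => false) (fun _ => False) o1 (fun v _ u _ => Or.inr (o2 u)) (by simp) _ rfl _ _ rfl
    rfl
  rw [hlen] at c2 t4 w4
  have hs := sum_map_order hp
    (fun v => splits (fun u => decide (G.Adj v u)) (aboveList hd p v))
  have hg := sum_map_order hp
    (fun v => (aboveList hd p v).countP (fun u => decide (G.Adj v u)))
  simp only [aboveList] at hs hg
  rw [hs] at w2 w3 w4
  rw [hg] at w4
  have hs' : totalSplits hd p G = ∑ v, splits (fun u => decide (G.Adj v u))
    (((cyclicOrders (fun v => e₁coord hd (p v)) (fun v => e₂coord hd (p v))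
    (sortByHeight (fun v => e₂coord hd (p v)) (List.finRange n)).val).val v).1.toList) := rfl
  have hg' : G.edgeSet.ncard = _ := ncard_edgeSet_eq_sum hp G
  simp only [aboveList] at hg'
  rw [← hs'] at w2 w3 w4
  rw [← hg'] at w4
  simp only [findEdges, Run.val_bind, Run.time_bind, time_tick, Run.diagrams_bind, diagrams_tick,
    val_ask, time_ask, diagrams_ask]
  refine ⟨?_, by omega, by omega, ?_⟩
  · rw [w1, List.append_nil]
    exact listsEdges_upEdges hp G (o3.nodup_iff.2 (List.nodup_finRange n)) o2
  · have e1 : n * (11 * n + 3) = 11 * n ^ 2 + 3 * n := by ring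
    have e2 : n * (2 * n + 3) = 2 * n ^ 2 + 3 * n := by ring
    have e3 : n * (n + 2 * Nat.log 2 n + 9) = n ^ 2 + 2 * (n * Nat.log 2 n) + 9 * n := by ring
    omega

end Sweep

/-! ### Points on the moment curve -/

section MomentCurve
variable {d : ℕ}

/-- The points `(t, t², …, t^d)` of the moment curve with `t = 0, 1, …, n - 1`. -/
noncomputable def momentPoints (d n : ℕ) (i : Fin n) : EuclideanSpace ℝ (Fin d) :=
  WithLp.toLp 2 (fun k : Fin d => (i.val : ℝ) ^ (k.val + 1))

variable {n : ℕ} (hd : 2 ≤ d)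

theorem e₁coord_momentPoints (i : Fin n) : e₁coord hd (momentPoints d n i) = i.val := by
  simp [e₁coord, momentPoints]

theorem e₂coord_momentPoints (i : Fin n) : e₂coord hd (momentPoints d n i) = (i.val : ℝ) ^ 2 := by
  simp [e₂coord, momentPoints]

theorem e₂coord_momentPoints_lt {i j : Fin n} :
    e₂coord hd (momentPoints d n i) < e₂coord hd (momentPoints d n j) ↔ i < j := by
  rw [e₂coord_momentPoints, e₂coord_momentPoints, pow_lt_pow_iff_left₀ (by positivity)
    (by positivity) two_ne_zero, Nat.cast_lt, Fin.lt_def]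

theorem affineIndependent_momentPoints (S : Finset (Fin n)) (hS : S.card = d + 1) :
    AffineIndependent ℝ (fun i : S => momentPoints d n i) := by
  classical
  rw [affineIndependent_iff]
  intro s w hw0 hw1
  have hw1' : ∀ k : Fin d, ∑ i ∈ s, w i * (i.val.val : ℝ) ^ (k.val + 1) = 0 := by
    intro k
    have := congrArg (fun q : EuclideanSpace ℝ (Fin d) => q k) hw1
    simpa [momentPoints] using this
  have hall : ∀ k : Fin (d + 1),
      ∑ i : S, (if i ∈ s then w i else 0) * (i.val.val : ℝ) ^ k.val = 0 := by
    intro k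
    have hsum : ∑ i : S, (if i ∈ s then w i else 0) * (i.val.val : ℝ) ^ k.val =
        ∑ i ∈ s, w i * (i.val.val : ℝ) ^ k.val := by
      simp only [ite_mul, zero_mul, Finset.sum_ite_mem, Finset.univ_inter]
    rw [hsum]
    refine Fin.cases ?_ (fun k => ?_) k
    · simpa using hw0
    · simpa using hw1' k
  let e : Fin (d + 1) ≃ S := (Fintype.equivFinOfCardEq (by simpa using hS)).symm
  have hv := Matrix.eq_zero_of_forall_pow_sum_mul_pow_eq_zero
    (f := fun j : Fin (d + 1) => ((e j).val.val : ℝ))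
    (v := fun j => if e j ∈ s then w (e j) else 0)
    (fun a b hab => e.injective (Subtype.ext (Fin.ext (Nat.cast_injective hab))))
    (fun k => (Equiv.sum_comp e
      (fun i => (if i ∈ s then w i else 0) * (i.val.val : ℝ) ^ k.val)).trans (hall k))
  intro i hi
  have := congrFun hv (e.symm i)
  simpa [hi] using this

theorem gpImmersed_momentPoints : GPImmersed hd (momentPoints d n) := by
  refine ⟨affineIndependent_momentPoints, fun i j k hij hjk hik hcol => ?_, fun i j hij => ?_⟩
  · rw [collinear_iff_of_mem (p₀ := proj hd (momentPoints d n i)) (by simp)] at hcol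
    obtain ⟨v, hv⟩ := hcol
    obtain ⟨r, hr⟩ := hv (proj hd (momentPoints d n j)) (by simp)
    obtain ⟨r', hr'⟩ := hv (proj hd (momentPoints d n k)) (by simp)
    have a0 := congrArg (fun q : EuclideanSpace ℝ (Fin 2) => q 0) hr
    have a1 := congrArg (fun q : EuclideanSpace ℝ (Fin 2) => q 1) hr
    have b0 := congrArg (fun q : EuclideanSpace ℝ (Fin 2) => q 0) hr'
    have b1 := congrArg (fun q : EuclideanSpace ℝ (Fin 2) => q 1) hr'
    simp only [proj, e₁coord_momentPoints, e₂coord_momentPoints] at a0 a1 b0 b1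
    simp at a0 a1 b0 b1
    have hne : ∀ {a b : Fin n}, a ≠ b → (a.val : ℝ) - b.val ≠ 0 := fun hab h =>
      hab (Fin.ext (Nat.cast_injective (sub_eq_zero.1 h)))
    have : ((i.val : ℝ) - j.val) * ((i.val : ℝ) - k.val) * ((j.val : ℝ) - k.val) = 0 := by
      rw [a0, b0] at *
      linear_combination (r' * v 0) * a1 - (r * v 0) * b1
    exact mul_ne_zero (mul_ne_zero (hne hij) (hne hik)) (hne hjk) this
  · rcases lt_trichotomy i j with h | h | h
    · exact absurd hij ((e₂coord_momentPoints_lt hd).2 h).ne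
    · exact h
    · exact absurd hij ((e₂coord_momentPoints_lt hd).2 h).ne'

theorem length_aboveList_momentPoints (v : Fin n) :
    (aboveList hd (momentPoints d n) v).length = n - 1 - v := by
  have h := cyc_spec (gpImmersed_momentPoints (n := n) hd) v
  have hnd := h.nodup.sublist (List.sublist_append_left _ _)
  rw [← List.toFinset_card_of_nodup hnd, ← Fin.card_Ioi]
  congr 1
  ext u
  rw [List.mem_toFinset, h.mem_above, e₂coord_momentPoints_lt, Finset.mem_Ioi]

end MomentCurve

/-! ### Graphs that force many splits -/

section LowerBound
variable {d n : ℕ} {hd : 2 ≤ d} {p : Fin n → EuclideanSpace ℝ (Fin d)}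

open Classical in
/-- The upper neighbours of the vertices may be prescribed independently of each other. -/
theorem exists_graph_of_upper_neighbours (hp : GPImmersed hd p) (q : Fin n → Fin n → Bool) :
    ∃ G : SimpleGraph (Fin n),
      G.edgeSet.ncard = ∑ v, (aboveList hd p v).countP (q v) ∧
      totalSplits hd p G = ∑ v, splits (q v) (aboveList hd p v) := by
  obtain ⟨G, hG⟩ : ∃ G : SimpleGraph (Fin n),
      ∀ v, ∀ u ∈ aboveList hd p v, (G.Adj v u ↔ q v u = true) := by
    refine ⟨{ Adj := fun a b => (e₂coord hd (p a) < e₂coord hd (p b) ∧ q a b = true) ∨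
                (e₂coord hd (p b) < e₂coord hd (p a) ∧ q b a = true)
              symm := ⟨fun a b h => h.symm⟩
              loopless := ⟨fun a h => by simp at h⟩ }, fun v u hu => ?_⟩
    have hlt := ((cyc_spec hp v).mem_above u).1 hu
    constructor
    · rintro (h | h)
      · exact h.2
      · exact absurd hlt (lt_asymm h.1)
    · exact fun h => Or.inl ⟨hlt, h⟩
  refine ⟨G, ?_, ?_⟩
  · rw [ncard_edgeSet_eq_sum hp]
    exact Finset.sum_congr rfl (fun v _ => List.countP_congr (fun u hu => by
      rw [decide_eq_true_eq]
      exact hG v u hu))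
  · exact Finset.sum_congr rfl (fun v _ => splits_congr (fun u hu => by
      rw [Bool.eq_iff_iff, decide_eq_true_eq]
      exact hG v u hu))

theorem sum_min_sub_mul (c m N : ℕ) :
    ∑ v ∈ Finset.range N, min c (m - v * c) = min m (N * c) := by
  induction N with
  | zero => simp
  | succ N ih =>
    rw [Finset.sum_range_succ, ih, add_mul]
    omega

/-- Spreading the edges evenly over the upper halves of the views from the lowest vertices. -/
theorem exists_graph_le_totalSplits (hd : 2 ≤ d) (n m h i j : ℕ) (hm : m ≤ h * 2 ^ j)
    (hhn : h ≤ n) (hij : 2 ^ (j + i) ≤ n - h) :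
    ∃ G : SimpleGraph (Fin n), G.edgeSet.ncard = m ∧
      m * i ≤ totalSplits hd (momentPoints d n) G := by
  classical
  have hp := gpImmersed_momentPoints (n := n) hd
  have key : ∀ v : Fin n, ∃ q : Fin n → Bool,
      (aboveList hd (momentPoints d n) v).countP q = min (2 ^ j) (m - v.val * 2 ^ j) ∧
      min (2 ^ j) (m - v.val * 2 ^ j) * i ≤ splits q (aboveList hd (momentPoints d n) v) := by
    intro v
    by_cases hv : v.val < h
    · refine exists_le_splits i j _ _ ((cyc_spec hp v).nodup.sublist
        (List.sublist_append_left _ _)) (min_le_left _ _) ?_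
      rw [length_aboveList_momentPoints]
      omega
    · have : m - v.val * 2 ^ j = 0 := by
        have := Nat.mul_le_mul_right (2 ^ j) (not_lt.1 hv)
        omega
      exact ⟨fun _ => false, by simp [this], by simp [this]⟩
  choose q hq1 hq2 using key
  obtain ⟨G, hG1, hG2⟩ := exists_graph_of_upper_neighbours hp q
  have hsum : ∑ v : Fin n, min (2 ^ j) (m - v.val * 2 ^ j) = m := by
    rw [Fin.sum_univ_eq_sum_range (fun v => min (2 ^ j) (m - v * 2 ^ j)), sum_min_sub_mul]
    exact min_eq_left (hm.trans (Nat.mul_le_mul_right _ hhn))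
  refine ⟨G, ?_, ?_⟩
  · rw [hG1, Finset.sum_congr rfl (fun v _ => hq1 v), hsum]
  · calc m * i = ∑ v : Fin n, min (2 ^ j) (m - v.val * 2 ^ j) * i := by
          rw [← Finset.sum_mul, hsum]
      _ ≤ totalSplits hd (momentPoints d n) G := by
          rw [hG2]
          exact Finset.sum_le_sum (fun v _ => hq2 v)

theorem exists_graph_ncard (n m : ℕ) (hm : m ≤ n.choose 2) :
    ∃ G : SimpleGraph (Fin n), G.edgeSet.ncard = m := by
  classical
  obtain ⟨S, hS, hcard⟩ := Finset.exists_subset_card_eq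
    (s := (⊤ : SimpleGraph (Fin n)).edgeFinset) (n := m) (by
      rwa [SimpleGraph.card_edgeFinset_top_eq_card_choose_two, Fintype.card_fin])
  refine ⟨SimpleGraph.fromEdgeSet (S : Set (Sym2 (Fin n))), ?_⟩
  have hdiag : (S : Set (Sym2 (Fin n))) \ {e | e.IsDiag} = S := by
    ext e
    simp only [Set.mem_sdiff, Finset.mem_coe, Set.mem_ofPred_eq, and_iff_left_iff_imp]
    intro he
    exact (⊤ : SimpleGraph (Fin n)).not_isDiag_of_mem_edgeFinset (hS he)
  rw [SimpleGraph.edgeSet_fromEdgeSet]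
  have : (S : Set (Sym2 (Fin n))) \ Sym2.diagSet = S := by
    simpa [Sym2.diagSet] using hdiag
  rw [this, Set.ncard_coe_finset, hcard]

end LowerBound

/-! ### Logarithms -/

theorem clog_le_three_mul_log (n : ℕ) : (Nat.clog 2 n : ℝ) ≤ 3 * Real.log n := by
  rcases Nat.lt_or_ge 1 n with hn | hn
  · have hk : 0 < Nat.clog 2 n := Nat.clog_pos one_lt_two hn
    have hlt : (2 : ℝ) ^ (Nat.clog 2 n - 1) ≤ n := by
      exact_mod_cast (Nat.pow_pred_clog_lt_self one_lt_two hn).le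
    have h1 := Real.log_le_log (by positivity) hlt
    rw [Real.log_pow, Nat.cast_sub hk, Nat.cast_one] at h1
    have h2 : Real.log 2 ≤ Real.log n := Real.log_le_log two_pos (by exact_mod_cast hn)
    have h3 := Real.log_two_gt_d9
    have h4 : (0 : ℝ) ≤ Nat.clog 2 n := Nat.cast_nonneg _
    nlinarith
  · rw [Nat.clog_of_right_le_one hn, Nat.cast_zero]
    exact mul_nonneg three_pos.le (Real.log_natCast_nonneg n)

theorem log_le_natLog_add_one {n : ℕ} : Real.log n ≤ Nat.log 2 n + 1 := by
  rcases Nat.eq_zero_or_pos n with rfl | hn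
  · simp
  · have hlt : (n : ℝ) ≤ (2 : ℝ) ^ (Nat.log 2 n + 1) := by
      exact_mod_cast (Nat.lt_pow_succ_log_self one_lt_two n).le
    have h1 := Real.log_le_log (by exact_mod_cast hn) hlt
    rw [Real.log_pow] at h1
    have h2 := Real.log_two_lt_d9
    push_cast at h1
    nlinarith [(Nat.cast_nonneg (Nat.log 2 n) : (0 : ℝ) ≤ Nat.log 2 n)]

theorem two_pow_clog_le {a : ℕ} (ha : 1 ≤ a) : 2 ^ Nat.clog 2 a ≤ 2 * a := by
  rcases Nat.lt_or_ge 1 a with h | h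
  · have hk : 0 < Nat.clog 2 a := Nat.clog_pos one_lt_two h
    have hlt := Nat.pow_pred_clog_lt_self one_lt_two h
    obtain ⟨k, hk'⟩ : ∃ k, Nat.clog 2 a = k + 1 := ⟨Nat.clog 2 a - 1, by omega⟩
    rw [hk', Nat.pred_succ] at hlt
    rw [hk', pow_succ]
    omega
  · rw [Nat.clog_of_right_le_one h]
    omega

section Bounds
variable {d n : ℕ} {hd : 2 ≤ d} {p : Fin n → EuclideanSpace ℝ (Fin d)}

/-! ### The upper bound -/

theorem ncard_edgeSet_le_sq (hp : GPImmersed hd p) (G : SimpleGraph (Fin n)) :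
    G.edgeSet.ncard ≤ n ^ 2 := by
  classical
  rw [ncard_edgeSet_eq_sum hp, sq]
  refine (Finset.sum_le_card_nsmul _ _ n (fun v _ =>
    List.countP_le_length.trans (length_aboveList_le hp v))).trans ?_
  simp

theorem totalSplits_le_mul_log (hp : GPImmersed hd p) (G : SimpleGraph (Fin n)) :
    (totalSplits hd p G : ℝ) ≤ 3 * (G.edgeSet.ncard * Real.log n) := by
  have h1 : (totalSplits hd p G : ℝ) ≤ G.edgeSet.ncard * Nat.clog 2 n := by
    exact_mod_cast totalSplits_le hp G
  have h2 := mul_le_mul_of_nonneg_left (clog_le_three_mul_log n)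
    (Nat.cast_nonneg G.edgeSet.ncard : (0 : ℝ) ≤ _)
  linarith

theorem findEdges_upper_bound (hp : GPImmersed hd p) {G : SimpleGraph (Fin n)}
    {oracle : EuclideanSpace ℝ (Fin d) → APD} (hO : IsOracle p G oracle) (T : ℕ) :
    ((findEdges hd p oracle T).diagrams : ℝ) ≤ 40 * (1 + G.edgeSet.ncard * Real.log n) ∧
    ((findEdges hd p oracle T).time : ℝ) ≤
      40 * ((n : ℝ) ^ 2 + (1 + G.edgeSet.ncard * Real.log n) * (d + T + Real.log n)) := by
  obtain ⟨-, hdg, -, ht⟩ := findEdges_spec hp hO T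
  have hs := totalSplits_le_mul_log hp G
  have hm : (G.edgeSet.ncard : ℝ) ≤ (n : ℝ) ^ 2 := by exact_mod_cast ncard_edgeSet_le_sq hp G
  have hlam := Real.log_natCast_nonneg n
  have hX := mul_nonneg (Nat.cast_nonneg G.edgeSet.ncard : (0 : ℝ) ≤ _) hlam
  have hL : (Nat.log 2 n : ℝ) ≤ 3 * Real.log n :=
    le_trans (by exact_mod_cast Nat.log_le_clog 2 n) (clog_le_three_mul_log n)
  have hnL : (n : ℝ) * Nat.log 2 n ≤ (n : ℝ) ^ 2 := by
    have : n * Nat.log 2 n ≤ n ^ 2 := by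
      rw [sq]
      exact Nat.mul_le_mul_left _ (Nat.log_le_self 2 n)
    exact_mod_cast this
  have hn : (n : ℝ) ≤ (n : ℝ) ^ 2 := by exact_mod_cast Nat.le_self_pow two_ne_zero n
  have hd' : (2 : ℝ) ≤ d := by exact_mod_cast hd
  have hT : (0 : ℝ) ≤ T := Nat.cast_nonneg T
  have ht' : ((findEdges hd p oracle T).time : ℝ) ≤
      d + T + totalSplits hd p G * (2 * d + T + (3 * Nat.log 2 n + 19)) +
        2 * G.edgeSet.ncard + 18 * (n : ℝ) ^ 2 + 2 * (n * Nat.log 2 n) + 18 * n + 1 := by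
    exact_mod_cast ht
  constructor
  · rw [hdg]
    push_cast
    linarith
  · have h1 : (2 * d + T + (3 * Nat.log 2 n + 19) : ℝ) ≤ 12 * (d + T + Real.log n) := by
      linarith
    have h2 : (totalSplits hd p G : ℝ) * (2 * d + T + (3 * Nat.log 2 n + 19)) ≤
        3 * (G.edgeSet.ncard * Real.log n) * (12 * (d + T + Real.log n)) :=
      mul_le_mul hs h1 (by positivity) (by positivity)
    have h3 : 0 ≤ (G.edgeSet.ncard * Real.log n) * (d + T + Real.log n) := by positivity
    linarith

/-! ### The lower bound -/

/-- Once `m log n` is at most `K` times the number of diagrams, all bounds from below follow. -/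
theorem findEdges_lower_bound (hp : GPImmersed hd p) {G : SimpleGraph (Fin n)}
    {oracle : EuclideanSpace ℝ (Fin d) → APD} (hO : IsOracle p G oracle) (T : ℕ) {K : ℝ}
    (hK : 1 ≤ K)
    (hX : G.edgeSet.ncard * Real.log n ≤ K * (1 + totalSplits hd p G)) :
    1 / (2 * K) * (G.edgeSet.ncard * Real.log n) ≤ ((findEdges hd p oracle T).diagrams : ℝ) ∧
    1 / (2 * K) * ((n : ℝ) ^ 2 + (G.edgeSet.ncard * Real.log n) * (d + T + Real.log n)) ≤
      ((findEdges hd p oracle T).time : ℝ) := by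
  obtain ⟨-, hdg, ht, -⟩ := findEdges_spec hp hO T
  have hlam := Real.log_natCast_nonneg n
  have hL : Real.log n ≤ Nat.log 2 n + 1 := log_le_natLog_add_one
  have hn : (n : ℝ) ≤ (n : ℝ) ^ 2 := by exact_mod_cast Nat.le_self_pow two_ne_zero n
  have hln : Real.log n ≤ n := Real.log_le_self (Nat.cast_nonneg n)
  have hs : (0 : ℝ) ≤ totalSplits hd p G := Nat.cast_nonneg _
  have ht' : (d : ℝ) + T + (n : ℝ) ^ 2 +
      totalSplits hd p G * (2 * d + T + 2 * (Nat.log 2 n + 1)) ≤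
      (findEdges hd p oracle T).time := by exact_mod_cast ht
  have hY : 1 / (2 * K) * (G.edgeSet.ncard * Real.log n) ≤ (1 + totalSplits hd p G) / 2 := by
    rw [div_mul_eq_mul_div, one_mul, div_le_div_iff₀ (by positivity) two_pos]
    linarith
  constructor
  · rw [hdg]
    push_cast
    linarith
  · have hc : 1 / (2 * K) ≤ 1 := by
      rw [div_le_one (by positivity)]
      linarith
    have hc' : 1 / (2 * K) ≤ 1 / 2 :=
      one_div_le_one_div_of_le two_pos (by linarith)
    have h1 : 1 / (2 * K) * (n : ℝ) ^ 2 ≤ 1 / 2 * (n : ℝ) ^ 2 :=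
      mul_le_mul_of_nonneg_right hc' (by positivity)
    have h2 := mul_le_mul_of_nonneg_right hY
      (by positivity : (0 : ℝ) ≤ d + T + Real.log n)
    have h3 : (totalSplits hd p G : ℝ) * (d + T + Real.log n) ≤
        totalSplits hd p G * (2 * d + T + 2 * (Nat.log 2 n + 1)) :=
      mul_le_mul_of_nonneg_left (by
        linarith [(Nat.cast_nonneg d : (0 : ℝ) ≤ d),
          (Nat.cast_nonneg (Nat.log 2 n) : (0 : ℝ) ≤ Nat.log 2 n)]) hs
    have h4 : (0 : ℝ) ≤ d := Nat.cast_nonneg d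
    have h5 : (0 : ℝ) ≤ T := Nat.cast_nonneg T
    have h6 : 0 ≤ (totalSplits hd p G : ℝ) * (d + T + Real.log n) := by positivity
    nlinarith

end Bounds

/-- For large `n`, about `n ^ (1 - e)` edges go up from each of the lower vertices, into about as
many different arcs with `n ^ e` vertices or more. -/
theorem exists_graph_mul_log_le {d : ℕ} (hd : 2 ≤ d) {n m : ℕ} {e : ℝ} (he : 0 < e) (he1 : e ≤ 1)
    (hn : 2 ≤ n) (hm : (m : ℝ) ≤ (n : ℝ) ^ (2 - e)) (hlarge : 10 ≤ e * Real.log n) :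
    ∃ G : SimpleGraph (Fin n), G.edgeSet.ncard = m ∧
      m * Real.log n ≤ 2 / e * totalSplits hd (momentPoints d n) G := by
  have hn0 : (0 : ℝ) < n := by positivity
  -- at most `2 ^ j` edges, about `m / h`, go up from each of the lower `h` vertices; they are in
  -- different arcs after `j` levels of the search, and `i` further levels follow
  obtain ⟨h, hh⟩ : ∃ h, h = n / 2 := ⟨_, rfl⟩
  obtain ⟨a, ha⟩ : ∃ a, a = m / h + 1 := ⟨_, rfl⟩
  obtain ⟨j, hj⟩ : ∃ j, j = Nat.clog 2 a := ⟨_, rfl⟩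
  obtain ⟨i, hi⟩ : ∃ i, i = Nat.log 2 ((n - h) / 2 ^ j) := ⟨_, rfl⟩
  have hh0 : 0 < h := by omega
  have haj : a ≤ 2 ^ j := hj ▸ Nat.le_pow_clog one_lt_two a
  have hja : 2 ^ j ≤ 2 * a := hj ▸ two_pow_clog_le (ha ▸ Nat.le_add_left 1 _)
  have hmj : m ≤ h * 2 ^ j :=
    (Nat.lt_mul_div_succ m hh0).le.trans (Nat.mul_le_mul_left _ (ha ▸ haj))
  have hpow : (1 : ℝ) ≤ (n : ℝ) ^ (1 - e) :=
    Real.one_le_rpow (by exact_mod_cast (by omega : 1 ≤ n)) (by linarith)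
  have hmul : (n : ℝ) ^ (2 - e) = n * (n : ℝ) ^ (1 - e) := by
    rw [show (2 - e : ℝ) = 1 + (1 - e) by ring, Real.rpow_add hn0, Real.rpow_one]
  have hale : (a : ℝ) ≤ 4 * (n : ℝ) ^ (1 - e) := by
    have h3 : (n : ℝ) ≤ 3 * h := by exact_mod_cast (by omega : n ≤ 3 * h)
    have hh0' : (0 : ℝ) < h := by exact_mod_cast hh0
    have h4 : ((m / h : ℕ) : ℝ) ≤ 3 * (n : ℝ) ^ (1 - e) := by
      refine Nat.cast_div_le.trans ((div_le_iff₀ hh0').2 ?_)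
      rw [hmul] at hm
      nlinarith
    rw [ha]
    push_cast
    linarith
  have hlt : n - h < 2 ^ (i + 1) * 2 ^ j := by
    rw [← Nat.div_lt_iff_lt_mul (by positivity), hi]
    exact Nat.lt_pow_succ_log_self one_lt_two _
  have hlt' : (n : ℝ) < 32 * 2 ^ i * (n : ℝ) ^ (1 - e) := by
    have h1 : n < 8 * 2 ^ i * a := by
      have : 2 ^ (i + 1) * 2 ^ j ≤ 2 ^ (i + 1) * (2 * a) := Nat.mul_le_mul_left _ hja
      have h' : 2 ^ (i + 1) * (2 * a) = 4 * (2 ^ i * a) := by ring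
      rw [mul_assoc]
      omega
    have h1' : (n : ℝ) < 8 * 2 ^ i * a := by exact_mod_cast h1
    have h2 := mul_le_mul_of_nonneg_left hale (by positivity : (0 : ℝ) ≤ 8 * 2 ^ i)
    linarith
  have hne : (n : ℝ) ^ e < 2 ^ (i + 5) := by
    have h1 : (n : ℝ) = (n : ℝ) ^ e * (n : ℝ) ^ (1 - e) := by
      rw [← Real.rpow_add hn0, add_sub_cancel, Real.rpow_one]
    have h2 : (n : ℝ) ^ e * (n : ℝ) ^ (1 - e) < 32 * 2 ^ i * (n : ℝ) ^ (1 - e) := by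
      rwa [← h1]
    have h3 := lt_of_mul_lt_mul_right h2 (by positivity)
    rw [pow_add]
    linarith
  have hie : e * Real.log n ≤ i + 5 := by
    have h1 := (Real.log_lt_log (by positivity) hne).le
    rw [Real.log_rpow hn0, Real.log_pow] at h1
    push_cast at h1
    have h2 := Real.log_two_lt_d9
    nlinarith [(Nat.cast_nonneg i : (0 : ℝ) ≤ i)]
  have hi0 : 0 < i := by
    have : (0 : ℝ) < i := by linarith
    exact_mod_cast this
  have hij : 2 ^ (j + i) ≤ n - h := by
    have hne0 : (n - h) / 2 ^ j ≠ 0 := fun h0 => by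
      rw [h0, Nat.log_zero_right] at hi
      omega
    have h1 := Nat.pow_log_le_self 2 hne0
    rw [← hi, Nat.le_div_iff_mul_le (by positivity)] at h1
    rw [pow_add, mul_comm]
    exact h1
  obtain ⟨G, hG, hGi⟩ := exists_graph_le_totalSplits hd n m h i j hmj (by omega) hij
  refine ⟨G, hG, ?_⟩
  have hGi' : (m : ℝ) * i ≤ totalSplits hd (momentPoints d n) G := by exact_mod_cast hGi
  have h1 : e * (m * Real.log n) ≤ 2 * (m * i) := by
    have := mul_le_mul_of_nonneg_left (by linarith : e * Real.log n ≤ 2 * i)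
      (Nat.cast_nonneg m : (0 : ℝ) ≤ m)
    linarith
  rw [div_mul_eq_mul_div, le_div_iff₀ he]
  linarith

/-- If `log n ≤ 10 / e`, then `m log n` is bounded and the first diagram alone is enough. -/
theorem mul_log_le_of_log_le {n m : ℕ} {e : ℝ} (hn : 1 ≤ n) (hm : m ≤ n ^ 2)
    (hsmall : e * Real.log n ≤ 10) (he : 0 < e) :
    m * Real.log n ≤ Real.exp (20 / e) * (10 / e) := by
  have hl : Real.log n ≤ 10 / e := by
    rw [le_div_iff₀ he]
    linarith
  have hn0 : (0 : ℝ) < n := by exact_mod_cast hn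
  have h1 : (m : ℝ) ≤ Real.exp (20 / e) := by
    have h2 : (n : ℝ) ≤ Real.exp (10 / e) := (Real.log_le_iff_le_exp hn0).1 hl
    calc (m : ℝ) ≤ (n : ℝ) ^ 2 := by exact_mod_cast hm
      _ ≤ Real.exp (10 / e) ^ 2 := by gcongr
      _ = Real.exp (20 / e) := by
        rw [← Real.exp_nat_mul]
        congr 1
        push_cast
        ring
  exact mul_le_mul h1 hl (Real.log_natCast_nonneg n) (Real.exp_pos _).le

end EdgeRec
theorem mainTheorem1 :
    (∃ C : ℝ, 0 < C ∧
      ∀ (d n : ℕ) (hd : 2 ≤ d) (p : Fin n → EuclideanSpace ℝ (Fin d)) (G : SimpleGraph (Fin n)),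
        EdgeRec.GPImmersed hd p →
        ∀ (oracle : EuclideanSpace ℝ (Fin d) → EdgeRec.APD), EdgeRec.IsOracle p G oracle →
        ∀ T : ℕ,
          EdgeRec.ListsEdges G (EdgeRec.findEdges hd p oracle T).val ∧
          ((EdgeRec.findEdges hd p oracle T).diagrams : ℝ) ≤
            C * (1 + (G.edgeSet.ncard : ℝ) * Real.log n) ∧
          ((EdgeRec.findEdges hd p oracle T).time : ℝ) ≤
            C * ((n : ℝ) ^ 2 +
              (1 + (G.edgeSet.ncard : ℝ) * Real.log n) * ((d : ℝ) + (T : ℝ) + Real.log n))) ∧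
    (∀ ε : ℝ, 0 < ε → ∃ c : ℝ, 0 < c ∧
      ∀ (d n m : ℕ) (hd : 2 ≤ d), 1 ≤ m → m ≤ n.choose 2 → (m : ℝ) ≤ (n : ℝ) ^ (2 - ε) →
        ∃ (p : Fin n → EuclideanSpace ℝ (Fin d)) (G : SimpleGraph (Fin n)),
          EdgeRec.GPImmersed hd p ∧ G.edgeSet.ncard = m ∧
          ∀ (oracle : EuclideanSpace ℝ (Fin d) → EdgeRec.APD), EdgeRec.IsOracle p G oracle →
          ∀ T : ℕ,
            c * ((m : ℝ) * Real.log n) ≤ ((EdgeRec.findEdges hd p oracle T).diagrams : ℝ) ∧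
            c * ((n : ℝ) ^ 2 +
              ((m : ℝ) * Real.log n) * ((d : ℝ) + (T : ℝ) + Real.log n)) ≤
              ((EdgeRec.findEdges hd p oracle T).time : ℝ)) := by
  refine ⟨⟨40, by norm_num, fun d n hd p G hp oracle hO T =>
    ⟨(EdgeRec.findEdges_spec hp hO T).1, EdgeRec.findEdges_upper_bound hp hO T⟩⟩,
    fun ε hε => ?_⟩
  obtain ⟨e, he, he1, heε⟩ : ∃ e : ℝ, 0 < e ∧ e ≤ 1 ∧ e ≤ ε :=
    ⟨min ε 1, lt_min hε one_pos, min_le_right _ _, min_le_left _ _⟩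
  obtain ⟨K, hK⟩ : ∃ K, K = max (2 / e) (Real.exp (20 / e) * (10 / e)) := ⟨_, rfl⟩
  have hK1 : 1 ≤ K := by
    rw [hK]
    refine le_max_of_le_left ?_
    rw [le_div_iff₀ he]
    linarith
  refine ⟨1 / (2 * K), by positivity, fun d n m hd hm1 hmc hmε => ?_⟩
  -- a graph with an edge has two vertices
  have hn : 2 ≤ n := by
    by_contra hlt
    rw [Nat.choose_eq_zero_of_lt (by omega)] at hmc
    omega
  have hm : (m : ℝ) ≤ (n : ℝ) ^ (2 - e) := hmε.trans
    (Real.rpow_le_rpow_of_exponent_le (by exact_mod_cast (by omega : 1 ≤ n)) (by linarith))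
  have hp := EdgeRec.gpImmersed_momentPoints (n := n) hd
  obtain ⟨G, hG, hX⟩ : ∃ G : SimpleGraph (Fin n), G.edgeSet.ncard = m ∧
      m * Real.log n ≤ K * (1 + EdgeRec.totalSplits hd (EdgeRec.momentPoints d n) G) := by
    rcases le_total 10 (e * Real.log n) with hl | hl
    · obtain ⟨G, hG, h⟩ := EdgeRec.exists_graph_mul_log_le hd he he1 hn hm hl
      refine ⟨G, hG, h.trans ?_⟩
      exact mul_le_mul (hK ▸ le_max_left _ _) (by linarith) (Nat.cast_nonneg _) (by linarith)
    · obtain ⟨G, hG⟩ := EdgeRec.exists_graph_ncard n m hmc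
      refine ⟨G, hG, ?_⟩
      have h := EdgeRec.mul_log_le_of_log_le (by omega)
        (hmc.trans (Nat.choose_le_pow n 2)) hl he
      have h' : m * Real.log n ≤ K := h.trans (hK ▸ le_max_right _ _)
      exact h'.trans (le_mul_of_one_le_right (by linarith)
        (le_add_of_nonneg_right (Nat.cast_nonneg _)))
  refine ⟨EdgeRec.momentPoints d n, G, hp, hG, fun oracle hO T => ?_⟩
  subst hG
  exact EdgeRec.findEdges_lower_bound hp hO T hK1 hX
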